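/- Let $G$ be a $3$-dimensional non-unimodular Lie group with Lie algebra $\mathfrak g$, and let $\mathfrak g_0=\{x\in\mathfrak g:\operatorname{tr}(\operatorname{ad}_x)=0\}$ be its unimodular kernel. **Definitions.** For left-invariant forms $H\in\Omega^3(G)$, $F\in\Omega^2(G)$ with $dF=0$ and $dH=-F\wedge F$, let $E_{H,F}=TG\oplus T^*G\oplus\mathbb R$ be the Courant algebroid of type $B_3$ with scalar product $\langle X+\xi+\lambda,Y+\eta+\mu\rangle=\frac12(\eta(X)+\xi(Y))+\lambda\mu$, anchor the projection $\pi$ to $TG$, and Dorfman bracket $$[X+\xi+\lambda,Y+\eta+\mu]=\mathcal L_XY+\mathcal L_X\eta-i_Yd\xi+2\mu\,d\lambda+i_Xi_YH-2(\mu\, i_XF-\lambda\, i_YF)+X(\mu)-Y(\lambda)+F(X,Y).$$ A (admissible) generalized metric is a rank $3$ subbundle $E_-\subset E_{H,F}$ on which $\langle\cdot,\cdot\rangle$ is non-degenerate and $\pi|_{E_-}:E_-\to TG$ is an isomorphism; put $E_+=E_-^\perp$ and $\mathcal G^{\mathrm{end}}|_{E_\pm}=\pm\mathrm{Id}$. A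 $B_3$-generalized complex structure is a skew-symmetric $\mathcal F\in\Gamma(\operatorname{End}E_{H,F})$ for which there is a section $u_0$ with $\langle u_0,u_0\rangle=-1$, $\mathcal Fu_0=0$, $\mathcal F^2=-\mathrm{Id}-\langle\cdot,u_0\rangle u_0$, and such that the sections of its $i$-eigenbundle are closed under the Dorfman bracket. A $B_3$-generalized pseudo-Kähler structure is a pair $(\mathcal G,\mathcal F)$ consisting of a generalized metric and an endomorphism $\mathcal F$ commuting with $\mathcal G^{\mathrm{end}}$ such that $\mathcal F$ and $\mathcal G^{\mathrm{end}}\mathcal F$ are both $B_3$-generalized complex structures. When $E_-=\{X-g(X,\cdot)\}$ is in standard form, with $g$ the pseudo-Riemannian metric given by $g(X,Y)=-\langle X-g(X,\cdot),Y-g(Y,\cdot)\rangle$, the components $(g,J_+,J_-,X_+,X_-)$ of $(\mathcal G,\mathcal F)$ are determined (up to the sign of $X_-$) by: $\mathcal F(X-g(X,\cdot))=J_-X-g(J_-X,\cdot)$; $X_--g(X_-,\cdot)\in\ker\mathcal F$ has scalar square $-1$; and $\mathcal F(X+g(X,\cdot)+a)=Y+g(Y,\cdot)-g(X_+,X)$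 with $Y=J_+X+aX_+$. The structure is left-invariant if $H$, $F$ and all components are left-invariant; these are then regarded as tensors on $\mathfrak g$. **Statement.** 1. There is a left-invariant $B_3$-generalized pseudo-Kähler structure on some left-invariant $E_{H,F}$ over $G$, with components $(g,J_+,J_-,X_+,X_-)$ such that $\mathfrak g_0^{\perp}\cap\mathfrak g_0=0$ (orthogonal complement with respect to $g$), if and only if $\mathfrak g\cong\mathbb R\oplus\mathfrak{sol}_2$, where $\mathfrak{sol}_2$ is the non-abelian $2$-dimensional real Lie algebra. 2. Left-invariant forms $H,F$ and left-invariant tensors $(g,J_+,J_-,X_+,X_-)$ arise from such a structure (with $\mathfrak g_0^{\perp}\cap\mathfrak g_0=0$) if and only if $H=0$, $F=0$ and there are a basis $\{w_1,w_2,w_3\}$ of $\mathfrak g$, $\delta\in\mathbb R\setminus\{0\}$ and $\epsilon,\epsilon'\in\{\pm1\}$ such that $$[w_1,w_2]=w_2,\qquad [w_1,w_3]=[w_2,w_3]=0,$$ $$g(w_1,w_1)=\frac{\epsilon}{\delta^2},\quad g(w_2,w_2)=\epsilon',\quad g(w_3,w_3)=1,\quad g(w_i,w_j)=0\ (i\ne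 j),$$ $X_-=w_3$, $X_+=\pm X_-$, and $J_\pm$ are $g$-skew-symmetric endomorphisms with $J_\pm X_\pm=0$ that are complex structures on $X_\pm^\perp$ (and are otherwise arbitrary). 3. Given a basis $\{w_1,w_2,w_3\}$ with the above brackets, $\delta\in\mathbb R\setminus\{0\}$, $\epsilon,\epsilon'\in\{\pm1\}$ and a choice of sign in $X_+=\pm X_-$, a structure as in 2. with these parameters exists (equivalently, admissible $J_\pm$ exist) if and only if $\epsilon=\epsilon'$. -/

import Mathlib

open scoped Manifold ContDiff

noncomputable section

/-! ### The Lie algebra `ℝ ⊕ sol₂` -/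

/-- The one-dimensional (abelian) real Lie algebra. -/
def LieLine : Type := ℝ

instance : AddCommGroup LieLine := inferInstanceAs (AddCommGroup ℝ)
instance : Module ℝ LieLine := inferInstanceAs (Module ℝ ℝ)

instance : LieRing LieLine where
  bracket _ _ := 0
  add_lie _ _ _ := (add_zero _).symm
  lie_add _ _ _ := (add_zero _).symm
  lie_self _ := rfl
  leibniz_lie _ _ _ := (add_zero _).symm

instance : LieAlgebra ℝ LieLine where
  lie_smul _ _ _ := (smul_zero _).symm

/-- The non-abelian two-dimensional real Lie algebra `sol₂`, on `ℝ²`: `[e₁, e₂] = e₂`. -/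
def LieSol2 : Type := ℝ × ℝ

instance : AddCommGroup LieSol2 := inferInstanceAs (AddCommGroup (ℝ × ℝ))
instance : Module ℝ LieSol2 := inferInstanceAs (Module ℝ (ℝ × ℝ))

instance : LieRing LieSol2 where
  bracket x y := ((0, x.1 * y.2 - x.2 * y.1) : ℝ × ℝ)
  add_lie x y z := Prod.ext (add_zero _).symm
    (show (x.1 + y.1) * z.2 - (x.2 + y.2) * z.1 =
      (x.1 * z.2 - x.2 * z.1) + (y.1 * z.2 - y.2 * z.1) by ring)
  lie_add x y z := Prod.ext (add_zero _).symm
    (show x.1 * (y.2 + z.2) - x.2 * (y.1 + z.1) =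
      (x.1 * y.2 - x.2 * y.1) + (x.1 * z.2 - x.2 * z.1) by ring)
  lie_self x := Prod.ext rfl (show x.1 * x.2 - x.2 * x.1 = 0 by ring)
  leibniz_lie x y z := Prod.ext (add_zero _).symm
    (show x.1 * (y.1 * z.2 - y.2 * z.1) - x.2 * 0 =
      (0 * z.2 - (x.1 * y.2 - x.2 * y.1) * z.1) + (y.1 * (x.1 * z.2 - x.2 * z.1) - y.2 * 0) by ring)

instance : LieAlgebra ℝ LieSol2 where
  lie_smul t x y := Prod.ext (smul_zero _).symm
    (show x.1 * (t * y.2) - x.2 * (t * y.1) = t * (x.1 * y.2 - x.2 * y.1) by ring)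

/-! ### Smooth tensor fields on an `n`-dimensional Lie group -/

/-- A smooth Lie group is in particular of the smoothness class for which Mathlib constructs the
Lie bracket on its Lie algebra. -/
instance instLieGroupMinSmoothness {n : ℕ} {G : Type*} [TopologicalSpace G]
    [ChartedSpace (EuclideanSpace ℝ (Fin n)) G] [Group G] [LieGroup (𝓡 n) ∞ G] :
    LieGroup (𝓡 n) (minSmoothness ℝ 3) G :=
  LieGroup.of_le (n := ∞)
    (by rw [minSmoothness_of_isRCLikeNormedField]; exact WithTop.coe_le_coe.2 le_top)

namespace BGen

section Manifold

variable {n : ℕ} {G : Type*} [TopologicalSpace G] [ChartedSpace (EuclideanSpace ℝ (Fin n)) G]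

variable (n G) in
/-- Vector fields (not necessarily smooth). -/
abbrev VecField : Type _ := Π p : G, TangentSpace (𝓡 n) p

variable (n G) in
/-- One-forms (not necessarily smooth). -/
abbrev OneForm : Type _ := Π p : G, Module.Dual ℝ (TangentSpace (𝓡 n) p)

variable (n G) in
/-- Differential `k`-forms (not necessarily smooth). -/
abbrev DiffForm (k : ℕ) : Type _ := Π p : G, (TangentSpace (𝓡 n) p) [⋀^Fin k]→ₗ[ℝ] ℝ

variable (n G) in
/-- Fields of endomorphisms of the tangent bundle. -/
abbrev EndField : Type _ := Π p : G, TangentSpace (𝓡 n) p →ₗ[ℝ] TangentSpace (𝓡 n) p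

variable (n G) in
/-- Fields of bilinear forms on the tangent bundle. -/
abbrev BilinField : Type _ :=
  Π p : G, TangentSpace (𝓡 n) p →ₗ[ℝ] TangentSpace (𝓡 n) p →ₗ[ℝ] ℝ

variable [IsManifold (𝓡 n) ∞ G]

/-- Smoothness of a function. -/
def SmoothFun (n : ℕ) {G : Type*} [TopologicalSpace G]
    [ChartedSpace (EuclideanSpace ℝ (Fin n)) G] (f : G → ℝ) : Prop :=
  ContMDiff (𝓡 n) 𝓘(ℝ, ℝ) ∞ f

/-- Smoothness of a vector field, as a section of the tangent bundle. -/
def SmoothVec (X : VecField n G) : Prop :=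
  ContMDiff (𝓡 n) (𝓡 n).tangent ∞ (fun p => (⟨p, X p⟩ : TangentBundle (𝓡 n) G))

/-- Smoothness of a one-form: its values on smooth vector fields are smooth. -/
def SmoothOneForm (ξ : OneForm n G) : Prop :=
  ∀ X : VecField n G, SmoothVec X → SmoothFun n (fun p => ξ p (X p))

/-- Smoothness of a `k`-form: its values on smooth vector fields are smooth. -/
def SmoothForm {k : ℕ} (α : DiffForm n G k) : Prop :=
  ∀ X : Fin k → VecField n G, (∀ i, SmoothVec (X i)) → SmoothFun n (fun p => α p (fun i => X i p))

/-- The derivative `X(f)` of a function along a vector field. -/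
def der (X : VecField n G) (f : G → ℝ) : G → ℝ := fun p => mvfderiv (𝓡 n) f p (X p)

/-- The Lie bracket `[X, Y]` of vector fields. -/
def bra (X Y : VecField n G) : VecField n G := VectorField.mlieBracket (𝓡 n) X Y

/-- `(𝓛_X η)(Z) = X(η(Z)) - η([X, Z])`. -/
def lieDerivOneForm (X : VecField n G) (η : OneForm n G) (Z : VecField n G) : G → ℝ :=
  fun p => der X (fun q => η q (Z q)) p - η p (bra X Z p)

/-- `(dξ)(Y, Z) = Y(ξ(Z)) - Z(ξ(Y)) - ξ([Y, Z])`. -/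
def dOneForm (ξ : OneForm n G) (Y Z : VecField n G) : G → ℝ :=
  fun p => der Y (fun q => ξ q (Z q)) p - der Z (fun q => ξ q (Y q)) p - ξ p (bra Y Z p)

/-- The exterior derivative of a 2-form, evaluated on vector fields. -/
def dTwoForm (F : DiffForm n G 2) (X Y Z : VecField n G) : G → ℝ := fun p =>
  der X (fun q => F q ![Y q, Z q]) p - der Y (fun q => F q ![X q, Z q]) p
    + der Z (fun q => F q ![X q, Y q]) p
    - F p ![bra X Y p, Z p] + F p ![bra X Z p, Y p] - F p ![bra Y Z p, X p]

/-- The exterior derivative of a 3-form, evaluated on vector fields. -/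
def dThreeForm (H : DiffForm n G 3) (X Y Z W : VecField n G) : G → ℝ := fun p =>
  der X (fun q => H q ![Y q, Z q, W q]) p - der Y (fun q => H q ![X q, Z q, W q]) p
    + der Z (fun q => H q ![X q, Y q, W q]) p - der W (fun q => H q ![X q, Y q, Z q]) p
    - H p ![bra X Y p, Z p, W p] + H p ![bra X Z p, Y p, W p] - H p ![bra X W p, Y p, Z p]
    - H p ![bra Y Z p, X p, W p] + H p ![bra Y W p, X p, Z p] - H p ![bra Z W p, X p, Y p]

/-- `(F ∧ F)(X, Y, Z, W)`. -/
def wedgeSq (F : DiffForm n G 2) (X Y Z W : VecField n G) : G → ℝ := fun p =>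
  2 * (F p ![X p, Y p] * F p ![Z p, W p] - F p ![X p, Z p] * F p ![Y p, W p]
    + F p ![X p, W p] * F p ![Y p, Z p])

/-- The data `(H, F)` of a Courant algebroid `E_{H,F}` of type `B_n`: smooth forms with `dF = 0`
and `dH = - F ∧ F`. -/
structure IsTwist (H : DiffForm n G 3) (F : DiffForm n G 2) : Prop where
  smooth_H : SmoothForm H
  smooth_F : SmoothForm F
  closed_F : ∀ X Y Z : VecField n G, SmoothVec X → SmoothVec Y → SmoothVec Z →
    ∀ p, dTwoForm F X Y Z p = 0
  d_H : ∀ X Y Z W : VecField n G, SmoothVec X → SmoothVec Y → SmoothVec Z → SmoothVec W →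
    ∀ p, dThreeForm H X Y Z W p = - wedgeSq F X Y Z W p

/-! ### The bundle `E = TG ⊕ T*G ⊕ ℝ` -/

variable (n) in
/-- The fibre at `p` of `E = TG ⊕ T*G ⊕ ℝ`; the triple `(X, ξ, l)` stands for `X + ξ + l`. -/
abbrev Fibre (p : G) : Type _ :=
  TangentSpace (𝓡 n) p × Module.Dual ℝ (TangentSpace (𝓡 n) p) × ℝ

variable (n G) in
/-- Sections of `E` (not necessarily smooth). The anchor is the first projection. -/
abbrev Sec : Type _ := Π p : G, Fibre n p

variable (n G) in
/-- Fields of endomorphisms of `E` (not necessarily smooth). -/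
abbrev EndE : Type _ := Π p : G, Fibre n p →ₗ[ℝ] Fibre n p

/-- The scalar product `⟨X + ξ + l, Y + η + m⟩ = (η(X) + ξ(Y)) / 2 + l m` on `E`. -/
def sp {p : G} (u v : Fibre n p) : ℝ := (1 / 2) * (v.2.1 u.1 + u.2.1 v.1) + u.2.2 * v.2.2

/-- Smoothness of a section of `E`. -/
structure SmoothSec (u : Sec n G) : Prop where
  vec : SmoothVec (fun p => (u p).1)
  cov : SmoothOneForm (fun p => (u p).2.1)
  fn : SmoothFun n (fun p => (u p).2.2)

/-- Smoothness of a field of endomorphisms of `E`: smooth sections are mapped to smooth sections. -/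
def SmoothEnd (A : EndE n G) : Prop := ∀ u : Sec n G, SmoothSec u → SmoothSec (fun p => A p (u p))

end Manifold

section LieGroup

variable {n : ℕ} {G : Type*} [TopologicalSpace G] [ChartedSpace (EuclideanSpace ℝ (Fin n)) G]
  [Group G]

/-! ### Left-invariant frame and left-invariant tensors -/

/-- Left translation by `p`, as a linear map from the Lie algebra to the tangent space at `p`. -/
def leftMap (p : G) : GroupLieAlgebra (𝓡 n) G →ₗ[ℝ] TangentSpace (𝓡 n) p where
  toFun x := mulInvariantVectorField x p
  map_add' x y := congrFun (mulInvariantVectorField_add x y) p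
  map_smul' c x := congrFun (mulInvariantVectorField_smul c x) p

variable [LieGroup (𝓡 n) ∞ G]

theorem leftMap_bijective (p : G) : Function.Bijective (leftMap (n := n) p) := by
  have hinj : Function.Injective (leftMap (n := n) p) := by
    refine (injective_iff_map_eq_zero (leftMap (n := n) p)).2 fun x hx => ?_
    have hd : ∀ q r : G, MDifferentiableAt (𝓡 n) (𝓡 n) (fun a : G => q * a) r := fun q r =>
      (contMDiff_mul_left (I := 𝓡 n) (n := ∞)).contMDiffAt.mdifferentiableAt (by simp)
    have hc := mfderiv_comp (I := 𝓡 n) (I' := 𝓡 n) (I'' := 𝓡 n) (1 : G) (hd p⁻¹ (p * 1)) (hd p 1)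
    have hid : (fun a : G => p⁻¹ * a) ∘ (fun a : G => p * a) = id := by
      funext a; simp
    rw [hid, mfderiv_id] at hc
    have hx' : mfderiv (𝓡 n) (𝓡 n) (fun a : G => p * a) 1 x = 0 := hx
    have h := DFunLike.congr_fun hc x
    refine h.trans ?_
    exact (congrArg (mfderiv (𝓡 n) (𝓡 n) (fun a : G => p⁻¹ * a) (p * 1)) hx').trans (map_zero _)
  have : FiniteDimensional ℝ (GroupLieAlgebra (𝓡 n) G) :=
    inferInstanceAs (FiniteDimensional ℝ (EuclideanSpace ℝ (Fin n)))
  let f : GroupLieAlgebra (𝓡 n) G →ₗ[ℝ] GroupLieAlgebra (𝓡 n) G := leftMap (n := n) p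
  have hf : Function.Injective f := hinj
  exact ⟨hinj, LinearMap.surjective_of_injective hf⟩

variable (n) in
/-- The basis of the tangent space at `p` obtained from the standard basis of the Lie algebra by
left translation. -/
def leftFrame (p : G) : Module.Basis (Fin n) ℝ (TangentSpace (𝓡 n) p) :=
  (show Module.Basis (Fin n) ℝ (GroupLieAlgebra (𝓡 n) G) from
    (EuclideanSpace.basisFun (Fin n) ℝ).toBasis).map
    (LinearEquiv.ofBijective (leftMap p) (leftMap_bijective p))

variable (n G) in
/-- The left-invariant vector fields that make up the left-invariant frame. -/
def frameField (i : Fin n) : VecField n G := fun p => leftFrame n p i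

/-- A vector field is left-invariant. -/
def LeftInvVec (X : VecField n G) : Prop := ∀ p, X p = mulInvariantVectorField (X 1) p

/-- A field of endomorphisms of the tangent bundle is left-invariant. -/
def LeftInvEnd (J : EndField n G) : Prop :=
  ∀ (p : G) (x : GroupLieAlgebra (𝓡 n) G),
    J p (mulInvariantVectorField x p) = mulInvariantVectorField (J 1 x) p

/-- A field of bilinear forms on the tangent bundle is left-invariant. -/
def LeftInvBilin (g : BilinField n G) : Prop :=
  ∀ (p : G) (x y : GroupLieAlgebra (𝓡 n) G),
    g p (mulInvariantVectorField x p) (mulInvariantVectorField y p) = g 1 x y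

/-- A differential form is left-invariant. -/
def LeftInvForm {k : ℕ} (α : DiffForm n G k) : Prop :=
  ∀ (p : G) (x : Fin k → GroupLieAlgebra (𝓡 n) G),
    α p (fun i => mulInvariantVectorField (x i) p) = α 1 x

/-! ### The Dorfman bracket -/

/-- The value on the vector field `Z` of the `T*G`-component of the Dorfman bracket
`[X + ξ + l, Y + η + m]` twisted by `(H, F)`:
`𝓛_X η - i_Y dξ + 2 m dl + i_X i_Y H - 2 (m i_X F - l i_Y F)`. -/
def dorfmanCov (H : DiffForm n G 3) (F : DiffForm n G 2) (u v : Sec n G) (Z : VecField n G) :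
    G → ℝ := fun p =>
  lieDerivOneForm (fun q => (u q).1) (fun q => (v q).2.1) Z p
    - dOneForm (fun q => (u q).2.1) (fun q => (v q).1) Z p
    + 2 * (v p).2.2 * der Z (fun q => (u q).2.2) p
    + H p ![(v p).1, (u p).1, Z p]
    - 2 * ((v p).2.2 * F p ![(u p).1, Z p] - (u p).2.2 * F p ![(v p).1, Z p])

/-- The Dorfman bracket `[X + ξ + l, Y + η + m]` on sections of `E`, twisted by `(H, F)`. Its
`TG`-component is `[X, Y]`, its `ℝ`-component is `X(m) - Y(l) + F(X, Y)`, and its `T*G`-component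
is the one-form whose values on the left-invariant frame are given by `dorfmanCov`
(on smooth sections `dorfmanCov` is tensorial in `Z`, so the frame is immaterial). -/
def dorfman (H : DiffForm n G 3) (F : DiffForm n G 2) (u v : Sec n G) : Sec n G := fun p =>
  (bra (fun q => (u q).1) (fun q => (v q).1) p,
   (leftFrame n p).constr ℝ (fun i => dorfmanCov H F u v (frameField n G i) p),
   der (fun q => (u q).1) (fun q => (v q).2.2) p - der (fun q => (v q).1) (fun q => (u q).2.2) p
     + F p ![(u p).1, (v p).1])

/-! ### `B_n`-generalized pseudo-Kähler structures -/

/-- A generalized metric, given by the field `Γ` of orthogonal involutions of `E` with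
`(-1)`-eigenbundle `E₋` and `(+1)`-eigenbundle `E₊ = E₋^⊥`. It is admissible: the anchor restricts to
an isomorphism from `E₋` to the tangent bundle (so `E₋` has rank `n`). -/
structure IsGenMetric (Γ : EndE n G) : Prop where
  smooth : SmoothEnd Γ
  invol : ∀ (p : G) (u : Fibre n p), Γ p (Γ p u) = u
  orth : ∀ (p : G) (u v : Fibre n p), sp (Γ p u) (Γ p v) = sp u v
  admissible : ∀ (p : G) (x : TangentSpace (𝓡 n) p), ∃! u : Fibre n p, Γ p u = -u ∧ u.1 = x

/-- A `B_n`-generalized almost complex structure, given by the field `𝓕` of skew-symmetric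
endomorphisms of `E` with `𝓕 u₀ = 0` and `𝓕² = - Id + (-1)ⁿ ⟨·, u₀⟩ u₀` for a section `u₀` with
`⟨u₀, u₀⟩ = (-1)ⁿ`. Equivalently, the `i`-eigenbundle `L` of `𝓕` is isotropic of complex rank `n`
with `L ∩ L̄ = 0`, and `𝓕` vanishes on the orthogonal complement of `L ⊕ L̄`. -/
structure IsGenAlmostComplex (𝓕 : EndE n G) : Prop where
  smooth : SmoothEnd 𝓕
  skew : ∀ (p : G) (u v : Fibre n p), sp (𝓕 p u) v = - sp u (𝓕 p v)
  square : ∃ u₀ : Sec n G, SmoothSec u₀ ∧ ∀ p : G,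
    sp (u₀ p) (u₀ p) = (-1 : ℝ) ^ n ∧ 𝓕 p (u₀ p) = 0 ∧
    ∀ u : Fibre n p, 𝓕 p (𝓕 p u) = -u + ((-1 : ℝ) ^ n * sp u (u₀ p)) • u₀ p

/-- The complex section `a + i b` of the complexified bundle lies in the `i`-eigenbundle `L` of `𝓕`,
i.e. `𝓕 (a + i b) = i (a + i b)`. -/
def InL (𝓕 : EndE n G) (a b : Sec n G) : Prop := ∀ p, 𝓕 p (a p) = - b p ∧ 𝓕 p (b p) = a p

/-- Integrability of `𝓕` on `E_{H,F}`: the smooth sections of the `i`-eigenbundle `L` are closed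
under the complex bilinear extension
`[a + i b, c + i d] = ([a, c] - [b, d]) + i ([a, d] + [b, c])` of the Dorfman bracket
(the bracket of smooth sections is automatically smooth). -/
def IsIntegrable (H : DiffForm n G 3) (F : DiffForm n G 2) (𝓕 : EndE n G) : Prop :=
  ∀ a b c d : Sec n G, SmoothSec a → SmoothSec b → SmoothSec c → SmoothSec d →
    InL 𝓕 a b → InL 𝓕 c d →
    InL 𝓕 (dorfman H F a c - dorfman H F b d) (dorfman H F a d + dorfman H F b c)

/-- A `B_n`-generalized complex structure on `E_{H,F}`. -/
def IsGenComplex (H : DiffForm n G 3) (F : DiffForm n G 2) (𝓕 : EndE n G) : Prop :=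
  IsGenAlmostComplex 𝓕 ∧ IsIntegrable H F 𝓕

/-- A `B_n`-generalized pseudo-Kähler structure on `E_{H,F}`: a generalized metric and an
endomorphism `𝓕` that commute, such that both `𝓕` and the composition are `B_n`-generalized complex
structures. -/
structure IsGenPseudoKahler (H : DiffForm n G 3) (F : DiffForm n G 2) (Γ 𝓕 : EndE n G) : Prop where
  metric : IsGenMetric Γ
  comm : ∀ (p : G) (u : Fibre n p), Γ p (𝓕 p u) = 𝓕 p (Γ p u)
  complex₁ : IsGenComplex H F 𝓕
  complex₂ : IsGenComplex H F (fun p => Γ p ∘ₗ 𝓕 p)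

/-- For odd `n`: the generalized metric is in the standard form `E₋ = {X - g(X, ·)}`, and
`(g, J₊, J₋, X₊, X₋)` are the components of `(Γ, 𝓕)`. Under `E₋ ≅ TG`, `X - g(X, ·) ↦ X`, the
negative of the scalar product is `g`, the restriction of `𝓕` is `J₋`, and `X₋` comes from a section
`u₋` of `ker 𝓕` with `⟨u₋, u₋⟩ = -1`; under `E₊ ≅ TG ⊕ ℝ`, `X + g(X, ·) + a ↦ X + a`, the
restriction of `𝓕` maps `X + a` to `J₊ X + a X₊ - g(X₊, X)`. -/
structure IsComponents (Γ 𝓕 : EndE n G) (g : BilinField n G) (Jp Jm : EndField n G)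
    (Xp Xm : VecField n G) : Prop where
  standard : ∀ (p : G) (u : Fibre n p),
    Γ p u = -u ↔ ∃ x : TangentSpace (𝓡 n) p, u = (x, - g p x, 0)
  metric : ∀ (p : G) (x y : TangentSpace (𝓡 n) p),
    g p x y = - sp (p := p) (x, - g p x, 0) (y, - g p y, 0)
  minus : ∀ (p : G) (x : TangentSpace (𝓡 n) p),
    𝓕 p (x, - g p x, 0) = (Jm p x, - g p (Jm p x), 0)
  plus : ∀ (p : G) (x : TangentSpace (𝓡 n) p) (a : ℝ),
    𝓕 p (x, g p x, a) = (Jp p x + a • Xp p, g p (Jp p x + a • Xp p), - g p (Xp p) x)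
  kernel : ∀ p : G, 𝓕 p (Xm p, - g p (Xm p), 0) = 0
  normalized : ∀ p : G, sp (p := p) (Xm p, - g p (Xm p), 0) (Xm p, - g p (Xm p), 0) = -1

/-- For odd `n`: `(Γ, 𝓕)` is a left-invariant `B_n`-generalized pseudo-Kähler structure on the
left-invariant Courant algebroid `E_{H,F}`, with components `(g, J₊, J₋, X₊, X₋)`. -/
structure IsLeftInvGPK (H : DiffForm n G 3) (F : DiffForm n G 2) (Γ 𝓕 : EndE n G)
    (g : BilinField n G) (Jp Jm : EndField n G) (Xp Xm : VecField n G) : Prop where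
  twist : IsTwist H F
  left_H : LeftInvForm H
  left_F : LeftInvForm F
  kahler : IsGenPseudoKahler H F Γ 𝓕
  components : IsComponents Γ 𝓕 g Jp Jm Xp Xm
  left_g : LeftInvBilin g
  left_Jp : LeftInvEnd Jp
  left_Jm : LeftInvEnd Jm
  left_Xp : LeftInvVec Xp
  left_Xm : LeftInvVec Xm

/-! ### Lie algebra notions -/

variable (n G) in
/-- The linear form `x ↦ trace (ad x)` on the Lie algebra of `G`. -/
def traceAd : GroupLieAlgebra (𝓡 n) G →ₗ[ℝ] ℝ :=
  LinearMap.trace ℝ (GroupLieAlgebra (𝓡 n) G) ∘ₗ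
    (LieAlgebra.ad ℝ (GroupLieAlgebra (𝓡 n) G) :
      GroupLieAlgebra (𝓡 n) G →ₗ[ℝ] Module.End ℝ (GroupLieAlgebra (𝓡 n) G))

variable (n G) in
/-- The unimodular kernel `𝔤₀ = {x : trace (ad x) = 0}`. -/
def unimodularKernel : Submodule ℝ (GroupLieAlgebra (𝓡 n) G) := LinearMap.ker (traceAd n G)

variable (n G) in
/-- `G` is unimodular: `trace (ad x) = 0` for all `x`. -/
def IsUnimodular : Prop := ∀ x, traceAd n G x = 0

/-- `𝔤₀^⊥ ∩ 𝔤₀ = 0` with respect to `g`. -/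
def KernelNondegenerate (g : BilinField n G) : Prop :=
  ∀ x ∈ unimodularKernel n G, (∀ y ∈ unimodularKernel n G, g 1 x y = 0) → x = 0

/-- `J` is `g`-skew-symmetric, `J X = 0`, and `J` restricts to a complex structure on the
`g`-orthogonal complement of `X` (which it preserves, by skew-symmetry). -/
def IsAdaptedTo (g : BilinField n G) (J : EndField n G) (X : VecField n G) : Prop :=
  ∀ p : G, (∀ x y : TangentSpace (𝓡 n) p, g p (J p x) y = - g p x (J p y)) ∧ J p (X p) = 0 ∧
    ∀ x : TangentSpace (𝓡 n) p, g p x (X p) = 0 → J p (J p x) = -x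

/-- The brackets `[w₁, w₂] = w₂`, `[w₁, w₃] = [w₂, w₃] = 0` (with indices starting at `0`). -/
def IsStandardBasis {G : Type*} [TopologicalSpace G] [ChartedSpace (EuclideanSpace ℝ (Fin 3)) G]
    [Group G] [LieGroup (𝓡 3) ∞ G] (w : Module.Basis (Fin 3) ℝ (GroupLieAlgebra (𝓡 3) G)) : Prop :=
  ⁅w 0, w 1⁆ = w 1 ∧ ⁅w 0, w 2⁆ = 0 ∧ ⁅w 1, w 2⁆ = 0

/-- In the basis `w`, at the identity: `g` is diagonal with entries `ε / δ²`, `ε'`, `1`. -/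
def IsStandardMetric {G : Type*} [TopologicalSpace G] [ChartedSpace (EuclideanSpace ℝ (Fin 3)) G]
    [Group G] (g : BilinField 3 G)
    (w : Module.Basis (Fin 3) ℝ (GroupLieAlgebra (𝓡 3) G)) (δ ε ε' : ℝ) : Prop :=
  g 1 (w 0) (w 0) = ε / δ ^ 2 ∧ g 1 (w 1) (w 1) = ε' ∧ g 1 (w 2) (w 2) = 1 ∧
    ∀ i j : Fin 3, i ≠ j → g 1 (w i) (w j) = 0

end LieGroup

end BGen

end

noncomputable section

namespace BGen

/-! ### Smoothness of left-invariant vector fields and of the Maurer-Cartan form. -/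

section Analysis

variable {n : ℕ} {G : Type*} [TopologicalSpace G] [ChartedSpace (EuclideanSpace ℝ (Fin n)) G]

/-! The plan is to turn integrability into algebra on the Lie algebra `V` of `G`, solve the
resulting equations in an adapted basis, and check that the solutions satisfy all the conditions.

Reduction. Left translation trivializes `E` as `V ⊕ V* ⊕ ℝ`. For the flat connection `∇` whose
parallel sections are the left-invariant ones, the Dorfman bracket is the algebraic bracket
`algDorfman` plus `∇_{π u} v - ∇_{π v} u + 2⟨∇u, v⟩` (`dorfman_eq`). A left-invariant endomorphism
commutes with `∇`, so on sections of its `i`-eigenbundle `L` the first two derivative terms stay in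
`L`, and the last one vanishes because `L` is isotropic. Integrability is thus tested on
left-invariant sections, where it reads `AlgIntegrable`.

Necessity. Passing from `𝓕` to `Γ𝓕` keeps `J₊`, `X₊` and replaces `J₋` by `-J₋`. Comparing the two
integrability conditions yields two real identities, `IsLeftInvGPK.sp_plus_minus_Xm` and
`IsLeftInvGPK.sp_plus_plus_minus`. The first says that `F(X₋, ·) = 0` (it is tested on `X₋^⊥`), that
`ad X₋` is `g`-skew, and that `H(·, ·, X₋)` is determined by `g(X₋, [·, ·])` on `X₋^⊥`. The second
relates `F`, `H`, `J₊` and `X₊`. In `classification` they are evaluated in an orthogonal basis `u,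
v, X₋` with `ad v` traceless. Non-unimodularity forces `[u, v]` to have a nonzero `v`-component `n`;
the Jacobi identity then makes `X₋` central, and the second identity leaves only `X₊ = ±X₋`, `[u, v]
= n v`, `H = 0`, `F = 0`. Rescaling `u` by `n⁻¹` gives the normal form, with `δ = n`.

Sufficiency. On the plane spanned by `w₁, w₂`, an adapted complex structure is one of two opposite
rotations, and it exists only if the two signs of the metric agree (`adapted_standard_form`). So
`J₊` and `J₋` agree up to sign, and `algIntegrable_standard` verifies the algebraic condition in
coordinates for both relative signs, which covers `𝓕` and `Γ𝓕` at once. -/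

theorem tangentBundle_mk_congr {p q : G} (h : p = q) (v : EuclideanSpace ℝ (Fin n)) :
    (⟨p, v⟩ : TangentBundle (𝓡 n) G) = ⟨q, v⟩ := by
  subst h; rfl

variable [Group G] [LieGroup (𝓡 n) ∞ G]

/-- The zero vector in the first factor kills one partial derivative of the multiplication and
leaves the differential of left translation. Both smoothness proofs below write a translated field
as the tangent map of multiplication applied to a zero section and that field. -/
theorem tangentMap_mul_zero_left (a b : G) (v : TangentSpace (𝓡 n) b) :
    tangentMap ((𝓡 n).prod (𝓡 n)) (𝓡 n) (fun p : G × G => p.1 * p.2)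
      ((equivTangentBundleProd (𝓡 n) G (𝓡 n) G).symm (⟨a, 0⟩, ⟨b, v⟩)) =
    (⟨a * b, mfderiv (𝓡 n) (𝓡 n) (fun x => a * x) b v⟩ : TangentBundle (𝓡 n) G) := by
  refine Bundle.TotalSpace.ext rfl ?_
  simp only [tangentMap]
  rw [mfderiv_prod_eq_add_apply ((contMDiff_mul (𝓡 n) (∞)).mdifferentiableAt (by simp))]
  exact heq_of_eq ((congrArg (· + _) (map_zero _)).trans (zero_add _))

theorem smoothVec_mulInvariantVectorField (v : GroupLieAlgebra (𝓡 n) G) :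
    SmoothVec (fun p : G => mulInvariantVectorField v p) := by
  let fg : G → TangentBundle (𝓡 n) G := fun g => ⟨g, 0⟩
  have sfg : ContMDiff (𝓡 n) (𝓡 n).tangent ∞ fg := Bundle.contMDiff_zeroSection _ _
  let fv : G → TangentBundle (𝓡 n) G := fun _ => ⟨1, v⟩
  have sfv : ContMDiff (𝓡 n) (𝓡 n).tangent ∞ fv := contMDiff_const
  have S₁ := sfg.prodMk sfv
  have S₂ := (contMDiff_equivTangentBundleProd_symm (n := ∞) (I := 𝓡 n) (M := G) (I' := 𝓡 n)
    (M' := G)).comp S₁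
  have S₃ := (ContMDiff.contMDiff_tangentMap (m := ∞) (contMDiff_mul (𝓡 n) (∞) (G := G))
    (by simp)).comp S₂
  refine S₃.congr fun g => ?_
  exact (tangentBundle_mk_congr (mul_one g).symm _).trans (tangentMap_mul_zero_left g 1 v).symm

theorem tangentMap_mul_left_inv (p : G) (y : GroupLieAlgebra (𝓡 n) G) :
    tangentMap (𝓡 n) (𝓡 n) (fun a => p⁻¹ * a) ⟨p, mulInvariantVectorField y p⟩ = ⟨1, y⟩ := by
  have hd : ∀ q : G, MDifferentiable (𝓡 n) (𝓡 n) (fun a : G => q * a) := fun q =>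
    (contMDiff_mul_left (I := 𝓡 n) (n := ∞)).mdifferentiable (by simp)
  have h1 : (⟨p, mulInvariantVectorField y p⟩ : TangentBundle (𝓡 n) G) =
      tangentMap (𝓡 n) (𝓡 n) (fun a => p * a) ⟨1, y⟩ :=
    tangentBundle_mk_congr (mul_one p).symm _
  have h2 := tangentMap_comp_at (I := 𝓡 n) (I' := 𝓡 n) (I'' := 𝓡 n)
    (⟨1, y⟩ : TangentBundle (𝓡 n) G) (hd p⁻¹ (p * 1)) (hd p 1)
  rw [h1, ← h2]
  have hid : (fun a : G => p⁻¹ * a) ∘ (fun a : G => p * a) = id := by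
    funext a; simp
  rw [hid, tangentMap_id]; rfl

theorem trivializationAt_mk_self (p : G) (y : TangentSpace (𝓡 n) p) :
    (trivializationAt (EuclideanSpace ℝ (Fin n)) (TangentSpace (𝓡 n)) p
      (⟨p, y⟩ : TangentBundle (𝓡 n) G)).2 = y := by
  have := FiberBundleCore.localTrivAt_apply_mk (tangentBundleCore (𝓡 n) G).toFiberBundleCore p y
  exact congrArg Prod.snd this

/-- The Maurer-Cartan form turns smooth vector fields into smooth functions. -/
theorem contMDiff_maurerCartan {X : VecField n G} (hX : SmoothVec X)
    (y : G → GroupLieAlgebra (𝓡 n) G) (hy : ∀ p, mulInvariantVectorField (y p) p = X p) :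
    ContMDiff (𝓡 n) 𝓘(ℝ, EuclideanSpace ℝ (Fin n)) ∞
      (fun p => (show EuclideanSpace ℝ (Fin n) from y p)) := by
  -- Translating `X p` by `p⁻¹` lands in the fibre over `1`. There the trivialization is the
  -- identity, so smoothness into the tangent bundle becomes smoothness of a vector-valued function.
  let fg : G → TangentBundle (𝓡 n) G := fun g => ⟨g⁻¹, 0⟩
  have sfg : ContMDiff (𝓡 n) (𝓡 n).tangent ∞ fg :=
    (Bundle.contMDiff_zeroSection ℝ (TangentSpace (𝓡 n) (M := G))
      (F := EuclideanSpace ℝ (Fin n)) (IB := 𝓡 n)).comp (contMDiff_inv (𝓡 n) ∞)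
  have S₁ := sfg.prodMk hX
  have S₂ := (contMDiff_equivTangentBundleProd_symm (n := ∞) (I := 𝓡 n) (M := G) (I' := 𝓡 n)
    (M' := G)).comp S₁
  have S₃ := (ContMDiff.contMDiff_tangentMap (m := ∞) (contMDiff_mul (𝓡 n) (∞) (G := G))
    (by simp)).comp S₂
  have S₄ : ContMDiff (𝓡 n) (𝓡 n).tangent ∞
      (fun p => (⟨1, y p⟩ : TangentBundle (𝓡 n) G)) := by
    refine S₃.congr fun g => ?_
    rw [← tangentMap_mul_left_inv g (y g), hy]
    exact (tangentMap_mul_zero_left g⁻¹ g (X g)).symm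
  intro p
  have := (Bundle.contMDiffAt_totalSpace.1 (S₄ p)).2
  simpa only [trivializationAt_mk_self] using! this

end Analysis

/-! ### The left-invariant trivialization of `E`. -/

section Frame

variable {n : ℕ} {G : Type*} [TopologicalSpace G] [ChartedSpace (EuclideanSpace ℝ (Fin n)) G]
  [Group G]

theorem mulInvariantVectorField_one (x : GroupLieAlgebra (𝓡 n) G) :
    mulInvariantVectorField x (1 : G) = x := by
  have h : (fun a : G => 1 * a) = id := by funext a; simp
  have : mfderiv (𝓡 n) (𝓡 n) (fun a : G => 1 * a) 1 = ContinuousLinearMap.id ℝ _ := by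
    rw [h, mfderiv_id]
  exact DFunLike.congr_fun this x

variable [LieGroup (𝓡 n) ∞ G]

variable (n) in
/-- Left translation by `p` as a linear equivalence. -/
def leftEquiv (p : G) : GroupLieAlgebra (𝓡 n) G ≃ₗ[ℝ] TangentSpace (𝓡 n) p :=
  LinearEquiv.ofBijective (leftMap p) (leftMap_bijective p)

theorem leftEquiv_apply (p : G) (x : GroupLieAlgebra (𝓡 n) G) :
    leftEquiv n p x = mulInvariantVectorField x p := rfl

variable (n G) in
/-- The standard basis of the Lie algebra. -/
def stdBasis : Module.Basis (Fin n) ℝ (GroupLieAlgebra (𝓡 n) G) :=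
  (EuclideanSpace.basisFun (Fin n) ℝ).toBasis

theorem leftEquiv_one (x : GroupLieAlgebra (𝓡 n) G) : leftEquiv n (1 : G) x = x :=
  mulInvariantVectorField_one x

theorem smoothVec_frameField (i : Fin n) : SmoothVec (frameField n G i) :=
  smoothVec_mulInvariantVectorField _

/-- The coordinates of `X` in the left-invariant frame are those of the Maurer-Cartan form evaluated
on `X`; conversely the frame fields are themselves smooth. -/
theorem smoothVec_iff {X : VecField n G} :
    SmoothVec X ↔ ∀ i, SmoothFun n (fun p => (leftFrame n p).repr (X p) i) := by
  constructor
  · intro hX i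
    have h := contMDiff_maurerCartan hX (fun p => (leftEquiv n p).symm (X p))
      (fun p => (leftEquiv n p).apply_symm_apply (X p))
    exact (EuclideanSpace.proj i : EuclideanSpace ℝ (Fin n) →L[ℝ] ℝ).contMDiff.comp h
  · intro h
    have hX : X = fun p => ∑ i, ((fun p => (leftFrame n p).repr (X p) i) • frameField n G i) p :=
      funext fun p => ((leftFrame n p).sum_repr (X p)).symm
    have := ContMDiff.sum_section (V := TangentSpace (𝓡 n) (M := G)) (s := Finset.univ)
      (fun i _ => ContMDiff.smul_section (h i) (smoothVec_frameField (G := G) i))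
    rw [hX]; exact this

theorem smoothOneForm_iff {ξ : OneForm n G} :
    SmoothOneForm ξ ↔ ∀ i, SmoothFun n (fun p => ξ p (leftFrame n p i)) := by
  refine ⟨fun h i => h _ (smoothVec_frameField i), fun h X hX => ?_⟩
  have h1 : (fun p => ξ p (X p)) =
      fun p => ∑ i, (leftFrame n p).repr (X p) i * ξ p (leftFrame n p i) := by
    funext p
    conv_lhs => rw [← (leftFrame n p).sum_repr (X p), map_sum]
    simp only [map_smul, smul_eq_mul]
  rw [h1]
  exact contMDiff_finsetSum fun i _ => ContMDiff.mul (smoothVec_iff.1 hX i) (h i)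

/-- The space of coordinates in a fibre of `E`. -/
abbrev Coord (n : ℕ) : Type := (Fin n → ℝ) × (Fin n → ℝ) × ℝ

/-- The trivialization of `E` by the left-invariant frame. -/
def fibreEquiv (p : G) : Coord n ≃ₗ[ℝ] Fibre n p :=
  (leftFrame n p).equivFun.symm.prodCongr
    (((leftFrame n p).constr ℝ).prodCongr (LinearEquiv.refl ℝ ℝ))

/-- The coordinates of a section of `E` in the left-invariant frame. -/
def coords (u : Sec n G) : G → Coord n := fun p => (fibreEquiv p).symm (u p)

/-- Smoothness becomes that of one map into a fixed vector space, on which left-invariant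
endomorphisms act by a constant matrix. -/
theorem smoothSec_iff {u : Sec n G} :
    SmoothSec u ↔ ContMDiff (𝓡 n) 𝓘(ℝ, Coord n) ∞ (coords u) := by
  have key : SmoothSec u ↔ SmoothVec (fun p => (u p).1) ∧ SmoothOneForm (fun p => (u p).2.1) ∧
      SmoothFun n (fun p => (u p).2.2) :=
    ⟨fun h => ⟨h.vec, h.cov, h.fn⟩, fun h => ⟨h.1, h.2.1, h.2.2⟩⟩
  rw [key, contMDiff_prod_module_iff, contMDiff_prod_module_iff, contMDiff_pi_space,
    contMDiff_pi_space, smoothVec_iff, smoothOneForm_iff]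
  rfl

/-- The transport of the fibre of `E` at the identity to the fibre at `p`. -/
def transport (p : G) : Fibre n (1 : G) ≃ₗ[ℝ] Fibre n p :=
  (fibreEquiv 1).symm.trans (fibreEquiv p)

theorem leftFrame_one (i : Fin n) : leftFrame n (1 : G) i = stdBasis n G i :=
  leftEquiv_one _

theorem transport_fst (p : G) (w : Fibre n (1 : G)) :
    (transport p w).1 = leftEquiv n p w.1 := by
  have h : (transport p w).1 = ∑ i, (leftFrame n (1 : G)).repr w.1 i • leftFrame n p i :=
    (leftFrame n p).equivFun_symm_apply _
  rw [h]
  conv_rhs => rw [← (leftFrame n (1 : G)).sum_repr w.1, map_sum]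
  refine Finset.sum_congr rfl fun i _ => ?_
  rw [map_smul, leftFrame_one]; rfl

theorem transport_snd (p : G) (w : Fibre n (1 : G)) (z : GroupLieAlgebra (𝓡 n) G) :
    (transport p w).2.1 (leftEquiv n p z) = w.2.1 z := by
  have h : (transport p w).2.1 ∘ₗ (leftEquiv n p).toLinearMap = w.2.1 := by
    refine (stdBasis n G).ext fun i => ?_
    have : (transport p w).2.1 (leftFrame n p i) = w.2.1 (leftFrame n 1 i) :=
      (leftFrame n p).constr_basis ℝ _ i
    rw [leftFrame_one] at this
    exact this
  exact DFunLike.congr_fun h z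

theorem transport_thd (p : G) (w : Fibre n (1 : G)) : (transport p w).2.2 = w.2.2 := rfl

theorem transport_one (w : Fibre n (1 : G)) : transport 1 w = w :=
  (fibreEquiv 1).apply_symm_apply w

end Frame

/-! ### The flat left-invariant connection and the Lie bracket of vector fields. -/

section Connection

variable {n : ℕ} {G : Type*} [TopologicalSpace G] [ChartedSpace (EuclideanSpace ℝ (Fin n)) G]

theorem SmoothFun.mdifferentiableAt {f : G → ℝ} (hf : SmoothFun n f) (p : G) :
    MDifferentiableAt (𝓡 n) 𝓘(ℝ, ℝ) f p :=
  (hf p).mdifferentiableAt (by simp)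

theorem bra_swap (X Y : VecField n G) (p : G) : bra X Y p = - bra Y X p :=
  VectorField.mlieBracket_swap_apply

theorem der_const (X : VecField n G) (c : ℝ) (p : G) : der X (fun _ => c) p = 0 := by
  unfold der
  rw [mvfderiv_const]; rfl

theorem mvfderiv_linear_comp {W W' : Type*} [NormedAddCommGroup W] [NormedSpace ℝ W]
    [FiniteDimensional ℝ W] [NormedAddCommGroup W'] [NormedSpace ℝ W'] (A : W →ₗ[ℝ] W')
    {f : G → W} {p : G} (hf : MDifferentiableAt (𝓡 n) 𝓘(ℝ, W) f p) (x : TangentSpace (𝓡 n) p) :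
    mvfderiv (𝓡 n) (fun q => A (f q)) p x = A (mvfderiv (𝓡 n) f p x) := by
  let B : W →L[ℝ] W' := LinearMap.toContinuousLinearMap A
  have h := mfderiv_comp_apply (I := 𝓡 n) (I' := 𝓘(ℝ, W)) (I'' := 𝓘(ℝ, W')) p
    (B.mdifferentiableAt) hf x
  rw [ContinuousLinearMap.mfderiv_eq] at h
  exact h

variable [Group G] [LieGroup (𝓡 n) ∞ G]

theorem bra_mulInvariantVectorField (x y : GroupLieAlgebra (𝓡 n) G) (p : G) :
    bra (n := n) (fun q : G => mulInvariantVectorField x q) (fun q => mulInvariantVectorField y q) p =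
      leftEquiv n p ⁅x, y⁆ :=
  (congrFun (mulInvariantVector_mlieBracket (I := 𝓡 n) x y) p).symm

theorem SmoothVec.mdifferentiableAt {X : VecField n G} (hX : SmoothVec X) (p : G) :
    MDifferentiableAt (𝓡 n) (𝓡 n).tangent (fun q => (⟨q, X q⟩ : TangentBundle (𝓡 n) G)) p :=
  (hX p).mdifferentiableAt (by simp)

theorem bra_sum_smul_right {ι : Type*} (s : Finset ι) (f : ι → G → ℝ) (E : ι → VecField n G)
    (X : VecField n G) (hf : ∀ i, SmoothFun n (f i)) (hE : ∀ i, SmoothVec (E i)) (p : G) :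
    bra X (fun q => ∑ i ∈ s, f i q • E i q) p =
      ∑ i ∈ s, (der X (f i) p • E i p + f i p • bra X (E i) p) := by
  have hfE : ∀ i, SmoothVec (f i • E i) := fun i => ContMDiff.smul_section (hf i) (hE i)
  have : IsManifold (𝓡 n) (minSmoothness ℝ 2) G :=
    IsManifold.of_le (n := ∞)
      (by rw [minSmoothness_of_isRCLikeNormedField]; exact WithTop.coe_le_coe.2 le_top)
  have : IsManifold (𝓡 n) 2 G :=
    IsManifold.of_le (n := ∞) (WithTop.coe_le_coe.2 le_top)
  classical
  induction s using Finset.induction_on with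
  | empty =>
    simp only [Finset.sum_empty]
    exact congrFun VectorField.mlieBracket_zero_right p
  | insert i s hi ih =>
    have hs : SmoothVec (fun q => ∑ i ∈ s, (f i • E i) q) :=
      ContMDiff.sum_section (V := TangentSpace (𝓡 n) (M := G)) fun i _ => hfE i
    have h := VectorField.mlieBracket_add_right (V := X) ((hfE i).mdifferentiableAt p)
      (hs.mdifferentiableAt p)
    have h' := VectorField.mlieBracket_smul_right (V := X) ((hf i).mdifferentiableAt p)
      ((hE i).mdifferentiableAt p)
    rw [Finset.sum_insert hi, ← ih]
    have e : (fun q => ∑ j ∈ insert i s, f j q • E j q) =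
        (f i • E i) + fun q => ∑ i ∈ s, (f i • E i) q := by
      funext q; rw [Finset.sum_insert hi]; rfl
    rw [e]
    refine h.trans ?_
    rw [h']; rfl

theorem eq_sum_frameField (X : VecField n G) :
    X = fun q => ∑ i, (leftFrame n q).repr (X q) i • frameField n G i q :=
  funext fun q => ((leftFrame n q).sum_repr (X q)).symm

/-- After swapping the arguments, `X` sits in the second slot and can be expanded in the frame by
the Leibniz rule; brackets of two frame fields come from the Lie algebra. -/
theorem bra_frameField {X : VecField n G} (hX : SmoothVec X) (k : Fin n) (p : G) :
    bra X (frameField n G k) p =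
      leftEquiv n p ⁅(leftEquiv n p).symm (X p), stdBasis n G k⁆ -
        ∑ i, der (frameField n G k) (fun q => (leftFrame n q).repr (X q) i) p • leftFrame n p i := by
  have h : bra (frameField n G k) X p =
      ∑ i, (der (frameField n G k) (fun q => (leftFrame n q).repr (X q) i) p • leftFrame n p i +
        (leftFrame n p).repr (X p) i • bra (frameField n G k) (frameField n G i) p) := by
    conv_lhs => rw [eq_sum_frameField X]
    exact bra_sum_smul_right Finset.univ _ _ _ (smoothVec_iff.1 hX) smoothVec_frameField p
  rw [bra_swap, h, Finset.sum_add_distrib, neg_add_rev, sub_eq_add_neg]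
  congr 1
  conv_rhs => rw [← (stdBasis n G).sum_repr ((leftEquiv n p).symm (X p)), sum_lie,
    map_sum]
  rw [← Finset.sum_neg_distrib]
  refine Finset.sum_congr rfl fun i _ => ?_
  rw [bra_swap, smul_neg, neg_neg, smul_lie, map_smul]
  rw [← bra_mulInvariantVectorField]; rfl

/-- The torsion of the flat connection is minus the Lie algebra bracket. Expanding `Y` in the frame
reduces the formula to `bra_frameField`. -/
theorem bra_eq {X Y : VecField n G} (hX : SmoothVec X) (hY : SmoothVec Y) (p : G) :
    bra X Y p =
      leftEquiv n p ⁅(leftEquiv n p).symm (X p), (leftEquiv n p).symm (Y p)⁆ +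
        ∑ i, der X (fun q => (leftFrame n q).repr (Y q) i) p • leftFrame n p i -
        ∑ i, der Y (fun q => (leftFrame n q).repr (X q) i) p • leftFrame n p i := by
  have h : bra X Y p =
      ∑ i, (der X (fun q => (leftFrame n q).repr (Y q) i) p • leftFrame n p i +
        (leftFrame n p).repr (Y p) i • bra X (frameField n G i) p) := by
    conv_lhs => rw [eq_sum_frameField Y]
    exact bra_sum_smul_right Finset.univ _ _ _ (smoothVec_iff.1 hY) smoothVec_frameField p
  have hd : ∀ f : G → ℝ, der Y f p =
      ∑ k, (leftFrame n p).repr (Y p) k * der (frameField n G k) f p := by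
    intro f
    unfold der
    conv_lhs => rw [← (leftFrame n p).sum_repr (Y p), map_sum]
    simp only [map_smul, smul_eq_mul]; rfl
  have hc : ⁅(leftEquiv n p).symm (X p), (leftEquiv n p).symm (Y p)⁆ =
      ∑ k, (leftFrame n p).repr (Y p) k • ⁅(leftEquiv n p).symm (X p), stdBasis n G k⁆ := by
    conv_lhs => rw [← (stdBasis n G).sum_repr ((leftEquiv n p).symm (Y p)), lie_sum]
    refine Finset.sum_congr rfl fun k _ => ?_
    rw [lie_smul]; rfl
  rw [h, Finset.sum_add_distrib, hc, map_sum]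
  simp only [bra_frameField hX, smul_sub, Finset.sum_sub_distrib, hd, Finset.sum_smul, map_smul,
    Finset.smul_sum, smul_smul]
  rw [Finset.sum_comm (γ := Fin n) (f := fun i k => ((leftFrame n p).repr (Y p) k *
    der (frameField n G k) (fun q => (leftFrame n q).repr (X q) i) p) • leftFrame n p i)]
  abel

/-- The flat connection on `E` for which left-invariant sections are parallel. -/
def conn (u : Sec n G) (p : G) : TangentSpace (𝓡 n) p →ₗ[ℝ] Fibre n p :=
  (fibreEquiv p).toLinearMap ∘ₗ (mvfderiv (𝓡 n) (coords u) p).toLinearMap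

theorem SmoothSec.mdifferentiableAt {u : Sec n G} (hu : SmoothSec u) (p : G) :
    MDifferentiableAt (𝓡 n) 𝓘(ℝ, Coord n) (coords u) p :=
  (smoothSec_iff.1 hu p).mdifferentiableAt (by simp)

theorem conn_fst {u : Sec n G} (hu : SmoothSec u) (p : G) (x : TangentSpace (𝓡 n) p) :
    (conn u p x).1 =
      ∑ i, mvfderiv (𝓡 n) (fun q => (leftFrame n q).repr (u q).1 i) p x • leftFrame n p i := by
  have h : (conn u p x).1 = ∑ i, (mvfderiv (𝓡 n) (coords u) p x).1 i • leftFrame n p i :=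
    (leftFrame n p).equivFun_symm_apply _
  rw [h]
  refine Finset.sum_congr rfl fun i _ => congrArg (· • _) ?_
  exact (mvfderiv_linear_comp (LinearMap.proj i ∘ₗ LinearMap.fst ℝ _ _)
    (hu.mdifferentiableAt p) x).symm

theorem conn_snd {u : Sec n G} (hu : SmoothSec u) (p : G) (x : TangentSpace (𝓡 n) p) (k : Fin n) :
    (conn u p x).2.1 (leftFrame n p k) =
      mvfderiv (𝓡 n) (fun q => (u q).2.1 (leftFrame n q k)) p x := by
  have h : (conn u p x).2.1 (leftFrame n p k) = (mvfderiv (𝓡 n) (coords u) p x).2.1 k :=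
    (leftFrame n p).constr_basis ℝ _ k
  rw [h]
  exact (mvfderiv_linear_comp (LinearMap.proj k ∘ₗ LinearMap.fst ℝ _ _ ∘ₗ LinearMap.snd ℝ _ _)
    (hu.mdifferentiableAt p) x).symm

theorem conn_thd {u : Sec n G} (hu : SmoothSec u) (p : G) (x : TangentSpace (𝓡 n) p) :
    (conn u p x).2.2 = mvfderiv (𝓡 n) (fun q => (u q).2.2) p x :=
  ((mvfderiv_linear_comp (LinearMap.snd ℝ _ _ ∘ₗ LinearMap.snd ℝ (Fin n → ℝ) _)
    (hu.mdifferentiableAt p) x).symm :)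

end Connection

/-! ### The algebraic Dorfman bracket on `V ⊕ V* ⊕ ℝ`. -/

section Algebraic

variable {V : Type*} [AddCommGroup V] [Module ℝ V]

theorem alternating_three_add (H : V [⋀^Fin 3]→ₗ[ℝ] ℝ) (a b z z' : V) :
    H ![a, b, z + z'] = H ![a, b, z] + H ![a, b, z'] := by
  have h : ∀ x : V, ![a, b, x] = Function.update ![a, b, 0] 2 x := fun x => by
    ext i; fin_cases i <;> rfl
  rw [h (z + z'), H.map_update_add, ← h, ← h]

theorem alternating_three_smul (H : V [⋀^Fin 3]→ₗ[ℝ] ℝ) (a b z : V) (t : ℝ) :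
    H ![a, b, t • z] = t * H ![a, b, z] := by
  have h : ∀ x : V, ![a, b, x] = Function.update ![a, b, 0] 2 x := fun x => by
    ext i; fin_cases i <;> rfl
  rw [h (t • z), H.map_update_smul, ← h, smul_eq_mul]

theorem alternating_two_add (F : V [⋀^Fin 2]→ₗ[ℝ] ℝ) (a z z' : V) :
    F ![a, z + z'] = F ![a, z] + F ![a, z'] := by
  have h : ∀ x : V, ![a, x] = Function.update ![a, 0] 1 x := fun x => by
    ext i; fin_cases i <;> rfl
  rw [h (z + z'), F.map_update_add, ← h, ← h]

theorem alternating_two_smul (F : V [⋀^Fin 2]→ₗ[ℝ] ℝ) (a z : V) (t : ℝ) :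
    F ![a, t • z] = t * F ![a, z] := by
  have h : ∀ x : V, ![a, x] = Function.update ![a, 0] 1 x := fun x => by
    ext i; fin_cases i <;> rfl
  rw [h (t • z), F.map_update_smul, ← h, smul_eq_mul]

end Algebraic

/-- The Dorfman bracket of left-invariant sections, as a bracket on `V ⊕ V* ⊕ ℝ` for a Lie
algebra `V`. -/
def algDorfman {V : Type*} [LieRing V] [LieAlgebra ℝ V] (H : V [⋀^Fin 3]→ₗ[ℝ] ℝ)
    (F : V [⋀^Fin 2]→ₗ[ℝ] ℝ) (u v : V × Module.Dual ℝ V × ℝ) : V × Module.Dual ℝ V × ℝ :=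
  (⁅u.1, v.1⁆,
   { toFun := fun z => - v.2.1 ⁅u.1, z⁆ + u.2.1 ⁅v.1, z⁆ + H ![v.1, u.1, z]
        - 2 * (v.2.2 * F ![u.1, z] - u.2.2 * F ![v.1, z])
     map_add' := fun z z' => by
        simp only [lie_add, map_add, alternating_three_add, alternating_two_add]; ring
     map_smul' := fun t z => by
        simp only [lie_smul, map_smul, alternating_three_smul, alternating_two_smul, smul_eq_mul,
          RingHom.id_apply]
        ring },
   F ![u.1, v.1])

/-! ### Comparison of the Dorfman bracket with its algebraic version. -/

section Pairing

variable {n : ℕ} {G : Type*} [TopologicalSpace G] [ChartedSpace (EuclideanSpace ℝ (Fin n)) G]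

/-- The scalar product with `v`. -/
def spForm {p : G} (v : Fibre n p) : Fibre n p →ₗ[ℝ] ℝ where
  toFun u := sp u v
  map_add' u u' := by simp only [sp, Prod.fst_add, Prod.snd_add, map_add, LinearMap.add_apply]; ring
  map_smul' t u := by
    simp only [sp, Prod.smul_fst, Prod.smul_snd, map_smul, LinearMap.smul_apply, smul_eq_mul,
      RingHom.id_apply]
    ring

theorem spForm_apply {p : G} (u v : Fibre n p) : spForm v u = sp u v := rfl

theorem sp_comm {p : G} (u v : Fibre n p) : sp u v = sp v u := by
  simp only [sp]; ring

variable [Group G] [LieGroup (𝓡 n) ∞ G]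

theorem transport_symm_fst (p : G) (w : Fibre n p) :
    ((transport p).symm w).1 = (leftEquiv n p).symm w.1 := by
  rw [LinearEquiv.eq_symm_apply, ← transport_fst, LinearEquiv.apply_symm_apply]

theorem transport_symm_snd (p : G) (w : Fibre n p) (z : GroupLieAlgebra (𝓡 n) G) :
    ((transport p).symm w).2.1 z = w.2.1 (leftEquiv n p z) := by
  rw [← transport_snd, LinearEquiv.apply_symm_apply]

theorem transport_symm_thd (p : G) (w : Fibre n p) : ((transport p).symm w).2.2 = w.2.2 := rfl

theorem conn_fst_eq_zero_add {u v : Sec n G} (hu : SmoothSec u) (hv : SmoothSec v) (p : G) :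
    bra (fun q => (u q).1) (fun q => (v q).1) p =
      leftEquiv n p ⁅(leftEquiv n p).symm (u p).1, (leftEquiv n p).symm (v p).1⁆ +
        (conn v p (u p).1).1 - (conn u p (v p).1).1 := by
  rw [bra_eq hu.vec hv.vec, conn_fst hv, conn_fst hu]; rfl

theorem bra_frameField_eq_conn {u : Sec n G} (hu : SmoothSec u) (k : Fin n) (p : G) :
    bra (fun q => (u q).1) (frameField n G k) p =
      leftEquiv n p ⁅(leftEquiv n p).symm (u p).1, stdBasis n G k⁆ -
        (conn u p (leftFrame n p k)).1 := by
  rw [bra_frameField hu.vec, conn_fst hu]; rfl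

/-- The pairing of covectors with vectors is parallel, since it has constant coefficients in the
frame and its dual. -/
theorem der_contraction {u v : Sec n G} (hu : SmoothSec u) (hv : SmoothSec v) (p : G)
    (x : TangentSpace (𝓡 n) p) :
    mvfderiv (𝓡 n) (fun q => (u q).2.1 (v q).1) p x =
      (conn u p x).2.1 (v p).1 + (u p).2.1 (conn v p x).1 := by
  have hb : ∀ i, MDifferentiableAt (𝓡 n) 𝓘(ℝ, ℝ) (fun q => (leftFrame n q).repr (v q).1 i) p :=
    fun i => SmoothFun.mdifferentiableAt (smoothVec_iff.1 hv.vec i) p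
  have hc : ∀ i, MDifferentiableAt (𝓡 n) 𝓘(ℝ, ℝ) (fun q => (u q).2.1 (leftFrame n q i)) p :=
    fun i => SmoothFun.mdifferentiableAt (smoothOneForm_iff.1 hu.cov i) p
  -- Differentiability of the partial sum is carried through the induction because the sum rule
  -- needs it at each step.
  have hs : ∀ s : Finset (Fin n),
      MDifferentiableAt (𝓡 n) 𝓘(ℝ, ℝ) (fun q => ∑ i ∈ s, (leftFrame n q).repr (v q).1 i *
        (u q).2.1 (leftFrame n q i)) p ∧
      mvfderiv (𝓡 n) (fun q => ∑ i ∈ s, (leftFrame n q).repr (v q).1 i *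
        (u q).2.1 (leftFrame n q i)) p x =
      ∑ i ∈ s, ((leftFrame n p).repr (v p).1 i * (conn u p x).2.1 (leftFrame n p i) +
        (u p).2.1 (leftFrame n p i) *
          mvfderiv (𝓡 n) (fun q => (leftFrame n q).repr (v q).1 i) p x) := by
    intro s
    classical
    induction s using Finset.induction_on with
    | empty =>
      simp only [Finset.sum_empty]
      exact ⟨mdifferentiableAt_const, by rw [mvfderiv_const]; rfl⟩
    | insert i s hi ih =>
      simp only [Finset.sum_insert hi]
      have hm := (hb i).mul (hc i)
      refine ⟨hm.add ih.1, ?_⟩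
      have h1 := mvfderiv_add hm ih.1
      have h2 := mvfderiv_mul (hb i) (hc i)
      refine (DFunLike.congr_fun h1 x).trans ?_
      rw [← ih.2, conn_snd hu]
      refine (congrArg (· + _) (DFunLike.congr_fun h2 x)).trans ?_
      rfl
  have hsum : (fun q => (u q).2.1 (v q).1) = fun q => ∑ i, (leftFrame n q).repr (v q).1 i *
      (u q).2.1 (leftFrame n q i) := by
    funext q
    conv_lhs => rw [← (leftFrame n q).sum_repr (v q).1, map_sum]
    simp only [map_smul, smul_eq_mul]
  rw [hsum, (hs Finset.univ).2, Finset.sum_add_distrib, conn_fst hv, map_sum]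
  simp only [map_smul, smul_eq_mul]
  congr 1
  · conv_rhs => rw [← (leftFrame n p).sum_repr (v p).1, map_sum]
    simp only [map_smul, smul_eq_mul]
  · exact Finset.sum_congr rfl fun i _ => mul_comm _ _

theorem dorfmanCov_frameField (H : DiffForm n G 3) (F : DiffForm n G 2) {u v : Sec n G}
    (hu : SmoothSec u) (hv : SmoothSec v) (k : Fin n) (p : G) :
    dorfmanCov H F u v (frameField n G k) p =
      - (v p).2.1 (leftEquiv n p ⁅(leftEquiv n p).symm (u p).1, stdBasis n G k⁆)
        + (u p).2.1 (leftEquiv n p ⁅(leftEquiv n p).symm (v p).1, stdBasis n G k⁆)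
        + H p ![(v p).1, (u p).1, leftFrame n p k]
        - 2 * ((v p).2.2 * F p ![(u p).1, leftFrame n p k]
            - (u p).2.2 * F p ![(v p).1, leftFrame n p k])
        + (conn v p (u p).1).2.1 (leftFrame n p k) - (conn u p (v p).1).2.1 (leftFrame n p k)
        + 2 * sp (conn u p (leftFrame n p k)) (v p) := by
  have h1 : der (fun q => (u q).1) (fun q => (v q).2.1 (frameField n G k q)) p =
      (conn v p (u p).1).2.1 (leftFrame n p k) := (conn_snd hv p _ k).symm
  have h2 : der (fun q => (v q).1) (fun q => (u q).2.1 (frameField n G k q)) p =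
      (conn u p (v p).1).2.1 (leftFrame n p k) := (conn_snd hu p _ k).symm
  have h3 : der (frameField n G k) (fun q => (u q).2.1 (v q).1) p = _ :=
    der_contraction hu hv p (leftFrame n p k)
  have h4 : der (frameField n G k) (fun q => (u q).2.2) p =
      (conn u p (leftFrame n p k)).2.2 := (conn_thd hu p _).symm
  simp only [dorfmanCov, lieDerivOneForm, dOneForm, bra_frameField_eq_conn hu,
    bra_frameField_eq_conn hv, h1, h2, h3, h4, map_sub, sp]
  have h5 : frameField n G k p = leftFrame n p k := rfl
  rw [h5]
  ring

theorem compLinearMap_leftEquiv_three (H : DiffForm n G 3) (p : G)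
    (a b c : TangentSpace (𝓡 n) p) :
    (H p).compLinearMap (leftEquiv n p).toLinearMap
      ![(leftEquiv n p).symm a, (leftEquiv n p).symm b, (leftEquiv n p).symm c] =
      H p ![a, b, c] := by
  rw [AlternatingMap.compLinearMap_apply]
  congr 1
  funext i; fin_cases i <;> exact (leftEquiv n p).apply_symm_apply _

theorem compLinearMap_leftEquiv_two (F : DiffForm n G 2) (p : G) (a b : TangentSpace (𝓡 n) p) :
    (F p).compLinearMap (leftEquiv n p).toLinearMap
      ![(leftEquiv n p).symm a, (leftEquiv n p).symm b] = F p ![a, b] := by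
  rw [AlternatingMap.compLinearMap_apply]
  congr 1
  funext i; fin_cases i <;> exact (leftEquiv n p).apply_symm_apply _

/-- This isolates the non-algebraic part of the bracket. All the ways in which a derivative of `u`
enters the covector component, except through `∇_{π v} u`, combine into the single term `2⟨∇u, v⟩`.
-/
theorem dorfman_eq (H : DiffForm n G 3) (F : DiffForm n G 2) {u v : Sec n G}
    (hu : SmoothSec u) (hv : SmoothSec v) (p : G) :
    dorfman H F u v p =
      transport p (algDorfman ((H p).compLinearMap (leftEquiv n p).toLinearMap)
        ((F p).compLinearMap (leftEquiv n p).toLinearMap)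
        ((transport p).symm (u p)) ((transport p).symm (v p)))
      + conn v p (u p).1 - conn u p (v p).1
      + (0, (2 : ℝ) • (spForm (v p) ∘ₗ conn u p), 0) := by
  refine Prod.ext ?_ (Prod.ext ?_ ?_)
  · simp only [Prod.fst_add, Prod.fst_sub, transport_fst, add_zero]
    simp only [algDorfman, transport_symm_fst]
    exact conn_fst_eq_zero_add hu hv p
  · refine (leftFrame n p).ext fun k => ?_
    have hl : (dorfman H F u v p).2.1 (leftFrame n p k) =
        dorfmanCov H F u v (frameField n G k) p := (leftFrame n p).constr_basis ℝ _ k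
    have hk : leftFrame n p k = leftEquiv n p (stdBasis n G k) := rfl
    have hk' : stdBasis n G k = (leftEquiv n p).symm (leftFrame n p k) := by
      rw [hk, LinearEquiv.symm_apply_apply]
    rw [hl, dorfmanCov_frameField H F hu hv]
    simp only [Prod.snd_add, Prod.fst_add, Prod.snd_sub, Prod.fst_sub, LinearMap.add_apply,
      LinearMap.sub_apply, LinearMap.smul_apply, LinearMap.comp_apply, spForm_apply, smul_eq_mul]
    congr 1
    congr 1
    congr 1
    rw [hk, transport_snd, ← hk]
    simp only [algDorfman, LinearMap.coe_mk, AddHom.coe_mk, transport_symm_fst,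
      transport_symm_snd, transport_symm_thd]
    rw [← compLinearMap_leftEquiv_three, ← compLinearMap_leftEquiv_two,
      ← compLinearMap_leftEquiv_two, ← hk']
  · have h1 : der (fun q => (u q).1) (fun q => (v q).2.2) p = (conn v p (u p).1).2.2 :=
      (conn_thd hv p _).symm
    have h2 : der (fun q => (v q).1) (fun q => (u q).2.2) p = (conn u p (v p).1).2.2 :=
      (conn_thd hu p _).symm
    simp only [dorfman, Prod.snd_add, Prod.snd_sub, transport_thd, h1, h2, add_zero]
    simp only [algDorfman, transport_symm_fst, compLinearMap_leftEquiv_two]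
    ring

end Pairing

/-- The algebraic condition for integrability of a left-invariant structure on `V ⊕ V* ⊕ ℝ`. -/
def AlgIntegrable {V : Type*} [LieRing V] [LieAlgebra ℝ V] (H : V [⋀^Fin 3]→ₗ[ℝ] ℝ)
    (F : V [⋀^Fin 2]→ₗ[ℝ] ℝ) (A : V × Module.Dual ℝ V × ℝ →ₗ[ℝ] V × Module.Dual ℝ V × ℝ) : Prop :=
  ∀ a b c d, A a = -b → A b = a → A c = -d → A d = c →
    A (algDorfman H F a c - algDorfman H F b d) = -(algDorfman H F a d + algDorfman H F b c) ∧
    A (algDorfman H F a d + algDorfman H F b c) = algDorfman H F a c - algDorfman H F b d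

/-- For `a + ib` and `c + id` in `L`, the `N`, `M` are the algebraic brackets and the `x`, `y` are
the covariant derivatives in `[a,c], [b,d]` and `[a,d], [b,c]` respectively. The `s` are the terms
`2⟨∇·, ·⟩`, which isotropy of `L` makes cancel in the complex bracket. -/
theorem complex_bracket_bookkeeping {E : Type*} [AddCommGroup E] [Module ℝ E] (A : E →ₗ[ℝ] E)
    {N₁ N₂ M₁ M₂ x₁ x₂ x₃ x₄ y₁ y₂ y₃ y₄ s₁ s₂ : E}
    (hN : A (N₁ - N₂) = -(M₁ + M₂)) (hM : A (M₁ + M₂) = N₁ - N₂)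
    (hx₁ : A x₁ = -y₁) (hx₂ : A x₂ = -y₄) (hx₃ : A x₃ = y₃) (hx₄ : A x₄ = y₂)
    (hy₁ : A y₁ = x₁) (hy₂ : A y₂ = -x₄) (hy₃ : A y₃ = -x₃) (hy₄ : A y₄ = x₂) :
    A ((N₁ + x₁ - x₂ + s₁) - (N₂ + x₃ - x₄ + s₁)) =
      -((M₁ + y₁ - y₂ + -s₂) + (M₂ + y₃ - y₄ + s₂)) ∧
    A ((M₁ + y₁ - y₂ + -s₂) + (M₂ + y₃ - y₄ + s₂)) =
      (N₁ + x₁ - x₂ + s₁) - (N₂ + x₃ - x₄ + s₁) := by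
  have e₁ : (N₁ + x₁ - x₂ + s₁) - (N₂ + x₃ - x₄ + s₁) = (N₁ - N₂) + (x₁ - x₂ - x₃ + x₄) := by abel
  have e₂ : (M₁ + y₁ - y₂ + -s₂) + (M₂ + y₃ - y₄ + s₂) = (M₁ + M₂) + (y₁ - y₂ + y₃ - y₄) := by
    abel
  rw [e₁, e₂, map_add A (N₁ - N₂), map_add A (M₁ + M₂), hN, hM]
  simp only [map_add, map_sub, hx₁, hx₂, hx₃, hx₄, hy₁, hy₂, hy₃, hy₄]
  exact ⟨by abel, by abel⟩

/-! ### Reduction of integrability to an algebraic condition. -/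

section Reduction

variable {n : ℕ} {G : Type*} [TopologicalSpace G] [ChartedSpace (EuclideanSpace ℝ (Fin n)) G]
  [Group G] [LieGroup (𝓡 n) ∞ G]

/-- A field of endomorphisms of `E` is left-invariant. -/
def LeftInvEndE (A : EndE n G) : Prop :=
  ∀ (p : G) (w : Fibre n (1 : G)), A p (transport p w) = transport p (A 1 w)

theorem coords_transport (w : Fibre n (1 : G)) :
    coords (fun p : G => transport p w) = fun _ => (fibreEquiv 1).symm w := by
  funext p
  exact (fibreEquiv p).symm_apply_apply _

theorem smoothSec_transport (w : Fibre n (1 : G)) : SmoothSec (fun p : G => transport p w) := by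
  rw [smoothSec_iff, coords_transport]
  exact contMDiff_const

theorem conn_transport (w : Fibre n (1 : G)) (p : G) :
    conn (fun p : G => transport p w) p = 0 := by
  ext1 x
  unfold conn
  rw [coords_transport, mvfderiv_const]
  exact map_zero (fibreEquiv p)

theorem compLinearMap_leftEquiv_one {k : ℕ} (α : DiffForm n G k) :
    (α 1).compLinearMap (leftEquiv n (1 : G)).toLinearMap = α 1 := by
  ext x
  rw [AlternatingMap.compLinearMap_apply]
  congr 1
  funext i
  exact leftEquiv_one (x i)

theorem dorfman_transport_one (H : DiffForm n G 3) (F : DiffForm n G 2) (u v : Fibre n (1 : G)) :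
    dorfman H F (fun p => transport p u) (fun p => transport p v) 1 =
      algDorfman (V := GroupLieAlgebra (𝓡 n) G) (H 1) (F 1) u v := by
  rw [dorfman_eq H F (smoothSec_transport u) (smoothSec_transport v), conn_transport,
    conn_transport, LinearEquiv.symm_apply_apply, LinearEquiv.symm_apply_apply, transport_one,
    LinearMap.comp_zero, smul_zero]
  rw [LinearMap.zero_apply, LinearMap.zero_apply, add_zero, sub_zero]
  refine (add_zero _).trans ?_
  congr 1
  · exact compLinearMap_leftEquiv_one H
  · exact compLinearMap_leftEquiv_one F

/-- Left-invariant sections are parallel, so on them the bracket at the identity is purely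
algebraic. -/
theorem IsIntegrable.algIntegrable {H : DiffForm n G 3} {F : DiffForm n G 2} {A : EndE n G}
    (hA : LeftInvEndE A) (h : IsIntegrable H F A) :
    AlgIntegrable (V := GroupLieAlgebra (𝓡 n) G) (H 1) (F 1) (A 1) := by
  intro a b c d hab hba hcd hdc
  have hL : ∀ a b : Fibre n (1 : G), A 1 a = -b → A 1 b = a →
      InL A (fun p => transport p a) (fun p => transport p b) := fun a b h1 h2 p => by
    rw [hA, hA, h1, h2, map_neg]; exact ⟨rfl, rfl⟩
  have := h _ _ _ _ (smoothSec_transport a) (smoothSec_transport b) (smoothSec_transport c)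
    (smoothSec_transport d) (hL a b hab hba) (hL c d hcd hdc) 1
  simp only [Pi.add_apply, Pi.sub_apply, dorfman_transport_one] at this
  exact this

theorem LeftInvEndE.coords_apply {A : EndE n G} (hA : LeftInvEndE A) (u : Sec n G) (p : G) :
    coords (fun q => A q (u q)) p =
      ((fibreEquiv 1).symm.toLinearMap ∘ₗ A 1 ∘ₗ (fibreEquiv 1).toLinearMap) (coords u p) := by
  have h := hA p ((transport p).symm (u p))
  rw [LinearEquiv.apply_symm_apply] at h
  show (fibreEquiv p).symm (A p (u p)) = _
  rw [h, LinearEquiv.symm_apply_eq]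
  rfl

theorem LeftInvEndE.smoothEnd {A : EndE n G} (hA : LeftInvEndE A) : SmoothEnd A := by
  intro u hu
  rw [smoothSec_iff] at hu ⊢
  rw [funext (hA.coords_apply u)]
  exact (LinearMap.toContinuousLinearMap ((fibreEquiv 1).symm.toLinearMap ∘ₗ A 1 ∘ₗ
    (fibreEquiv (1 : G)).toLinearMap)).contMDiff.comp hu

/-- In the trivialization `A` is a constant matrix, hence commutes with differentiation. -/
theorem LeftInvEndE.conn_apply {A : EndE n G} (hA : LeftInvEndE A) {u : Sec n G}
    (hu : SmoothSec u) (p : G) (x : TangentSpace (𝓡 n) p) :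
    conn (fun q => A q (u q)) p x = A p (conn u p x) := by
  have h := hA p ((transport p).symm (conn u p x))
  rw [LinearEquiv.apply_symm_apply] at h
  rw [h]
  show fibreEquiv p (mvfderiv (𝓡 n) (coords (fun q => A q (u q))) p x) = _
  rw [funext (hA.coords_apply u), mvfderiv_linear_comp _ (hu.mdifferentiableAt p)]
  have h2 : (transport p).symm (conn u p x) =
      fibreEquiv 1 (mvfderiv (𝓡 n) (coords u) p x) := by
    rw [LinearEquiv.symm_apply_eq]
    exact congrArg (fibreEquiv p) ((fibreEquiv 1).symm_apply_apply _).symm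
  rw [h2]
  rfl

theorem conn_neg (u : Sec n G) (p : G) (x : TangentSpace (𝓡 n) p) :
    conn (fun q => -u q) p x = - conn u p x := by
  show fibreEquiv p (mvfderiv (𝓡 n) (coords (fun q => -u q)) p x) = _
  have : coords (fun q => -u q) = - coords u := by
    funext q
    exact map_neg (fibreEquiv q).symm (u q)
  rw [this, mvfderiv_neg]
  exact map_neg (fibreEquiv p) _

/-- The connection preserves `L`, and `L` is isotropic by skew-symmetry of `A`, so only the
algebraic bracket remains to be controlled. With zero forms this bracket is the same at every point.
-/
theorem isIntegrable_zero_of_algIntegrable {A : EndE n G} (hA : LeftInvEndE A)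
    (hskew : ∀ (p : G) (u v : Fibre n p), sp (A p u) v = - sp u (A p v))
    (h : AlgIntegrable (V := GroupLieAlgebra (𝓡 n) G) 0 0 (A 1)) : IsIntegrable 0 0 A := by
  intro a b c d ha hb hc hd hab hcd p
  have hconn : ∀ a b : Sec n G, SmoothSec a → SmoothSec b → InL A a b → ∀ x,
      A p (conn a p x) = - conn b p x ∧ A p (conn b p x) = conn a p x := by
    intro a b ha hb hab x
    rw [← hA.conn_apply ha, ← hA.conn_apply hb, ← conn_neg]
    rw [funext fun q => (hab q).1, funext fun q => (hab q).2]
    exact ⟨rfl, rfl⟩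
  have h1 := hconn a b ha hb hab
  have h2 := hconn c d hc hd hcd
  have ht : ∀ w : Fibre n p, A 1 ((transport p).symm w) = (transport p).symm (A p w) := by
    intro w
    rw [LinearEquiv.eq_symm_apply, ← hA, LinearEquiv.apply_symm_apply]
  have hal := h ((transport p).symm (a p)) ((transport p).symm (b p)) ((transport p).symm (c p))
    ((transport p).symm (d p)) (by rw [ht, (hab p).1, map_neg]) (by rw [ht, (hab p).2])
    (by rw [ht, (hcd p).1, map_neg]) (by rw [ht, (hcd p).2])
  -- Real and imaginary parts of `⟨∇(a + ib), c + id⟩ = 0`, the isotropy of `L`.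
  have hp1 : spForm (c p) ∘ₗ conn a p = spForm (d p) ∘ₗ conn b p := by
    ext1 x
    simp only [LinearMap.comp_apply, spForm_apply]
    rw [← (h1 x).2, hskew, (hcd p).1]
    simp only [sp, Prod.fst_neg, Prod.snd_neg, map_neg, LinearMap.neg_apply]; ring
  have hp2 : spForm (d p) ∘ₗ conn a p = - (spForm (c p) ∘ₗ conn b p) := by
    ext1 x
    simp only [LinearMap.comp_apply, spForm_apply, LinearMap.neg_apply]
    rw [← (h1 x).2, hskew, (hcd p).2]
  have z3 : ((0 : DiffForm n G 3) p).compLinearMap (leftEquiv n p).toLinearMap = 0 :=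
    AlternatingMap.zero_compLinearMap _
  have z2 : ((0 : DiffForm n G 2) p).compLinearMap (leftEquiv n p).toLinearMap = 0 :=
    AlternatingMap.zero_compLinearMap _
  simp only [Pi.add_apply, Pi.sub_apply, dorfman_eq 0 0 ha hc, dorfman_eq 0 0 ha hd,
    dorfman_eq 0 0 hb hc, dorfman_eq 0 0 hb hd, z3, z2]
  have hs : ((0, (2 : ℝ) • (spForm (d p) ∘ₗ conn a p), 0) : Fibre n p) =
      - (0, (2 : ℝ) • (spForm (c p) ∘ₗ conn b p), 0) := by
    rw [hp2]; refine Prod.ext ?_ (Prod.ext ?_ ?_) <;> simp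
  rw [hp1, hs]
  refine complex_bracket_bookkeeping (A p) ?_ ?_ (h2 _).1 (h1 _).1 (h2 _).2 (h1 _).2
    (h2 _).2 ?_ ?_ (h1 _).2
  · rw [← map_sub, ← map_add, hA, hal.1, map_neg]
  · rw [← map_sub, ← map_add, hA, hal.2]
  · exact (h1 _).1
  · exact (h2 _).1

end Reduction

/-! ### Linear algebra of `E₊`, `E₋` and the components. -/

section Pointwise

variable {n : ℕ} {G : Type*} [TopologicalSpace G] [ChartedSpace (EuclideanSpace ℝ (Fin n)) G]

/-- The element `x - g(x, ·)` of the fibre of `E₋`. -/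
def eMinus (g : BilinField n G) (p : G) (x : TangentSpace (𝓡 n) p) : Fibre n p := (x, - g p x, 0)

/-- The element `x + g(x, ·) + a` of the fibre of `E₊`. -/
def ePlus (g : BilinField n G) (p : G) (x : TangentSpace (𝓡 n) p) (a : ℝ) : Fibre n p :=
  (x, g p x, a)

/-- `g` is a pseudo-Riemannian metric. -/
structure IsMetric (g : BilinField n G) : Prop where
  symm : ∀ (p : G) (x y : TangentSpace (𝓡 n) p), g p x y = g p y x
  nondeg : ∀ (p : G) (x : TangentSpace (𝓡 n) p), g p x = 0 → x = 0

theorem sp_eMinus_eMinus {g : BilinField n G} (hg : IsMetric g) (p : G)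
    (x y : TangentSpace (𝓡 n) p) : sp (eMinus g p x) (eMinus g p y) = - g p x y := by
  simp only [sp, eMinus, LinearMap.neg_apply, hg.symm p y x]; ring

theorem sp_ePlus_ePlus {g : BilinField n G} (hg : IsMetric g) (p : G)
    (x y : TangentSpace (𝓡 n) p) (a b : ℝ) :
    sp (ePlus g p x a) (ePlus g p y b) = g p x y + a * b := by
  simp only [sp, ePlus, hg.symm p y x]; ring

theorem sp_ePlus_eMinus {g : BilinField n G} (hg : IsMetric g) (p : G)
    (x y : TangentSpace (𝓡 n) p) (a : ℝ) : sp (ePlus g p x a) (eMinus g p y) = 0 := by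
  simp only [sp, ePlus, eMinus, LinearMap.neg_apply, hg.symm p y x]; ring

theorem sp_eMinus_ePlus {g : BilinField n G} (hg : IsMetric g) (p : G)
    (x y : TangentSpace (𝓡 n) p) (a : ℝ) : sp (eMinus g p y) (ePlus g p x a) = 0 := by
  rw [sp_comm, sp_ePlus_eMinus hg]

/-- The isomorphism `TG ≅ T*G` given by a metric. -/
def IsMetric.equiv {g : BilinField n G} (hg : IsMetric g) (p : G) :
    TangentSpace (𝓡 n) p ≃ₗ[ℝ] Module.Dual ℝ (TangentSpace (𝓡 n) p) :=
  haveI : FiniteDimensional ℝ (TangentSpace (𝓡 n) p) :=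
    inferInstanceAs (FiniteDimensional ℝ (EuclideanSpace ℝ (Fin n)))
  LinearEquiv.ofInjectiveOfFinrankEq (g p)
    ((injective_iff_map_eq_zero (g p)).2 (hg.nondeg p)) Subspace.dual_finrank_eq.symm

theorem IsMetric.apply_equiv_symm {g : BilinField n G} (hg : IsMetric g) (p : G)
    (ξ : Module.Dual ℝ (TangentSpace (𝓡 n) p)) : g p ((hg.equiv p).symm ξ) = ξ :=
  (hg.equiv p).apply_symm_apply ξ

theorem IsMetric.equiv_symm_apply {g : BilinField n G} (hg : IsMetric g) (p : G)
    (x : TangentSpace (𝓡 n) p) : (hg.equiv p).symm (g p x) = x :=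
  (hg.equiv p).symm_apply_apply x

theorem exists_eq_eMinus_add_ePlus {g : BilinField n G} (hg : IsMetric g) (p : G)
    (u : Fibre n p) : ∃ x y a, u = eMinus g p x + ePlus g p y a := by
  obtain ⟨x, ξ, l⟩ := u
  refine ⟨(1 / 2 : ℝ) • (x - (hg.equiv p).symm ξ), (1 / 2 : ℝ) • (x + (hg.equiv p).symm ξ), l,
    Prod.ext ?_ (Prod.ext ?_ ?_)⟩
  · simp only [eMinus, ePlus, Prod.fst_add]; module
  · simp only [eMinus, ePlus, Prod.fst_add, Prod.snd_add, map_smul, map_sub, map_add,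
      hg.apply_equiv_symm]
    module
  · simp only [eMinus, ePlus, Prod.snd_add, zero_add]

/-- The endomorphism `A` of `E` preserves `E₊` and `E₋` and has components `(J₊, J₋, X₊)`. -/
structure HasComponents (A : EndE n G) (g : BilinField n G) (Jp Jm : EndField n G)
    (Xp : VecField n G) : Prop where
  minus : ∀ (p : G) (x : TangentSpace (𝓡 n) p), A p (eMinus g p x) = eMinus g p (Jm p x)
  plus : ∀ (p : G) (x : TangentSpace (𝓡 n) p) (a : ℝ),
    A p (ePlus g p x a) = ePlus g p (Jp p x + a • Xp p) (- g p (Xp p) x)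

theorem IsAdaptedTo.sq [Group G] [LieGroup (𝓡 n) ∞ G] {g : BilinField n G} (hg : IsMetric g)
    {J : EndField n G} {X : VecField n G} (h : IsAdaptedTo g J X) (hX : ∀ p, g p (X p) (X p) = 1)
    (p : G) (x : TangentSpace (𝓡 n) p) : J p (J p x) = -x + g p (X p) x • X p := by
  obtain ⟨_, h1, h2⟩ := h p
  have h3 := h2 (x - g p (X p) x • X p) (by
    simp only [map_sub, map_smul, LinearMap.sub_apply, LinearMap.smul_apply, hX p,
      hg.symm p x (X p), smul_eq_mul]
    ring)
  simp only [map_sub, map_smul, h1, smul_zero, sub_zero] at h3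
  rw [h3]; module

theorem HasComponents.skew [Group G] [LieGroup (𝓡 n) ∞ G] {A : EndE n G} {g : BilinField n G}
    {Jp Jm : EndField n G} {Xp Xm : VecField n G} (hA : HasComponents A g Jp Jm Xp)
    (hg : IsMetric g) (hp : IsAdaptedTo g Jp Xp) (hm : IsAdaptedTo g Jm Xm) (p : G)
    (u v : Fibre n p) : sp (A p u) v = - sp u (A p v) := by
  obtain ⟨x, y, a, rfl⟩ := exists_eq_eMinus_add_ePlus hg p u
  obtain ⟨x', y', a', rfl⟩ := exists_eq_eMinus_add_ePlus hg p v
  have hl : ∀ u u' v : Fibre n p, sp (u + u') v = sp u v + sp u' v := fun u u' v =>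
    map_add (spForm v) u u'
  have hr : ∀ u v v' : Fibre n p, sp u (v + v') = sp u v + sp u v' := fun u v v' => by
    rw [sp_comm, hl, sp_comm v, sp_comm v']
  simp only [map_add, hA.minus, hA.plus, hl, hr, sp_eMinus_eMinus hg, sp_ePlus_ePlus hg,
    sp_ePlus_eMinus hg, sp_eMinus_ePlus hg, LinearMap.add_apply, LinearMap.smul_apply, map_smul,
    smul_eq_mul, (hp p).1, (hm p).1, hg.symm p y (Xp p)]
  ring

/-- On `E₊` the kernel `X₊` of `J₊` is rotated into the summand `ℝ`, so `A² = -1` there; on `E₋` the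
direction of `X₋` is the only defect. -/
theorem HasComponents.sq [Group G] [LieGroup (𝓡 n) ∞ G] {A : EndE n G} {g : BilinField n G}
    {Jp Jm : EndField n G} {Xp Xm : VecField n G} (hA : HasComponents A g Jp Jm Xp)
    (hg : IsMetric g) (hp : IsAdaptedTo g Jp Xp) (hm : IsAdaptedTo g Jm Xm)
    (hXp : ∀ p, g p (Xp p) (Xp p) = 1) (hXm : ∀ p, g p (Xm p) (Xm p) = 1) (p : G)
    (u : Fibre n p) :
    A p (A p u) = -u - sp u (eMinus g p (Xm p)) • eMinus g p (Xm p) := by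
  obtain ⟨x, y, a, rfl⟩ := exists_eq_eMinus_add_ePlus hg p u
  have hl : ∀ u u' v : Fibre n p, sp (u + u') v = sp u v + sp u' v := fun u u' v =>
    map_add (spForm v) u u'
  have hz : g p (Xp p) (Jp p y) = 0 := by
    rw [hg.symm, (hp p).1, (hp p).2.1, map_zero, neg_zero]
  simp only [map_add, hA.minus, hA.plus, hl, sp_eMinus_eMinus hg, sp_ePlus_eMinus hg, map_smul,
    (hp p).2.1, hp.sq hg hXp, hm.sq hg hXm, hz, smul_eq_mul, hXp, hg.symm p x (Xm p)]
  refine Prod.ext ?_ (Prod.ext ?_ ?_)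
  · simp only [eMinus, ePlus, Prod.fst_add, Prod.fst_sub, Prod.fst_neg, Prod.smul_fst]
    module
  · simp only [eMinus, ePlus, Prod.fst_add, Prod.fst_sub, Prod.fst_neg, Prod.smul_fst,
      Prod.snd_add, Prod.snd_sub, Prod.snd_neg, Prod.smul_snd, map_add, map_neg, map_smul, map_zero]
    module
  · simp only [eMinus, ePlus, Prod.snd_add, Prod.snd_sub, Prod.snd_neg, Prod.smul_snd]
    simp

end Pointwise

/-! ### Left-invariance of the endomorphism from that of its components. -/

section LeftInvariance

variable {n : ℕ} {G : Type*} [TopologicalSpace G] [ChartedSpace (EuclideanSpace ℝ (Fin n)) G]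
  [Group G] [LieGroup (𝓡 n) ∞ G]

theorem transport_eMinus {g : BilinField n G} (hl : LeftInvBilin g) (p : G)
    (x : TangentSpace (𝓡 n) (1 : G)) :
    transport p (eMinus g 1 x) = eMinus g p (leftEquiv n p x) := by
  refine Prod.ext (transport_fst p _) (Prod.ext ?_ rfl)
  ext z
  obtain ⟨z, rfl⟩ := (leftEquiv n p).surjective z
  rw [transport_snd]
  exact congrArg Neg.neg (hl p x z).symm

theorem transport_ePlus {g : BilinField n G} (hl : LeftInvBilin g) (p : G)
    (x : TangentSpace (𝓡 n) (1 : G)) (a : ℝ) :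
    transport p (ePlus g 1 x a) = ePlus g p (leftEquiv n p x) a := by
  refine Prod.ext (transport_fst p _) (Prod.ext ?_ rfl)
  ext z
  obtain ⟨z, rfl⟩ := (leftEquiv n p).surjective z
  rw [transport_snd]
  exact (hl p x z).symm

theorem leftInvVec_iff {X : VecField n G} :
    LeftInvVec X ↔ ∀ p, X p = leftEquiv n p (X 1) := Iff.rfl

theorem leftInvEnd_iff {J : EndField n G} :
    LeftInvEnd J ↔ ∀ p x, J p (leftEquiv n p x) = leftEquiv n p (J 1 x) := Iff.rfl

theorem leftInvBilin_iff {g : BilinField n G} :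
    LeftInvBilin g ↔ ∀ p x y, g p (leftEquiv n p x) (leftEquiv n p y) = g 1 x y := Iff.rfl

theorem HasComponents.leftInv {A : EndE n G} {g : BilinField n G}
    {Jp Jm : EndField n G} {Xp : VecField n G} (hA : HasComponents A g Jp Jm Xp)
    (hg : IsMetric g) (lg : LeftInvBilin g) (lp : LeftInvEnd Jp) (lm : LeftInvEnd Jm)
    (lX : LeftInvVec Xp) : LeftInvEndE A := by
  intro p w
  obtain ⟨x, y, a, rfl⟩ := exists_eq_eMinus_add_ePlus hg 1 w
  rw [leftInvEnd_iff] at lp lm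
  rw [leftInvVec_iff] at lX
  have e : leftEquiv n p (Jp 1 y + a • Xp 1) = Jp p (leftEquiv n p y) + a • Xp p := by
    rw [lp, lX p]
    exact (map_add _ _ _).trans (congrArg (_ + ·) (map_smul _ _ _))
  have e' : g p (Xp p) (leftEquiv n p y) = g 1 (Xp 1) y := by
    rw [lX p]; exact lg p _ _
  rw [map_add, map_add, transport_eMinus lg, transport_ePlus lg, hA.minus, hA.plus, map_add,
    map_add, hA.minus, hA.plus, transport_eMinus lg, transport_ePlus lg, e, e', lm]

end LeftInvariance

/-! ### Algebraic properties of the components of a structure. -/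

section ComponentsOfStructure

variable {G : Type*} [TopologicalSpace G] [ChartedSpace (EuclideanSpace ℝ (Fin 3)) G]

theorem IsComponents.hasComponents {Γ 𝓕 : EndE 3 G} {g : BilinField 3 G} {Jp Jm : EndField 3 G}
    {Xp Xm : VecField 3 G} (h : IsComponents Γ 𝓕 g Jp Jm Xp Xm) :
    HasComponents 𝓕 g Jp Jm Xp := ⟨h.minus, h.plus⟩

theorem IsComponents.Xm_unit {Γ 𝓕 : EndE 3 G} {g : BilinField 3 G} {Jp Jm : EndField 3 G}
    {Xp Xm : VecField 3 G} (h : IsComponents Γ 𝓕 g Jp Jm Xp Xm) (p : G) :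
    g p (Xm p) (Xm p) = 1 := by
  rw [h.metric, h.normalized, neg_neg]

/-- A generalized metric and an endomorphism with given components. -/
structure IsPairWithComponents (Γ 𝓕 : EndE 3 G) (g : BilinField 3 G) (Jp Jm : EndField 3 G)
    (Xp : VecField 3 G) : Prop where
  minus : ∀ p x, Γ p (eMinus g p x) = - eMinus g p x
  plus : ∀ p x a, Γ p (ePlus g p x a) = ePlus g p x a
  comps : HasComponents 𝓕 g Jp Jm Xp

/-- `Γ` is `-1` on `E₋` and `1` on `E₊`, so the second structure differs from the first only in the
sign of `J₋`. Arguments stated for arbitrary `J₋` therefore apply to both. -/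
theorem IsPairWithComponents.comp {Γ 𝓕 : EndE 3 G} {g : BilinField 3 G} {Jp Jm : EndField 3 G}
    {Xp : VecField 3 G} (h : IsPairWithComponents Γ 𝓕 g Jp Jm Xp) :
    HasComponents (fun p => Γ p ∘ₗ 𝓕 p) g Jp (-Jm) Xp where
  minus p x := by
    rw [LinearMap.comp_apply, h.comps.minus, h.minus]
    refine Prod.ext rfl (Prod.ext ?_ ?_)
    · exact congrArg Neg.neg (map_neg (g p) (Jm p x)).symm
    · simp [eMinus]
  plus p x a := by rw [LinearMap.comp_apply, h.comps.plus, h.plus]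

variable [Group G] [LieGroup (𝓡 3) ∞ G]

/-- If `g(y, ·) = 0`, then the element of `E₋` over `y` is orthogonal to `u - Γu` in `E₋` by the
formula for `g`, and to `u + Γu` because `Γ` is orthogonal. Hence it is orthogonal to every `u`, and
testing on covectors gives `y = 0`. -/
theorem IsComponents.isMetric {Γ 𝓕 : EndE 3 G} {g : BilinField 3 G} {Jp Jm : EndField 3 G}
    {Xp Xm : VecField 3 G} (h : IsComponents Γ 𝓕 g Jp Jm Xp Xm)
    (hΓ : IsGenMetric Γ) : IsMetric g := by
  have hs : ∀ (p : G) (x y : TangentSpace (𝓡 3) p), g p x y = g p y x := by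
    intro p x y
    have := h.metric p x y
    simp only [sp, LinearMap.neg_apply] at this
    linarith
  refine ⟨hs, fun p y hy => ?_⟩
  have hm : ∀ x, Γ p (eMinus g p x) = - eMinus g p x := fun x => (h.standard p _).2 ⟨x, rfl⟩
  have key : ∀ u : Fibre 3 p, sp (eMinus g p y) u = 0 := by
    intro u
    obtain ⟨z, hz⟩ := (h.standard p (u - Γ p u)).1 (by rw [map_sub, hΓ.invol]; abel)
    have h1 : sp (eMinus g p y) (u - Γ p u) = 0 := by
      rw [hz]
      have := h.metric p y z
      simp only [hy, LinearMap.zero_apply] at this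
      simp only [eMinus, hy]
      linarith
    have h2 : sp (eMinus g p y) (u + Γ p u) = 0 := by
      have := hΓ.orth p (eMinus g p y) (u + Γ p u)
      rw [hm, map_add, hΓ.invol, add_comm (Γ p u)] at this
      simp only [sp, Prod.fst_neg, Prod.snd_neg, map_neg, LinearMap.neg_apply] at this ⊢
      linarith
    have h3 : sp (eMinus g p y) (u - Γ p u) + sp (eMinus g p y) (u + Γ p u) =
        2 * sp (eMinus g p y) u := by
      simp only [sp, Prod.fst_add, Prod.snd_add, Prod.fst_sub, Prod.snd_sub, map_add, map_sub,
        LinearMap.add_apply, LinearMap.sub_apply]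
      ring
    linarith
  rw [← Module.forall_dual_apply_eq_zero_iff ℝ]
  intro ξ
  have := key (0, ξ, 0)
  simp only [sp, eMinus, map_zero, add_zero, mul_zero] at this
  linarith

/-- The square formula forces every kernel vector of `𝓕` to be a multiple of `u₀`. The normalized
kernel vector given by `X₋` is thus `±u₀`, and the formula does not see this sign. -/
theorem IsComponents.sq_apply {Γ 𝓕 : EndE 3 G} {g : BilinField 3 G} {Jp Jm : EndField 3 G}
    {Xp Xm : VecField 3 G} (h : IsComponents Γ 𝓕 g Jp Jm Xp Xm)
    (h𝓕 : IsGenAlmostComplex 𝓕) (p : G) (u : Fibre 3 p) :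
    𝓕 p (𝓕 p u) = -u - sp u (eMinus g p (Xm p)) • eMinus g p (Xm p) := by
  obtain ⟨u₀, -, hu₀⟩ := h𝓕.square
  obtain ⟨h1, h2, h3⟩ := hu₀ p
  set k := eMinus g p (Xm p)
  have hk : k = (-(sp k (u₀ p))) • u₀ p := by
    have := h3 k
    rw [show 𝓕 p k = 0 from h.kernel p, map_zero] at this
    have e : ((-1 : ℝ) ^ 3 * sp k (u₀ p)) = -(sp k (u₀ p)) := by ring
    rw [e] at this
    exact (sub_eq_zero.1 (by rw [this]; abel)).symm
  set s := sp k (u₀ p)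
  have hsm : ∀ (t : ℝ) (a b : Fibre 3 p), sp a (t • b) = t * sp a b := by
    intro t a b
    rw [sp_comm, sp_comm a]
    exact map_smul (spForm a) t b
  have hss : s * s = 1 := by
    have hn : sp k k = -1 := h.normalized p
    rw [hk, hsm, sp_comm, hsm, h1] at hn
    linarith
  rw [h3 u, hk, hsm, smul_smul]
  have e : -s * sp u (u₀ p) * -s = sp u (u₀ p) := by linear_combination sp u (u₀ p) * hss
  rw [e]
  have e2 : (-1 : ℝ) ^ 3 * sp u (u₀ p) = -(sp u (u₀ p)) := by ring
  rw [e2]; module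

theorem IsComponents.adapted_minus {Γ 𝓕 : EndE 3 G} {g : BilinField 3 G} {Jp Jm : EndField 3 G}
    {Xp Xm : VecField 3 G} (h : IsComponents Γ 𝓕 g Jp Jm Xp Xm) (hΓ : IsGenMetric Γ)
    (h𝓕 : IsGenAlmostComplex 𝓕) : IsAdaptedTo g Jm Xm := by
  have hg := h.isMetric hΓ
  have hm : ∀ p x, 𝓕 p (eMinus g p x) = eMinus g p (Jm p x) := h.minus
  intro p
  refine ⟨fun x y => ?_, ?_, fun x hx => ?_⟩
  · have := h𝓕.skew p (eMinus g p x) (eMinus g p y)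
    rw [hm, hm, sp_eMinus_eMinus hg, sp_eMinus_eMinus hg] at this
    linarith
  · have := h.kernel p
    exact congrArg Prod.fst ((h.minus p (Xm p)).symm.trans this)
  · have := h.sq_apply h𝓕 p (eMinus g p x)
    rw [hm, hm, sp_eMinus_eMinus hg, hx, neg_zero, zero_smul, sub_zero] at this
    exact congrArg Prod.fst this

theorem IsComponents.adapted_plus {Γ 𝓕 : EndE 3 G} {g : BilinField 3 G} {Jp Jm : EndField 3 G}
    {Xp Xm : VecField 3 G} (h : IsComponents Γ 𝓕 g Jp Jm Xp Xm) (hΓ : IsGenMetric Γ)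
    (h𝓕 : IsGenAlmostComplex 𝓕) : IsAdaptedTo g Jp Xp ∧ ∀ p, g p (Xp p) (Xp p) = 1 := by
  have hg := h.isMetric hΓ
  have hm : ∀ p x a, 𝓕 p (ePlus g p x a) =
    ePlus g p (Jp p x + a • Xp p) (- g p (Xp p) x) := h.plus
  have hsq : ∀ p x a, 𝓕 p (𝓕 p (ePlus g p x a)) = - ePlus g p x a := by
    intro p x a
    rw [h.sq_apply h𝓕, sp_ePlus_eMinus hg, zero_smul, sub_zero]
  -- The generator of `ℝ` goes to `X₊` and then to `J₊ X₊ - g(X₊, X₊)`, which must equal `-1`.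
  have h1 : ∀ p, Jp p (Xp p) = 0 := by
    intro p
    have := hsq p 0 1
    rw [hm, hm] at this
    simpa [ePlus] using congrArg Prod.fst this
  have h2 : ∀ p, g p (Xp p) (Xp p) = 1 := by
    intro p
    have := hsq p 0 1
    rw [hm, hm] at this
    simpa [ePlus] using congrArg (fun z => z.2.2) this
  refine ⟨fun p => ⟨fun x y => ?_, h1 p, fun x hx => ?_⟩, h2⟩
  · have := h𝓕.skew p (ePlus g p x 0) (ePlus g p y 0)
    rw [hm, hm, sp_ePlus_ePlus hg, sp_ePlus_ePlus hg] at this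
    simp only [zero_smul, add_zero, mul_zero, zero_mul] at this
    exact this
  · have := hsq p x 0
    rw [hm, hm, hg.symm p (Xp p) x, hx] at this
    simpa [ePlus] using congrArg Prod.fst this

/-- `Γu - u` always lies in `E₋`. For `u` orthogonal to `E₋` it is also orthogonal to `E₋`, so it
vanishes by nondegeneracy of `g`. -/
theorem IsComponents.metric_apply_plus {Γ 𝓕 : EndE 3 G} {g : BilinField 3 G}
    {Jp Jm : EndField 3 G} {Xp Xm : VecField 3 G} (h : IsComponents Γ 𝓕 g Jp Jm Xp Xm)
    (hΓ : IsGenMetric Γ) (p : G) (x : TangentSpace (𝓡 3) p) (a : ℝ) :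
    Γ p (ePlus g p x a) = ePlus g p x a := by
  have hg := h.isMetric hΓ
  have hm : ∀ x, Γ p (eMinus g p x) = - eMinus g p x := fun x => (h.standard p _).2 ⟨x, rfl⟩
  obtain ⟨y, hy⟩ := (h.standard p (Γ p (ePlus g p x a) - ePlus g p x a)).1
    (by rw [map_sub, hΓ.invol]; abel)
  have hy0 : y = 0 := by
    refine hg.nondeg p y (LinearMap.ext fun z => ?_)
    have h1 := hΓ.orth p (ePlus g p x a) (eMinus g p z)
    rw [hm, sp_ePlus_eMinus hg] at h1
    have h2 : Γ p (ePlus g p x a) = eMinus g p y + ePlus g p x a := by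
      rw [show eMinus g p y = Γ p (ePlus g p x a) - ePlus g p x a from hy.symm]; abel
    rw [h2] at h1
    have h3 := sp_eMinus_eMinus hg p y z
    have h4 := sp_ePlus_eMinus hg p x z a
    simp only [sp, Prod.fst_add, Prod.snd_add, Prod.fst_neg, Prod.snd_neg, map_add, map_neg,
      LinearMap.add_apply, LinearMap.neg_apply] at h1 h3 h4
    rw [LinearMap.zero_apply]
    linarith
  rw [hy0] at hy
  have : Γ p (ePlus g p x a) - ePlus g p x a = 0 := by
    rw [hy, map_zero, neg_zero]; rfl
  exact sub_eq_zero.1 this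

theorem IsLeftInvGPK.pair {H : DiffForm 3 G 3} {F : DiffForm 3 G 2} {Γ 𝓕 : EndE 3 G}
    {g : BilinField 3 G} {Jp Jm : EndField 3 G} {Xp Xm : VecField 3 G}
    (h : IsLeftInvGPK H F Γ 𝓕 g Jp Jm Xp Xm) : IsPairWithComponents Γ 𝓕 g Jp Jm Xp where
  minus p x := (h.components.standard p _).2 ⟨x, rfl⟩
  plus := h.components.metric_apply_plus h.kahler.metric
  comps := h.components.hasComponents

end ComponentsOfStructure

/-! ### The generalized metric and the endomorphism with prescribed components. -/

section Construction

variable {G : Type*} [TopologicalSpace G] [ChartedSpace (EuclideanSpace ℝ (Fin 3)) G]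

/-- The generalized metric with `E₋ = {X - g(X, ·)}`. -/
def metricInvolution {g : BilinField 3 G} (hg : IsMetric g) : EndE 3 G := fun p =>
  ((hg.equiv p).symm.toLinearMap ∘ₗ LinearMap.fst ℝ _ _ ∘ₗ LinearMap.snd ℝ _ _).prod
    ((g p ∘ₗ LinearMap.fst ℝ _ _).prod (LinearMap.snd ℝ _ _ ∘ₗ LinearMap.snd ℝ _ _))

/-- The endomorphism of `E` with components `(J₊, J₋, X₊)`. -/
def structureEnd {g : BilinField 3 G} (hg : IsMetric g) (Jp Jm : EndField 3 G)
    (Xp : VecField 3 G) : EndE 3 G := fun p =>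
  let ξ : Fibre 3 p →ₗ[ℝ] TangentSpace (𝓡 3) p :=
    (hg.equiv p).symm.toLinearMap ∘ₗ LinearMap.fst ℝ _ _ ∘ₗ LinearMap.snd ℝ _ _
  -- `S` and `D` are the tangent vectors underlying the `E₊`- and `E₋`-parts of an element of the
  -- fibre.
  let S : Fibre 3 p →ₗ[ℝ] TangentSpace (𝓡 3) p := (1 / 2 : ℝ) • (LinearMap.fst ℝ _ _ + ξ)
  let D : Fibre 3 p →ₗ[ℝ] TangentSpace (𝓡 3) p := (1 / 2 : ℝ) • (LinearMap.fst ℝ _ _ - ξ)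
  let Y : Fibre 3 p →ₗ[ℝ] TangentSpace (𝓡 3) p :=
    Jp p ∘ₗ S + (LinearMap.snd ℝ _ _ ∘ₗ LinearMap.snd ℝ _ _).smulRight (Xp p)
  let Z : Fibre 3 p →ₗ[ℝ] TangentSpace (𝓡 3) p := Jm p ∘ₗ D
  (Y + Z).prod ((g p ∘ₗ (Y - Z)).prod (-(g p (Xp p) ∘ₗ S)))

theorem isPairWithComponents_structureEnd [Group G] [LieGroup (𝓡 3) ∞ G] {g : BilinField 3 G}
    (hg : IsMetric g) (Jp Jm : EndField 3 G) (Xp : VecField 3 G) :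
    IsPairWithComponents (metricInvolution hg) (structureEnd hg Jp Jm Xp) g Jp Jm Xp where
  minus p x := by
    refine Prod.ext ?_ (Prod.ext ?_ ?_)
    · simp [metricInvolution, eMinus, hg.equiv_symm_apply]
    · simp [metricInvolution, eMinus]
    · simp [metricInvolution, eMinus]
  plus p x a := by
    refine Prod.ext ?_ (Prod.ext ?_ ?_)
    · simp [metricInvolution, ePlus, hg.equiv_symm_apply]
    · simp [metricInvolution, ePlus]
    · simp [metricInvolution, ePlus]
  comps := by
    constructor
    · intro p x
      have hh : (2⁻¹ : ℝ) • (x + x) = x := by module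
      refine Prod.ext ?_ (Prod.ext ?_ ?_)
      · simp [structureEnd, eMinus, hg.equiv_symm_apply, hh, -smul_add]
      · simp [structureEnd, eMinus, hg.equiv_symm_apply, hh, -smul_add]
      · simp [structureEnd, eMinus, hg.equiv_symm_apply]
    · intro p x a
      have hh : (2⁻¹ : ℝ) • (x + x) = x := by module
      refine Prod.ext ?_ (Prod.ext ?_ ?_)
      · simp [structureEnd, ePlus, hg.equiv_symm_apply, hh, -smul_add]
      · simp [structureEnd, ePlus, hg.equiv_symm_apply, hh, -smul_add]
      · simp [structureEnd, ePlus, hg.equiv_symm_apply, hh, -smul_add]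

end Construction

/-! ### Alternating forms as multilinear maps. -/

section Alternating

variable {V : Type*} [AddCommGroup V] [Module ℝ V]

theorem alternating_three_swap_left (H : V [⋀^Fin 3]→ₗ[ℝ] ℝ) (a b c : V) :
    H ![b, a, c] = - H ![a, b, c] := by
  rw [← H.map_swap ![a, b, c] (show (0 : Fin 3) ≠ 1 by decide)]
  congr 1; ext i; fin_cases i <;> rfl

theorem alternating_three_swap_right (H : V [⋀^Fin 3]→ₗ[ℝ] ℝ) (a b c : V) :
    H ![a, c, b] = - H ![a, b, c] := by
  rw [← H.map_swap ![a, b, c] (show (1 : Fin 3) ≠ 2 by decide)]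
  congr 1; ext i; fin_cases i <;> rfl

theorem alternating_two_swap (F : V [⋀^Fin 2]→ₗ[ℝ] ℝ) (a b : V) : F ![b, a] = - F ![a, b] := by
  rw [← F.map_swap ![a, b] (show (0 : Fin 2) ≠ 1 by decide)]
  congr 1; ext i; fin_cases i <;> rfl

/-- A 3-form as a trilinear map. -/
def trilinear (H : V [⋀^Fin 3]→ₗ[ℝ] ℝ) : V →ₗ[ℝ] V →ₗ[ℝ] V →ₗ[ℝ] ℝ where
  toFun a := LinearMap.mk₂ ℝ (fun b c => H ![a, b, c])
    (fun b b' c => by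
      simp only [alternating_three_swap_right H a c, alternating_three_add]; ring)
    (fun t b c => by
      simp only [alternating_three_swap_right H a c, alternating_three_smul, smul_eq_mul]; ring)
    (fun b c c' => alternating_three_add H a b c c')
    (fun t b c => alternating_three_smul H a b c t)
  map_add' a a' := by
    ext b c
    simp only [LinearMap.mk₂_apply, LinearMap.add_apply, alternating_three_swap_left H b,
      alternating_three_swap_right H b c, alternating_three_add]
    ring
  map_smul' t a := by
    ext b c
    simp only [LinearMap.mk₂_apply, LinearMap.smul_apply, alternating_three_swap_left H b,
      alternating_three_swap_right H b c, alternating_three_smul, smul_eq_mul, RingHom.id_apply]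
    ring

theorem trilinear_apply (H : V [⋀^Fin 3]→ₗ[ℝ] ℝ) (a b c : V) :
    trilinear H a b c = H ![a, b, c] := rfl

/-- A 2-form as a bilinear map. -/
def bilinear (F : V [⋀^Fin 2]→ₗ[ℝ] ℝ) : V →ₗ[ℝ] V →ₗ[ℝ] ℝ :=
  LinearMap.mk₂ ℝ (fun a b => F ![a, b])
    (fun a a' b => by simp only [alternating_two_swap F b, alternating_two_add]; ring)
    (fun t a b => by
      simp only [alternating_two_swap F b, alternating_two_smul, smul_eq_mul]; ring)
    (fun a b b' => alternating_two_add F a b b')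
    (fun t a b => alternating_two_smul F a b t)

theorem bilinear_apply (F : V [⋀^Fin 2]→ₗ[ℝ] ℝ) (a b : V) : bilinear F a b = F ![a, b] := rfl

end Alternating

/-! ### Two identities forced by the integrability of `𝓕` and of `Γ𝓕`. -/

section Identities

theorem IsAdaptedTo.neg {n : ℕ} {G : Type*} [TopologicalSpace G]
    [ChartedSpace (EuclideanSpace ℝ (Fin n)) G] [Group G] [LieGroup (𝓡 n) ∞ G]
    {g : BilinField n G} {J : EndField n G} {X : VecField n G} (h : IsAdaptedTo g J X) :
    IsAdaptedTo g (-J) X := by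
  intro p
  obtain ⟨h1, h2, h3⟩ := h p
  refine ⟨fun x y => ?_, ?_, fun x hx => ?_⟩
  · simp only [Pi.neg_apply, LinearMap.neg_apply, map_neg, h1]
  · simp only [Pi.neg_apply, LinearMap.neg_apply, h2, neg_zero]
  · simp only [Pi.neg_apply, LinearMap.neg_apply, map_neg, h3 x hx, neg_neg]

theorem LeftInvEnd.neg {n : ℕ} {G : Type*} [TopologicalSpace G]
    [ChartedSpace (EuclideanSpace ℝ (Fin n)) G] [Group G] [LieGroup (𝓡 n) ∞ G]
    {J : EndField n G} (h : LeftInvEnd J) : LeftInvEnd (-J) := by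
  intro p x
  have e := (leftInvEnd_iff.1 h) p x
  show - (J p (leftEquiv n p x)) = leftEquiv n p (-(J 1 x))
  rw [e]; exact (map_neg _ _).symm

/-- The 3-form `⟨[u, v], w⟩` on left-invariant sections. -/
theorem sp_algDorfman {G : Type*} [TopologicalSpace G]
    [ChartedSpace (EuclideanSpace ℝ (Fin 3)) G] [Group G] [LieGroup (𝓡 3) ∞ G]
    (H : GroupLieAlgebra (𝓡 3) G [⋀^Fin 3]→ₗ[ℝ] ℝ) (F : GroupLieAlgebra (𝓡 3) G [⋀^Fin 2]→ₗ[ℝ] ℝ)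
    (u v w : Fibre 3 (1 : G)) :
    sp (algDorfman (V := GroupLieAlgebra (𝓡 3) G) H F u v) w =
      (1 / 2) * (w.2.1 ⁅(u.1 : GroupLieAlgebra (𝓡 3) G), (v.1 : GroupLieAlgebra (𝓡 3) G)⁆
        - v.2.1 ⁅(u.1 : GroupLieAlgebra (𝓡 3) G), (w.1 : GroupLieAlgebra (𝓡 3) G)⁆
        + u.2.1 ⁅(v.1 : GroupLieAlgebra (𝓡 3) G), (w.1 : GroupLieAlgebra (𝓡 3) G)⁆
        + trilinear H v.1 u.1 w.1
        - 2 * (v.2.2 * bilinear F u.1 w.1 - u.2.2 * bilinear F v.1 w.1))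
      + bilinear F u.1 v.1 * w.2.2 := by
  simp only [sp, algDorfman, LinearMap.coe_mk, AddHom.coe_mk, trilinear_apply, bilinear_apply]
  ring

variable {G : Type*} [TopologicalSpace G] [ChartedSpace (EuclideanSpace ℝ (Fin 3)) G]
  [Group G] [LieGroup (𝓡 3) ∞ G]

variable {H : DiffForm 3 G 3} {F : DiffForm 3 G 2} {Γ 𝓕 : EndE 3 G}
  {g : BilinField 3 G} {Jp Jm : EndField 3 G} {Xp Xm : VecField 3 G}

/-- The identity `⟨[u, y - g(y)], X₋ - g(X₋)⟩ = 0` for `u` in `E₊`. -/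
theorem IsLeftInvGPK.sp_plus_minus_Xm (h : IsLeftInvGPK H F Γ 𝓕 g Jp Jm Xp Xm)
    (z y : TangentSpace (𝓡 3) (1 : G)) (a : ℝ) (hy : g 1 y (Xm 1) = 0) :
    sp (algDorfman (V := GroupLieAlgebra (𝓡 3) G) (H 1) (F 1) (ePlus g 1 z a) (eMinus g 1 y))
      (eMinus g 1 (Xm 1)) = 0 := by
  have hg := h.components.isMetric h.kahler.metric
  have hm := h.components.adapted_minus h.kahler.metric h.kahler.complex₁.1
  have hp := h.components.adapted_plus h.kahler.metric h.kahler.complex₁.1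
  -- The bracket of two sections of `L` is again in `L`, so its real part lies in the image of `A`
  -- and is orthogonal to the kernel vector given by `X₋`. Replacing `J₋` by `-J₋` flips the second
  -- summand only; adding the two relations isolates the first.
  have key : ∀ (A : EndE 3 G) (Jm' : EndField 3 G), HasComponents A g Jp Jm' Xp →
      IsAdaptedTo g Jm' Xm → LeftInvEnd Jm' → IsIntegrable H F A →
      sp (algDorfman (V := GroupLieAlgebra (𝓡 3) G) (H 1) (F 1) (ePlus g 1 z a) (eMinus g 1 y))
          (eMinus g 1 (Xm 1)) -
        sp (algDorfman (V := GroupLieAlgebra (𝓡 3) G) (H 1) (F 1) (-A 1 (ePlus g 1 z a))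
          (eMinus g 1 (-Jm' 1 y))) (eMinus g 1 (Xm 1)) = 0 := by
    intro A Jm' hA hJ lJ hint
    have hal := hint.algIntegrable (hA.leftInv hg h.left_g h.left_Jp lJ h.left_Xp)
    have hsq := hA.sq hg hp.1 hJ hp.2 h.components.Xm_unit 1
    have h1 : eMinus g 1 (-Jm' 1 y) = - eMinus g 1 (Jm' 1 y) := by
      refine Prod.ext rfl (Prod.ext ?_ ?_)
      · exact congrArg Neg.neg (map_neg (g 1) (Jm' 1 y))
      · simp [eMinus]
    obtain ⟨-, h2⟩ := hal (ePlus g 1 z a) (-A 1 (ePlus g 1 z a)) (eMinus g 1 y)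
      (eMinus g 1 (-Jm' 1 y)) (neg_neg _).symm
      (by rw [map_neg, hsq, sp_ePlus_eMinus hg, zero_smul, sub_zero, neg_neg])
      (by rw [h1, hA.minus, neg_neg])
      (by rw [h1, ← hA.minus, map_neg, hsq, sp_eMinus_eMinus hg, hy, neg_zero, zero_smul,
        sub_zero, neg_neg])
    have h3 : A 1 (eMinus g 1 (Xm 1)) = 0 := by
      rw [hA.minus, (hJ 1).2.1]
      simp only [eMinus, map_zero, neg_zero]; rfl
    have h4 := hA.skew hg hp.1 hJ 1
      (algDorfman (V := GroupLieAlgebra (𝓡 3) G) (H 1) (F 1) (ePlus g 1 z a)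
        (eMinus g 1 (-Jm' 1 y)) +
      algDorfman (V := GroupLieAlgebra (𝓡 3) G) (H 1) (F 1) (-A 1 (ePlus g 1 z a))
        (eMinus g 1 y)) (eMinus g 1 (Xm 1))
    rw [h2, h3] at h4
    rw [← spForm_apply, ← spForm_apply, ← map_sub, spForm_apply, h4, sp_comm, ← spForm_apply,
      map_zero, neg_zero]
  have k1 := key 𝓕 Jm h.pair.comps hm h.left_Jm h.kahler.complex₁.2
  have k2 := key _ (-Jm) h.pair.comp hm.neg h.left_Jm.neg h.kahler.complex₂.2
  have e1 : (Γ 1 ∘ₗ 𝓕 1) (ePlus g 1 z a) = 𝓕 1 (ePlus g 1 z a) := by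
    rw [h.pair.comp.plus, h.pair.comps.plus]
  rw [e1] at k2
  have e2 : ∀ w : Fibre 3 (1 : G),
      sp (algDorfman (V := GroupLieAlgebra (𝓡 3) G) (H 1) (F 1) w (eMinus g 1 (-(-Jm) 1 y)))
        (eMinus g 1 (Xm 1)) =
      - sp (algDorfman (V := GroupLieAlgebra (𝓡 3) G) (H 1) (F 1) w (eMinus g 1 (-Jm 1 y)))
        (eMinus g 1 (Xm 1)) := by
    intro w
    rw [Pi.neg_apply, LinearMap.neg_apply, neg_neg, sp_algDorfman, sp_algDorfman]
    simp only [eMinus, lie_neg, neg_lie, map_neg, LinearMap.neg_apply]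
    ring
  rw [e2] at k2
  linarith

/-- The two structures agree on `E₊`, so they share the sections of `L` lying in the
complexification of `E₊`, and the bracket of two of these has no `E₋`-part. The sections used are `1
- i X₊` and the one with real part `J₊ y`. -/
theorem IsLeftInvGPK.sp_plus_plus_minus (h : IsLeftInvGPK H F Γ 𝓕 g Jp Jm Xp Xm)
    (y x : TangentSpace (𝓡 3) (1 : G)) :
    sp (algDorfman (V := GroupLieAlgebra (𝓡 3) G) (H 1) (F 1) (ePlus g 1 0 1)
      (ePlus g 1 (Jp 1 y) 0)) (eMinus g 1 x) =
    sp (algDorfman (V := GroupLieAlgebra (𝓡 3) G) (H 1) (F 1) (-ePlus g 1 (Xp 1) 0)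
      (ePlus g 1 (y - g 1 (Xp 1) y • Xp 1) 0)) (eMinus g 1 x) := by
  have hg := h.components.isMetric h.kahler.metric
  have hm := h.components.adapted_minus h.kahler.metric h.kahler.complex₁.1
  have hp := h.components.adapted_plus h.kahler.metric h.kahler.complex₁.1
  set N := algDorfman (V := GroupLieAlgebra (𝓡 3) G) (H 1) (F 1) (ePlus g 1 0 1)
      (ePlus g 1 (Jp 1 y) 0) -
    algDorfman (V := GroupLieAlgebra (𝓡 3) G) (H 1) (F 1) (-ePlus g 1 (Xp 1) 0)
      (ePlus g 1 (y - g 1 (Xp 1) y • Xp 1) 0) with hN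
  set M := algDorfman (V := GroupLieAlgebra (𝓡 3) G) (H 1) (F 1) (ePlus g 1 0 1)
      (ePlus g 1 (y - g 1 (Xp 1) y • Xp 1) 0) +
    algDorfman (V := GroupLieAlgebra (𝓡 3) G) (H 1) (F 1) (-ePlus g 1 (Xp 1) 0)
      (ePlus g 1 (Jp 1 y) 0) with hM
  have key : ∀ (A : EndE 3 G) (Jm' : EndField 3 G), HasComponents A g Jp Jm' Xp →
      LeftInvEnd Jm' → IsIntegrable H F A → A 1 M = N := by
    intro A Jm' hA lJ hint
    have hal := hint.algIntegrable (hA.leftInv hg h.left_g h.left_Jp lJ h.left_Xp)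
    have hz : g 1 (Xp 1) (Jp 1 y) = 0 := by
      rw [hg.symm, (hp.1 1).1, (hp.1 1).2.1, map_zero, neg_zero]
    have hng : ∀ x : TangentSpace (𝓡 3) (1 : G), ePlus g 1 (-x) 0 = -ePlus g 1 x 0 := fun x => by
      refine Prod.ext rfl (Prod.ext ?_ ?_) <;> simp [ePlus]
    refine (hal _ _ _ _ ?_ ?_ ?_ ?_).2
    · rw [hA.plus, neg_neg]; simp
    · rw [map_neg, hA.plus, (hp.1 1).2.1, hp.2]
      refine Prod.ext ?_ (Prod.ext ?_ ?_) <;> simp [ePlus]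
    · rw [hA.plus, hz, neg_zero, zero_smul, add_zero, hp.1.sq hg hp.2, ← hng]
      congr 1; abel
    · rw [hA.plus, zero_smul, add_zero, map_sub, map_smul, (hp.1 1).2.1, smul_zero, sub_zero]
      simp [hp.2]
  have k1 := key 𝓕 Jm h.pair.comps h.left_Jm h.kahler.complex₁.2
  have k2 := key _ (-Jm) h.pair.comp h.left_Jm.neg h.kahler.complex₂.2
  rw [LinearMap.comp_apply, k1] at k2
  -- `𝓕 M = N` and `Γ 𝓕 M = N` together give `Γ N = N`, so `N` is orthogonal to `E₋`.
  have k3 := h.kahler.metric.orth 1 N (eMinus g 1 x)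
  rw [k2, h.pair.minus] at k3
  have k4 : sp N (eMinus g 1 x) = 0 := by
    simp only [sp, Prod.fst_neg, Prod.snd_neg, map_neg, LinearMap.neg_apply] at k3 ⊢
    linarith
  rw [← spForm_apply, hN, map_sub, spForm_apply, spForm_apply] at k4
  linarith

end Identities

/-! ### Classification of the algebraic data on a non-unimodular three-dimensional Lie algebra. -/

section Classification

variable {V : Type*} [LieRing V] [LieAlgebra ℝ V]

/-- The trace of `ad x` in a basis of a three-dimensional Lie algebra. -/
theorem trace_ad_eq (b : Module.Basis (Fin 3) ℝ V) (x : V) :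
    LinearMap.trace ℝ V (LieAlgebra.ad ℝ V x) =
      b.repr ⁅x, b 0⁆ 0 + b.repr ⁅x, b 1⁆ 1 + b.repr ⁅x, b 2⁆ 2 := by
  rw [LinearMap.trace_eq_matrix_trace ℝ b, Matrix.trace_fin_three]
  simp only [LinearMap.toMatrix_apply, LieAlgebra.ad_apply]

/-- A nonzero vector orthogonal to `X` in the kernel of a linear form, completed to an orthogonal
basis by a complex structure on `X^⊥`. -/
theorem exists_orthogonal_basis (hd : Module.finrank ℝ V = 3) (τ : V →ₗ[ℝ] ℝ)
    (g : V →ₗ[ℝ] V →ₗ[ℝ] ℝ) (gs : ∀ x y, g x y = g y x) (gn : ∀ x, g x = 0 → x = 0)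
    (J : V →ₗ[ℝ] V) (X : V) (hX : g X X = 1) (Js : ∀ x y, g (J x) y = - g x (J y)) (JX : J X = 0)
    (J2 : ∀ x, g x X = 0 → J (J x) = -x) :
    ∃ (b : Module.Basis (Fin 3) ℝ V) (e : ℝ), (e = 1 ∨ e = -1) ∧ b 2 = X ∧ τ (b 1) = 0 ∧
      g (b 0) (b 0) = e ∧ g (b 1) (b 1) = e ∧ g (b 0) (b 1) = 0 ∧ g (b 0) X = 0 ∧
      g (b 1) X = 0 := by
  have hfin : FiniteDimensional ℝ V := FiniteDimensional.of_finrank_pos (by omega)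
  -- Two linear conditions on a three-dimensional space have a nonzero common solution.
  have hker : LinearMap.ker (τ.prod (g X)) ≠ ⊥ := by
    refine LinearMap.ker_ne_bot_of_finrank_lt ?_
    rw [hd, Module.finrank_prod, Module.finrank_self]; norm_num
  obtain ⟨v, hv, hv0⟩ := Submodule.exists_mem_ne_zero_of_ne_bot hker
  rw [LinearMap.mem_ker] at hv
  have hτ : τ v = 0 := congrArg Prod.fst hv
  have hvX : g v X = 0 := by rw [gs]; exact congrArg Prod.snd hv
  have mk : ∀ v : V, v ≠ 0 → g v X = 0 → ∃ b : Module.Basis (Fin 3) ℝ V,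
      b 0 = - J v ∧ b 1 = v ∧ b 2 = X := by
    intro v hv0 hvX
    have hli : LinearIndependent ℝ ![-J v, v, X] := by
      rw [Fintype.linearIndependent_iff]
      intro c hc
      have hc' : c 0 • (-J v) + c 1 • v + c 2 • X = 0 := by
        simpa [Fin.sum_univ_three] using hc
      have hJvX : g (J v) X = 0 := by rw [Js, JX, map_zero, neg_zero]
      have c2 : c 2 = 0 := by
        have := congrArg (fun z => g z X) hc'
        simpa [hJvX, hvX, hX] using this
      have e1 : c 1 • v = c 0 • J v := by
        rw [c2, zero_smul, add_zero, smul_neg] at hc'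
        exact (neg_add_eq_zero.1 hc').symm
      have e2 : c 1 • J v = - (c 0 • v) := by
        have := congrArg J e1
        rwa [map_smul, map_smul, J2 v hvX, smul_neg] at this
      -- `v` and `J v` are independent because `J² = -1` on `X^⊥` has no real eigenvalue.
      have e3 : (c 0 * c 0 + c 1 * c 1) • v = 0 := by
        rw [add_smul, mul_smul (c 1), e1, smul_comm, e2, mul_smul, smul_neg, add_neg_cancel]
      have e4 := (smul_eq_zero.1 e3).resolve_right hv0
      have c0 : c 0 = 0 := by nlinarith [mul_self_nonneg (c 0), mul_self_nonneg (c 1)]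
      have c1 : c 1 = 0 := by nlinarith [mul_self_nonneg (c 0), mul_self_nonneg (c 1)]
      intro i; fin_cases i
      exacts [c0, c1, c2]
    refine ⟨basisOfLinearIndependentOfCardEqFinrank hli (by rw [hd]; rfl), ?_, ?_, ?_⟩ <;>
      simp
  have hJX : ∀ v, g (J v) X = 0 := fun v => by rw [Js, JX, map_zero, neg_zero]
  have hJJ : ∀ v, g v X = 0 → g (J v) (J v) = g v v := fun v hv => by
    rw [Js, J2 v hv, map_neg, neg_neg]
  have hJv : ∀ v, g (J v) v = 0 := fun v => by
    have := Js v v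
    rw [gs v] at this; linarith
  -- A null `v` would be orthogonal to the whole basis `-J v, v, X`, as `J v ⊥ v` by skew-symmetry.
  -- Since `J` is an isometry of `X^⊥`, `v` and `J v` then have squares of the same sign `e`.
  have hvv : g v v ≠ 0 := by
    intro h0
    obtain ⟨b, h1, h2, h3⟩ := mk v hv0 hvX
    refine hv0 (gn v (b.ext fun i => ?_))
    fin_cases i
    · show g v (b 0) = 0
      rw [h1, map_neg, gs, hJv, neg_zero]
    · show g v (b 1) = 0
      rw [h2, h0]
    · show g v (b 2) = 0
      rw [h3, hvX]
  set r := (Real.sqrt |g v v|)⁻¹ with hr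
  have hsq : Real.sqrt |g v v| ≠ 0 := (Real.sqrt_pos.2 (abs_pos.2 hvv)).ne'
  have hr0 : r ≠ 0 := inv_ne_zero hsq
  have hrX : g (r • v) X = 0 := by rw [map_smul, LinearMap.smul_apply, hvX, smul_zero]
  obtain ⟨b, h1, h2, h3⟩ := mk (r • v) (smul_ne_zero hr0 hv0) hrX
  have hrr : r * r = |g v v|⁻¹ := by
    rw [hr, ← mul_inv, Real.mul_self_sqrt (abs_nonneg _)]
  have hg : g (r • v) (r • v) = |g v v|⁻¹ * g v v := by
    simp only [map_smul, LinearMap.smul_apply, smul_eq_mul]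
    rw [← mul_assoc, hrr]
  refine ⟨b, |g v v|⁻¹ * g v v, ?_, h3, ?_, ?_, ?_, ?_, ?_, ?_⟩
  · rcases lt_or_gt_of_ne hvv with h | h
    · right; rw [abs_of_neg h, inv_neg, neg_mul, inv_mul_cancel₀ hvv]
    · left; rw [abs_of_pos h, inv_mul_cancel₀ hvv]
  · rw [h2, map_smul, hτ, smul_zero]
  · rw [h1, ← hg, map_neg, map_neg, LinearMap.neg_apply, neg_neg, hJJ _ hrX]
  · rw [h2, hg]
  · rw [h1, h2, map_neg, LinearMap.neg_apply, hJv, neg_zero]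
  · rw [h1, map_neg, LinearMap.neg_apply, hJX, neg_zero]
  · rw [h2, hrX]

/-- The classification of the algebraic data. -/
theorem classification (hd : Module.finrank ℝ V = 3)
    (hu : ∃ x, LinearMap.trace ℝ V (LieAlgebra.ad ℝ V x) ≠ 0)
    (g : V →ₗ[ℝ] V →ₗ[ℝ] ℝ) (gs : ∀ x y, g x y = g y x) (gn : ∀ x, g x = 0 → x = 0)
    (J : V →ₗ[ℝ] V) (X : V) (hX : g X X = 1) (Js : ∀ x y, g (J x) y = - g x (J y)) (JX : J X = 0)
    (J2 : ∀ x, g x X = 0 → J (J x) = -x)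
    (K : V →ₗ[ℝ] V) (Z : V) (hZ : g Z Z = 1) (Ks : ∀ x y, g (K x) y = - g x (K y)) (KZ : K Z = 0)
    (K2 : ∀ x, g x Z = 0 → K (K x) = -x)
    (H : V [⋀^Fin 3]→ₗ[ℝ] ℝ) (F : V [⋀^Fin 2]→ₗ[ℝ] ℝ)
    (hF : ∀ y, g y X = 0 → bilinear F y X = 0)
    (hB : ∀ z y, g y X = 0 →
      - g X ⁅z, y⁆ + g y ⁅z, X⁆ + g z ⁅y, X⁆ + trilinear H y z X = 0)
    (hA : ∀ x y, 2 * bilinear F (K y) x =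
      g x ⁅Z, y⁆ + g y ⁅Z, x⁆ - g Z ⁅y, x⁆ - trilinear H y Z x) :
    H = 0 ∧ F = 0 ∧ (Z = X ∨ Z = -X) ∧ ∃ (w : Module.Basis (Fin 3) ℝ V) (δ ε ε' : ℝ),
      δ ≠ 0 ∧ (ε = 1 ∨ ε = -1) ∧ (ε' = 1 ∨ ε' = -1) ∧ w 2 = X ∧
      (⁅w 0, w 1⁆ = w 1 ∧ ⁅w 0, w 2⁆ = 0 ∧ ⁅w 1, w 2⁆ = 0) ∧
      (g (w 0) (w 0) = ε / δ ^ 2 ∧ g (w 1) (w 1) = ε' ∧ g (w 2) (w 2) = 1 ∧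
        ∀ i j : Fin 3, i ≠ j → g (w i) (w j) = 0) := by
  obtain ⟨b, e, he, bX, hτ, guu, gvv, guv, guX, gvX⟩ := exists_orthogonal_basis hd
    (LinearMap.trace ℝ V ∘ₗ (LieAlgebra.ad ℝ V : V →ₗ[ℝ] Module.End ℝ V)) g gs gn J X hX Js JX J2
  have he0 : e ≠ 0 := by rcases he with h | h <;> rw [h] <;> norm_num
  have hτ' : ∀ x, (LinearMap.trace ℝ V ∘ₗ (LieAlgebra.ad ℝ V : V →ₗ[ℝ] Module.End ℝ V)) x =
    LinearMap.trace ℝ V (LieAlgebra.ad ℝ V x) := fun x => rfl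
  rw [hτ', trace_ad_eq b] at hτ
  set u := b 0 with hub
  set v := b 1 with hvb
  have hrep : ∀ x, ∃ α β γ : ℝ, x = α • u + β • v + γ • X := fun x =>
    ⟨b.repr x 0, b.repr x 1, b.repr x 2, by
      conv_lhs => rw [← b.sum_repr x, Fin.sum_univ_three, bX]⟩
  have r0 : ∀ α β γ : ℝ, b.repr (α • u + β • v + γ • X) 0 = α := by
    intro α β γ; rw [hub, hvb, ← bX]; simp
  have r1 : ∀ α β γ : ℝ, b.repr (α • u + β • v + γ • X) 1 = β := by
    intro α β γ; rw [hub, hvb, ← bX]; simp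
  have r2 : ∀ α β γ : ℝ, b.repr (α • u + β • v + γ • X) 2 = γ := by
    intro α β γ; rw [hub, hvb, ← bX]; simp
  have gvu : g v u = 0 := by rw [gs, guv]
  have gXu : g X u = 0 := by rw [gs, guX]
  have gXv : g X v = 0 := by rw [gs, gvX]
  obtain ⟨m, n, c, huv⟩ := hrep ⁅u, v⁆
  obtain ⟨a1, α, a3, huX⟩ := hrep ⁅u, X⁆
  obtain ⟨b1, b2, b3, hvX⟩ := hrep ⁅v, X⁆
  have hvu : ⁅v, u⁆ = -⁅u, v⁆ := (lie_skew v u).symm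
  have hXu : ⁅X, u⁆ = -⁅u, X⁆ := (lie_skew X u).symm
  have hXv : ⁅X, v⁆ = -⁅v, X⁆ := (lie_skew X v).symm
  have tyy : ∀ x y z, trilinear H y x z = - trilinear H x y z := alternating_three_swap_left H
  have tzz : ∀ x y z, trilinear H x z y = - trilinear H x y z := alternating_three_swap_right H
  have t1 : ∀ x z, trilinear H x x z = 0 := fun x z => by linarith [tyy x x z]
  have t2 : ∀ x z, trilinear H x z z = 0 := fun x z => by linarith [tzz x z z]
  -- the Killing equation for `X`
  have B1 := hB u u guX
  have B2 := hB v v gvX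
  have B3 := hB X u guX
  have B4 := hB X v gvX
  have B5 := hB u v gvX
  have B6 := hB v u guX
  simp only [lie_self, hXu, hXv, hvu, t1, t2, huv, huX, hvX, map_add, map_neg, map_smul,
    smul_eq_mul, guu, gvv, guv, gvu, guX, gvX, gXu, gXv, hX, map_zero] at B1 B2 B3 B4 B5 B6
  have ha1 : a1 = 0 := by
    have : a1 * e = 0 := by linarith
    exact (mul_eq_zero.1 this).resolve_right he0
  have hb2 : b2 = 0 := by
    have : b2 * e = 0 := by linarith
    exact (mul_eq_zero.1 this).resolve_right he0
  have ha3 : a3 = 0 := by linarith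
  have hb3 : b3 = 0 := by linarith
  have tuv : trilinear H v u X = - trilinear H u v X := tyy u v X
  have hb1 : b1 = -α := by
    have : (b1 + α) * e = 0 := by linarith
    linarith [(mul_eq_zero.1 this).resolve_right he0]
  -- The part of `hB` symmetric in `u, v` gave `b1 = -α`; the antisymmetric part ties `H` to the
  -- `X`-component of `[u, v]`.
  have huvX : trilinear H u v X = -c := by rw [hb1] at B5 B6; linarith
  rw [ha1, ha3, zero_smul, zero_smul, zero_add, add_zero] at huX
  rw [hb1, hb2, hb3, zero_smul, zero_smul, add_zero, add_zero] at hvX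
  -- unimodularity
  have hm : m = 0 := by
    have e1 : ⁅v, u⁆ = (-m) • u + (-n) • v + (-c) • X := by rw [hvu, huv]; module
    have e2 : ⁅v, b 2⁆ = (-α) • u + (0 : ℝ) • v + (0 : ℝ) • X := by rw [bX, hvX]; module
    rw [e1, e2, lie_self, r0, r2, map_zero, Finsupp.zero_apply] at hτ
    linarith
  rw [hm, zero_smul, zero_add] at huv
  -- `n` is the trace of `ad u`, while `ad v` and `ad X` are traceless.
  have hn : n ≠ 0 := by
    intro hn
    obtain ⟨x, hx⟩ := hu
    refine hx ?_
    have tu : LinearMap.trace ℝ V (LieAlgebra.ad ℝ V u) = 0 := by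
      have e1 : ⁅u, v⁆ = (0 : ℝ) • u + n • v + c • X := by rw [huv]; module
      have e2 : ⁅u, b 2⁆ = (0 : ℝ) • u + α • v + (0 : ℝ) • X := by rw [bX, huX]; module
      rw [trace_ad_eq b, ← hub, ← hvb, e1, e2, r1, r2, lie_self]
      simp [hn]
    have tX : LinearMap.trace ℝ V (LieAlgebra.ad ℝ V X) = 0 := by
      have e1 : ⁅X, u⁆ = (0 : ℝ) • u + (-α) • v + (0 : ℝ) • X := by rw [hXu, huX]; module
      have e2 : ⁅X, v⁆ = α • u + (0 : ℝ) • v + (0 : ℝ) • X := by rw [hXv, hvX]; module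
      rw [trace_ad_eq b, ← hub, ← hvb, bX, e1, e2, r1, r0, lie_self, map_zero,
        Finsupp.zero_apply]
      norm_num
    have tv : LinearMap.trace ℝ V (LieAlgebra.ad ℝ V v) = 0 := by
      rw [trace_ad_eq b, ← hub, ← hvb, hτ]
    obtain ⟨x1, x2, x3, rfl⟩ := hrep x
    rw [← hτ', map_add, map_add, map_smul, map_smul, map_smul, hτ', hτ', hτ', tu, tv, tX]
    simp
  have hu0 : u ≠ 0 := fun h => he0 (by rw [← guu, h, map_zero])
  -- The Jacobi identity for `u, v, X` reduces to `n α u = 0`; from here on `X` is central.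
  have hα : α = 0 := by
    have := leibniz_lie u v X
    rw [huX, hvX, huv] at this
    simp only [lie_smul, lie_self, smul_zero, add_lie, smul_lie, hvX, add_zero, smul_smul] at this
    have h2 := (smul_eq_zero.1 this.symm).resolve_right hu0
    simpa [hn] using h2
  rw [hα, zero_smul] at huX
  rw [hα, neg_zero, zero_smul] at hvX
  have hXu' : ⁅X, u⁆ = 0 := by rw [hXu, huX, neg_zero]
  have hXv' : ⁅X, v⁆ = 0 := by rw [hXv, hvX, neg_zero]
  -- the components of `Z`
  obtain ⟨z1, z2, z3, hZZ⟩ := hrep Z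
  have hFuX := hF u guX
  have hFvX := hF v gvX
  have fs : ∀ x y, bilinear F y x = - bilinear F x y := alternating_two_swap F
  have f0 : ∀ x, bilinear F x x = 0 := fun x => by linarith [fs x x]
  have hFXu : bilinear F X u = 0 := by rw [fs, hFuX, neg_zero]
  have hFXv : bilinear F X v = 0 := by rw [fs, hFvX, neg_zero]
  have hFvu : bilinear F v u = - bilinear F u v := fs u v
  have tvXu : trilinear H v X u = -c := by rw [tzz, tuv, huvX]; ring
  have tuXv : trilinear H u X v = c := by rw [tzz, huvX]; ring
  have t3 : ∀ x z, trilinear H x z x = 0 := fun x z => by rw [tzz, t1, neg_zero]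
  obtain ⟨k11, k12, k13, hKu⟩ := hrep (K u)
  obtain ⟨k21, k22, k23, hKv⟩ := hrep (K v)
  -- Skew-symmetry of `K`, with `u` and `v` of equal square, makes its block on their span a
  -- multiple of the rotation.
  have k11_0 : k11 = 0 := by
    have := Ks u u
    rw [hKu] at this
    simp only [map_add, map_smul, LinearMap.add_apply, LinearMap.smul_apply, smul_eq_mul, guu, gvu,
      gXu, guv, guX] at this
    have h2 : k11 * e = 0 := by linarith
    exact (mul_eq_zero.1 h2).resolve_right he0
  have k22_0 : k22 = 0 := by
    have := Ks v v
    rw [hKv] at this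
    simp only [map_add, map_smul, LinearMap.add_apply, LinearMap.smul_apply, smul_eq_mul, gvv, gvu,
      gXv, guv, gvX] at this
    have h2 : k22 * e = 0 := by linarith
    exact (mul_eq_zero.1 h2).resolve_right he0
  have k12_21 : k12 = - k21 := by
    have := Ks u v
    rw [hKu, hKv] at this
    simp only [map_add, map_smul, LinearMap.add_apply, LinearMap.smul_apply, smul_eq_mul, gvv, guu,
      gXv, guv, guX] at this
    have h2 : (k12 + k21) * e = 0 := by linarith
    linarith [(mul_eq_zero.1 h2).resolve_right he0]
  -- The mixed pairs give `c z3 = 0` and then `z2 = 0`; the diagonal pairs give `F(u, v) k12 = 0`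
  -- and then `z1 = 0`. So `Z` is proportional to `X`.
  have A1 := hA u u
  have A2 := hA u v
  have A4 := hA v u
  have A5 := hA v v
  rw [hZZ, hKu] at A1 A4
  rw [hZZ, hKv] at A2 A5
  simp only [map_add, map_neg, map_smul, LinearMap.add_apply, LinearMap.smul_apply, smul_eq_mul,
    add_lie, smul_lie, lie_self, hvu, hXu', hXv', huv, smul_zero, map_zero, gvv, guv,
    guX, gvX, gXv, hX, f0, hFXu, hFXv, hFvu, t1, t2, t3, tvXu, tuXv] at A1 A2 A4 A5
  have c3 : c * z3 = 0 := by rw [k22_0] at A2; linarith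
  have hz2 : z2 = 0 := by
    rw [k11_0] at A4
    have : z2 * (n * e) = 0 := by linarith
    exact (mul_eq_zero.1 this).resolve_right (mul_ne_zero hn he0)
  have φk : bilinear F u v * k12 = 0 := by linarith
  have hz1 : z1 = 0 := by
    have h1 : bilinear F u v * k21 = 0 := by rw [k12_21] at φk; linarith
    have : z1 * (n * e) = 0 := by linarith
    exact (mul_eq_zero.1 this).resolve_right (mul_ne_zero hn he0)
  rw [hz1, hz2, zero_smul, zero_smul, zero_add, zero_add] at hZZ
  have hz3 : z3 * z3 = 1 := by
    rw [hZZ] at hZ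
    simpa [hX] using hZ
  have hz30 : z3 ≠ 0 := fun h => by rw [h] at hz3; norm_num at hz3
  have hc : c = 0 := (mul_eq_zero.1 c3).resolve_right hz30
  -- If `k12` vanished then `K u = 0`, contradicting `K² u = -u` for `u ⊥ Z`.
  have hφ : bilinear F u v = 0 := by
    refine (mul_eq_zero.1 φk).resolve_right fun hk => ?_
    have hKX : K X = 0 := by
      rw [hZZ, map_smul] at KZ
      exact (smul_eq_zero.1 KZ).resolve_left hz30
    have hk13 : k13 = 0 := by
      have := Ks u X
      rw [hKX, map_zero, hKu] at this
      simpa [guX, gvX, hX] using this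
    have h2 := K2 u (by rw [hZZ, map_smul, guX, smul_zero])
    rw [hKu, k11_0, hk, hk13] at h2
    simp only [zero_smul, add_zero, map_zero] at h2
    exact hu0 (neg_eq_zero.1 h2.symm)
  rw [hc, zero_smul, add_zero] at huv
  have hF0 : bilinear F = 0 := by
    refine b.ext fun i => b.ext fun j => ?_
    fin_cases i <;> fin_cases j <;>
      simp [← hub, ← hvb, bX, f0, hφ, hFuX, hFvX, hFXu, hFXv, hFvu]
  refine ⟨?_, ?_, ?_, ?_⟩
  · rw [H.eq_smul_basis_det b]
    have : (⇑b : Fin 3 → V) = ![u, v, X] := by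
      ext i; fin_cases i
      exacts [rfl, rfl, bX]
    rw [this, ← trilinear_apply, huvX, hc, neg_zero, zero_smul]
  · ext x
    have : x = ![x 0, x 1] := by ext i; fin_cases i <;> rfl
    rw [this, ← bilinear_apply, hF0]; rfl
  · have : (z3 - 1) * (z3 + 1) = 0 := by linarith
    rcases mul_eq_zero.1 this with h | h
    · left; rw [hZZ, sub_eq_zero.1 h, one_smul]
    · right; rw [hZZ, eq_neg_of_add_eq_zero_left h, neg_smul, one_smul]
  · have hunit : ∀ i, IsUnit ((![n⁻¹, 1, 1] : Fin 3 → ℝ) i) := by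
      intro i; fin_cases i <;> simp [hn]
    have w0 : b.isUnitSMul hunit 0 = n⁻¹ • u := b.isUnitSMul_apply hunit 0
    have w1 : b.isUnitSMul hunit 1 = v := (b.isUnitSMul_apply hunit 1).trans (one_smul _ _)
    have w2 : b.isUnitSMul hunit 2 = X := ((b.isUnitSMul_apply hunit 2).trans (one_smul _ _)).trans bX
    -- Dividing `u` by `n` normalizes `[u, v] = n v`, and turns `g(u, u) = e` into `e / n²`; hence
    -- `δ = n`.
    refine ⟨b.isUnitSMul hunit, n, e, e, hn, he, he, w2, ⟨?_, ?_, ?_⟩, ?_, ?_, ?_, ?_⟩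
    · rw [w0, w1, smul_lie, huv, smul_smul, inv_mul_cancel₀ hn, one_smul]
    · rw [w0, w2, smul_lie, huX, smul_zero]
    · rw [w1, w2, hvX]
    · rw [w0]
      simp only [map_smul, LinearMap.smul_apply, guu, smul_eq_mul]
      field_simp
    · rw [w1, gvv]
    · rw [w2, hX]
    · intro i j hij
      fin_cases i <;> fin_cases j <;> first | exact absurd rfl hij | skip
      all_goals
        simp [w0, w1, w2, guv, gvu, guX, gvX, gXu, gXv]

end Classification

/-! ### Algebraic integrability of the standard model in coordinates. -/

section StandardModel

variable {V : Type*} [LieRing V] [LieAlgebra ℝ V]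

/-- The sum of `d - g(d)` and `s + g(s) + t`, in terms of the coordinates of `d` and `s`. -/
def stdElement (w : Module.Basis (Fin 3) ℝ V) (g : V →ₗ[ℝ] V →ₗ[ℝ] ℝ) (d₀ d₁ d₂ s₀ s₁ s₂ t : ℝ) :
    V × Module.Dual ℝ V × ℝ :=
  (d₀ • w 0 + d₁ • w 1 + d₂ • w 2, -g (d₀ • w 0 + d₁ • w 1 + d₂ • w 2), 0) +
    (s₀ • w 0 + s₁ • w 1 + s₂ • w 2, g (s₀ • w 0 + s₁ • w 1 + s₂ • w 2), t)

variable (w : Module.Basis (Fin 3) ℝ V) (g : V →ₗ[ℝ] V →ₗ[ℝ] ℝ)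

theorem stdElement_add (d₀ d₁ d₂ s₀ s₁ s₂ t d₀' d₁' d₂' s₀' s₁' s₂' t' : ℝ) :
    stdElement w g d₀ d₁ d₂ s₀ s₁ s₂ t + stdElement w g d₀' d₁' d₂' s₀' s₁' s₂' t' =
      stdElement w g (d₀ + d₀') (d₁ + d₁') (d₂ + d₂') (s₀ + s₀') (s₁ + s₁') (s₂ + s₂') (t + t') := by
  refine Prod.ext ?_ (Prod.ext ?_ ?_)
  · simp only [stdElement, Prod.fst_add]; module
  · simp only [stdElement, Prod.fst_add, Prod.snd_add, map_add, map_smul]; module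
  · simp only [stdElement, Prod.snd_add]; ring

theorem stdElement_neg (d₀ d₁ d₂ s₀ s₁ s₂ t : ℝ) :
    -stdElement w g d₀ d₁ d₂ s₀ s₁ s₂ t =
      stdElement w g (-d₀) (-d₁) (-d₂) (-s₀) (-s₁) (-s₂) (-t) := by
  refine Prod.ext ?_ (Prod.ext ?_ ?_)
  · simp only [stdElement, Prod.fst_add, Prod.fst_neg]; module
  · simp only [stdElement, Prod.fst_add, Prod.snd_add, Prod.fst_neg, Prod.snd_neg, map_add,
      map_smul]
    module
  · simp only [stdElement, Prod.snd_add, Prod.snd_neg]; ring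

theorem stdElement_sub (d₀ d₁ d₂ s₀ s₁ s₂ t d₀' d₁' d₂' s₀' s₁' s₂' t' : ℝ) :
    stdElement w g d₀ d₁ d₂ s₀ s₁ s₂ t - stdElement w g d₀' d₁' d₂' s₀' s₁' s₂' t' =
      stdElement w g (d₀ - d₀') (d₁ - d₁') (d₂ - d₂') (s₀ - s₀') (s₁ - s₁') (s₂ - s₂') (t - t') := by
  rw [sub_eq_add_neg, stdElement_neg, stdElement_add]
  simp only [← sub_eq_add_neg]

variable {w g} {k l ε : ℝ}

theorem exists_eq_stdElement (hε : ε * ε = 1) (hkl : k * l = -1) (g00 : g (w 0) (w 0) = ε * k ^ 2)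
    (g11 : g (w 1) (w 1) = ε) (g22 : g (w 2) (w 2) = 1)
    (gij : ∀ i j : Fin 3, i ≠ j → g (w i) (w j) = 0) (u : V × Module.Dual ℝ V × ℝ) :
    ∃ d₀ d₁ d₂ s₀ s₁ s₂ t, u = stdElement w g d₀ d₁ d₂ s₀ s₁ s₂ t := by
  obtain ⟨x, ξ, t⟩ := u
  -- These are the coordinates of `(x ∓ g⁻¹ξ) / 2`; the inverse of `g(w₀, w₀) = ε k²` is `ε l²`
  -- because `k l = -1`.
  refine ⟨(w.repr x 0 - ε * l ^ 2 * ξ (w 0)) / 2, (w.repr x 1 - ε * ξ (w 1)) / 2,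
    (w.repr x 2 - ξ (w 2)) / 2, (w.repr x 0 + ε * l ^ 2 * ξ (w 0)) / 2,
    (w.repr x 1 + ε * ξ (w 1)) / 2, (w.repr x 2 + ξ (w 2)) / 2, t, ?_⟩
  refine Prod.ext ?_ (Prod.ext ?_ ?_)
  · simp only [stdElement, Prod.fst_add]
    conv_lhs => rw [← w.sum_repr x, Fin.sum_univ_three]
    module
  · refine w.ext fun i => ?_
    have hk : ε * k ^ 2 * (ε * l ^ 2) = 1 := by
      linear_combination (k * l) ^ 2 * hε + (k * l - 1) * hkl
    fin_cases i
    · simp [stdElement, g00, gij]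
      linear_combination (-ξ (w 0)) * hk
    · simp [stdElement, g11, gij]
      linear_combination (-ξ (w 1)) * hε
    · simp [stdElement, g22, gij]
      ring
  · simp [stdElement]

theorem algDorfman_stdElement (hkl : k * l = -1)
    (hw : ⁅w 0, w 1⁆ = w 1 ∧ ⁅w 0, w 2⁆ = 0 ∧ ⁅w 1, w 2⁆ = 0) (g00 : g (w 0) (w 0) = ε * k ^ 2)
    (g11 : g (w 1) (w 1) = ε)
    (gij : ∀ i j : Fin 3, i ≠ j → g (w i) (w j) = 0)
    (d₀ d₁ d₂ s₀ s₁ s₂ t d₀' d₁' d₂' s₀' s₁' s₂' t' : ℝ) :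
    algDorfman 0 0 (stdElement w g d₀ d₁ d₂ s₀ s₁ s₂ t)
        (stdElement w g d₀' d₁' d₂' s₀' s₁' s₂' t') =
      stdElement w g (-(l ^ 2 * (s₁' * d₁ - s₁ * d₁')))
        (s₀ * s₁' + d₀ * s₁' - s₁ * s₀' - s₁ * d₀') 0
        (l ^ 2 * (s₁' * d₁ - s₁ * d₁'))
        (s₀ * d₁' + d₀ * d₁' - d₁ * s₀' - d₁ * d₀') 0 0 := by
  obtain ⟨h01, h02, h12⟩ := hw
  have h10 : ⁅w 1, w 0⁆ = -w 1 := by rw [← lie_skew, h01]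
  have h20 : ⁅w 2, w 0⁆ = 0 := by rw [← lie_skew, h02, neg_zero]
  have h21 : ⁅w 2, w 1⁆ = 0 := by rw [← lie_skew, h12, neg_zero]
  have hk : k ^ 2 * l ^ 2 = 1 := by linear_combination (k * l - 1) * hkl
  refine Prod.ext ?_ (Prod.ext ?_ ?_)
  · simp only [algDorfman, stdElement, Prod.fst_add, add_lie, lie_add, smul_lie, lie_smul, lie_self,
      h01, h02, h12, h10, h20, h21, smul_zero]
    module
  · refine w.ext fun i => ?_
    fin_cases i
    · simp [algDorfman, stdElement, h01, h02, h12, h10, h20, h21, g00, g11, gij]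
      linear_combination (-2 * ε * (s₁' * d₁ - s₁ * d₁')) * hk
    · simp [algDorfman, stdElement, h01, h02, h12, h10, h20, h21, g11, gij]
      ring
    · simp [algDorfman, stdElement, h01, h02, h12, h10, h20, h21, gij]
  · simp [algDorfman, stdElement]

/-- In the coordinates of `stdElement` both `A` and the bracket are explicit, so closure of `L`
becomes polynomial identities in the coordinates. The sign `σ` of `J₋` relative to `J₊` is left
free, so the result covers `𝓕` and `Γ𝓕`. -/
theorem algIntegrable_standard (hε : ε * ε = 1) (hkl : k * l = -1)
    (hw : ⁅w 0, w 1⁆ = w 1 ∧ ⁅w 0, w 2⁆ = 0 ∧ ⁅w 1, w 2⁆ = 0) (g00 : g (w 0) (w 0) = ε * k ^ 2)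
    (g11 : g (w 1) (w 1) = ε) (g22 : g (w 2) (w 2) = 1)
    (gij : ∀ i j : Fin 3, i ≠ j → g (w i) (w j) = 0)
    {A : V × Module.Dual ℝ V × ℝ →ₗ[ℝ] V × Module.Dual ℝ V × ℝ} {Jp Jm : V →ₗ[ℝ] V} {Z : V}
    {σ s : ℝ} (hσ : σ = 1 ∨ σ = -1)
    (Jp0 : Jp (w 0) = k • w 1) (Jp1 : Jp (w 1) = l • w 0) (Jp2 : Jp (w 2) = 0)
    (Jm0 : Jm (w 0) = (σ * k) • w 1) (Jm1 : Jm (w 1) = (σ * l) • w 0) (Jm2 : Jm (w 2) = 0)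
    (hZ : Z = s • w 2) (Am : ∀ x, A (x, -g x, 0) = (Jm x, -g (Jm x), 0))
    (Ap : ∀ x a, A (x, g x, a) = (Jp x + a • Z, g (Jp x + a • Z), -g Z x)) :
    AlgIntegrable 0 0 A := by
  have hA : ∀ d₀ d₁ d₂ s₀ s₁ s₂ t, A (stdElement w g d₀ d₁ d₂ s₀ s₁ s₂ t) =
      stdElement w g (σ * l * d₁) (σ * k * d₀) 0 (l * s₁) (k * s₀) (s * t) (-(s * s₂)) := by
    intro d₀ d₁ d₂ s₀ s₁ s₂ t
    have e1 : Jm (d₀ • w 0 + d₁ • w 1 + d₂ • w 2) =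
        (σ * l * d₁) • w 0 + (σ * k * d₀) • w 1 + (0 : ℝ) • w 2 := by
      simp only [map_add, map_smul, Jm0, Jm1, Jm2]; module
    have e2 : Jp (s₀ • w 0 + s₁ • w 1 + s₂ • w 2) + t • Z =
        (l * s₁) • w 0 + (k * s₀) • w 1 + (s * t) • w 2 := by
      simp only [map_add, map_smul, Jp0, Jp1, Jp2, hZ]; module
    have e3 : g Z (s₀ • w 0 + s₁ • w 1 + s₂ • w 2) = s * s₂ := by
      rw [hZ]; simp [g22, gij]
    rw [stdElement, map_add, Am, Ap, e1, e2, e3]; rfl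
  have hnorm : ∀ a b, A a = -b → A b = a → ∃ d₀ d₁ s₀ s₁ s₂ t,
      a = stdElement w g d₀ d₁ 0 s₀ s₁ s₂ t ∧
      b = stdElement w g (-(σ * l * d₁)) (-(σ * k * d₀)) 0 (-(l * s₁)) (-(k * s₀)) (-(s * t))
        (s * s₂) := by
    intro a b hab hba
    obtain ⟨d₀, d₁, d₂, s₀, s₁, s₂, t, rfl⟩ := exists_eq_stdElement hε hkl g00 g11 g22 gij a
    have hb : b = stdElement w g (-(σ * l * d₁)) (-(σ * k * d₀)) 0 (-(l * s₁)) (-(k * s₀))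
        (-(s * t)) (s * s₂) := by
      rw [← neg_eq_iff_eq_neg.2 hab, hA, stdElement_neg]; simp
    -- `a = A b` lies in the image of `A`, which has no `E₋`-component along `w₂`.
    have hd : d₂ = 0 := by
      rw [hb, hA] at hba
      have h1 := congrArg (fun z => w.repr z.1 2) hba
      have h2 := congrArg (fun z => z.2.1 (w 2)) hba
      simp [stdElement] at h1
      simp [stdElement, g22, gij] at h2
      linarith
    rw [hd] at *
    exact ⟨d₀, d₁, s₀, s₁, s₂, t, rfl, hb⟩
  have hl : l ≠ 0 := fun h => by rw [h] at hkl; norm_num at hkl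
  -- Eliminating `k` encodes `k l = -1`, so that the remaining identities hold by ring arithmetic
  -- after clearing denominators.
  have hk : k = -l⁻¹ := by field_simp; linarith
  intro a b c d hab hba hcd hdc
  obtain ⟨d₀, d₁, s₀, s₁, s₂, t, rfl, rfl⟩ := hnorm a b hab hba
  obtain ⟨d₀', d₁', s₀', s₁', s₂', t', rfl, rfl⟩ := hnorm c d hcd hdc
  simp only [algDorfman_stdElement hkl hw g00 g11 gij, stdElement_add, stdElement_sub,
    stdElement_neg, hA]
  rw [hk]
  rcases hσ with rfl | rfl
  · constructor <;> congr 1 <;> field_simp <;> ring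
  · constructor <;> congr 1 <;> field_simp <;> ring

end StandardModel

/-! ### Complex structures adapted to the standard metric. -/

section AdaptedForm

variable {V : Type*} [AddCommGroup V] [Module ℝ V]

/-- A complex structure on the orthogonal complement of `w₂`, in an orthogonal basis. -/
theorem adapted_standard_form {w : Module.Basis (Fin 3) ℝ V} {g : V →ₗ[ℝ] V →ₗ[ℝ] ℝ}
    {δ ε ε' : ℝ} (hδ : δ ≠ 0) (hε : ε = 1 ∨ ε = -1) (hε' : ε' = 1 ∨ ε' = -1)
    (g00 : g (w 0) (w 0) = ε / δ ^ 2) (g11 : g (w 1) (w 1) = ε') (g22 : g (w 2) (w 2) = 1)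
    (gij : ∀ i j : Fin 3, i ≠ j → g (w i) (w j) = 0) {J : V →ₗ[ℝ] V}
    (Js : ∀ x y, g (J x) y = - g x (J y)) (Jw : J (w 2) = 0)
    (J2 : ∀ x, g x (w 2) = 0 → J (J x) = -x) :
    ε = ε' ∧ ∃ σ : ℝ, (σ = 1 ∨ σ = -1) ∧ J (w 0) = (σ * δ⁻¹) • w 1 ∧
      J (w 1) = (-(σ * δ)) • w 0 := by
  have hε0 : ε ≠ 0 := by rcases hε with h | h <;> rw [h] <;> norm_num
  have hε0' : ε' ≠ 0 := by rcases hε' with h | h <;> rw [h] <;> norm_num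
  have hrep : ∀ x, ∃ a b c : ℝ, x = a • w 0 + b • w 1 + c • w 2 := fun x =>
    ⟨w.repr x 0, w.repr x 1, w.repr x 2, by
      conv_lhs => rw [← w.sum_repr x, Fin.sum_univ_three]⟩
  obtain ⟨a, b, c, h0⟩ := hrep (J (w 0))
  obtain ⟨p, q, r, h1⟩ := hrep (J (w 1))
  have ha : a = 0 := by
    have := Js (w 0) (w 0)
    rw [h0] at this
    simp [g00, gij] at this
    have h2 : a * (ε / δ ^ 2) = 0 := by linarith
    exact (mul_eq_zero.1 h2).resolve_right (div_ne_zero hε0 (pow_ne_zero 2 hδ))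
  have hc : c = 0 := by
    have := Js (w 0) (w 2)
    rw [h0, Jw] at this
    simpa [g22, gij] using this
  have hq : q = 0 := by
    have := Js (w 1) (w 1)
    rw [h1] at this
    simp [g11, gij] at this
    have h2 : q * ε' = 0 := by linarith
    exact (mul_eq_zero.1 h2).resolve_right hε0'
  have hr : r = 0 := by
    have := Js (w 1) (w 2)
    rw [h1, Jw] at this
    simpa [g22, gij] using this
  have hbp : b * ε' = - (p * (ε / δ ^ 2)) := by
    have := Js (w 0) (w 1)
    rw [h0, h1] at this
    simpa [g00, g11, gij] using this
  rw [ha, hc, zero_smul, zero_smul, zero_add, add_zero] at h0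
  rw [hq, hr, zero_smul, zero_smul, add_zero, add_zero] at h1
  have hbp1 : b * p = -1 := by
    have := J2 (w 0) (gij 0 2 (by decide))
    rw [h0, map_smul, h1, smul_smul] at this
    have h2 := congrArg (fun x => w.repr x 0) this
    simpa using h2
  -- Skew-symmetry together with `b p = -1`. The positive factor forces the signs `ε` and `ε'` to
  -- agree, and then `b δ = ±1` is the sign `σ`.
  have hb2 : (b * δ) ^ 2 * ε' = ε := by
    have h3 : b * (b * ε') * δ ^ 2 = -(b * p) * ε := by
      rw [hbp]; field_simp
    rw [hbp1] at h3
    linear_combination h3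
  have hb0 : b ≠ 0 := fun h => by rw [h] at hbp1; norm_num at hbp1
  have hpos : 0 < (b * δ) ^ 2 := by positivity
  have hee : ε = ε' := by
    rcases hε with h | h <;> rcases hε' with h' | h' <;> rw [h, h'] at hb2 ⊢ <;> linarith
  have hsq : (b * δ) ^ 2 = 1 := by
    rw [hee] at hb2
    exact (mul_eq_right₀ hε0').1 hb2
  refine ⟨hee, b * δ, mul_self_eq_one_iff.1 (by rw [← sq, hsq]), ?_, ?_⟩
  · rw [h0, mul_assoc, mul_inv_cancel₀ hδ, mul_one]
  · rw [h1]
    congr 1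
    refine mul_left_cancel₀ hb0 ?_
    linear_combination hbp1 + hsq

end AdaptedForm

/-! ### Every structure has the standard form. -/

section Forward

variable {G : Type*} [TopologicalSpace G] [ChartedSpace (EuclideanSpace ℝ (Fin 3)) G]
  [Group G]

theorem LeftInvVec.ext {X Y : VecField 3 G} (hX : LeftInvVec X) (hY : LeftInvVec Y)
    (h : X 1 = Y 1) : X = Y := by
  funext p
  rw [hX p, hY p, h]

theorem finrank_groupLieAlgebra : Module.finrank ℝ (GroupLieAlgebra (𝓡 3) G) = 3 :=
  finrank_euclideanSpace_fin

variable [LieGroup (𝓡 3) ∞ G]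

variable {H : DiffForm 3 G 3} {F : DiffForm 3 G 2} {Γ 𝓕 : EndE 3 G}
  {g : BilinField 3 G} {Jp Jm : EndField 3 G} {Xp Xm : VecField 3 G}

theorem LeftInvForm.eq_zero {k : ℕ} {α : DiffForm 3 G k} (h : LeftInvForm α) (h1 : α 1 = 0) :
    α = 0 := by
  funext p
  ext x
  have := h p (fun i => (leftEquiv 3 p).symm (x i))
  have e : (fun i => mulInvariantVectorField ((leftEquiv 3 p).symm (x i)) p) = x :=
    funext fun i => (leftEquiv 3 p).apply_symm_apply (x i)
  rw [e, h1] at this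
  exact this

theorem LeftInvVec.smul {X : VecField 3 G} (hX : LeftInvVec X) (c : ℝ) :
    LeftInvVec (c • X) := by
  intro p
  show c • X p = leftEquiv 3 p (c • X 1)
  rw [hX p]
  exact (map_smul (leftEquiv 3 p) c (X 1)).symm

theorem IsLeftInvGPK.description (h : IsLeftInvGPK H F Γ 𝓕 g Jp Jm Xp Xm)
    (hG : ¬ IsUnimodular 3 G) :
    H = 0 ∧ F = 0 ∧ IsAdaptedTo g Jp Xp ∧ IsAdaptedTo g Jm Xm ∧
      (∃ w : Module.Basis (Fin 3) ℝ (GroupLieAlgebra (𝓡 3) G), IsStandardBasis w ∧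
        (∃ δ ε ε' : ℝ, δ ≠ 0 ∧ (ε = 1 ∨ ε = -1) ∧ (ε' = 1 ∨ ε' = -1) ∧
          IsStandardMetric g w δ ε ε') ∧ Xm 1 = w 2) ∧ (Xp = Xm ∨ Xp = -Xm) := by
  have hg := h.components.isMetric h.kahler.metric
  have hm := h.components.adapted_minus h.kahler.metric h.kahler.complex₁.1
  have hp := h.components.adapted_plus h.kahler.metric h.kahler.complex₁.1
  have hu : ∃ x, LinearMap.trace ℝ (GroupLieAlgebra (𝓡 3) G)
      (LieAlgebra.ad ℝ (GroupLieAlgebra (𝓡 3) G) x) ≠ 0 := by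
    by_contra hcon
    push Not at hcon
    exact hG hcon
  obtain ⟨hH, hF, hZ, w, δ, ε, ε', hδ, hε, hε', hw2, hw, hwg⟩ :=
    classification (V := GroupLieAlgebra (𝓡 3) G) finrank_groupLieAlgebra hu (g 1) (hg.symm 1)
      (hg.nondeg 1) (Jm 1) (Xm 1) (h.components.Xm_unit 1) (hm 1).1 (hm 1).2.1 (hm 1).2.2
      (Jp 1) (Xp 1) (hp.2 1) (hp.1 1).1 (hp.1 1).2.1 (hp.1 1).2.2 (H 1) (F 1)
      -- For the generator of `ℝ` the first identity involves `F` only; in the next obligation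
      -- elements of `E₊` over `z` give the relation for `g` and `H`.
      (by
        intro y hy
        have := h.sp_plus_minus_Xm 0 y 1 hy
        rw [sp_algDorfman] at this
        simpa [ePlus, eMinus] using this)
      (by
        intro z y hy
        have := h.sp_plus_minus_Xm z y 0 hy
        rw [sp_algDorfman] at this
        simp only [ePlus, eMinus, LinearMap.neg_apply] at this
        linarith)
      (by
        intro x y
        have := h.sp_plus_plus_minus y x
        rw [sp_algDorfman, sp_algDorfman] at this
        simp only [ePlus, eMinus, LinearMap.neg_apply, Prod.fst_neg, Prod.snd_neg, map_zero,
          LinearMap.zero_apply, zero_lie, neg_lie, sub_lie, lie_sub, smul_lie, lie_smul, map_sub,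
          map_neg, map_smul, LinearMap.sub_apply, LinearMap.smul_apply, smul_eq_mul, lie_self] at this
        -- The multiple of `X₊` subtracted from `y` contributes nothing: its `g`-terms cancel, and
        -- this is its `H`-term.
        have t1 : trilinear (V := GroupLieAlgebra (𝓡 3) G) (H 1) (Xp 1) (Xp 1) x = 0 := by
          have := alternating_three_swap_left (V := GroupLieAlgebra (𝓡 3) G) (H 1) (Xp 1) (Xp 1) x
          rw [trilinear_apply]; linarith
        rw [t1] at this
        linarith)
  have hXX : Xp = Xm ∨ Xp = -Xm := by
    rcases hZ with hZ | hZ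
    · exact Or.inl (h.left_Xp.ext h.left_Xm hZ)
    · right
      have e : LeftInvVec (-Xm) := by
        have := h.left_Xm.smul (-1)
        rwa [neg_one_smul] at this
      exact h.left_Xp.ext e hZ
  exact ⟨h.left_H.eq_zero hH, h.left_F.eq_zero hF, hp.1, hm,
    ⟨w, hw, ⟨δ, ε, ε', hδ, hε, hε', hwg⟩, hw2.symm⟩, hXX⟩

end Forward

/-! ### The standard data define a structure. -/

section Converse

variable {G : Type*} [TopologicalSpace G] [ChartedSpace (EuclideanSpace ℝ (Fin 3)) G]

variable {Γ 𝓕 : EndE 3 G} {g : BilinField 3 G} {Jp Jm : EndField 3 G} {Xp Xm : VecField 3 G}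

theorem IsPairWithComponents.eq_neg_iff (h : IsPairWithComponents Γ 𝓕 g Jp Jm Xp)
    (hg : IsMetric g) (p : G) (u : Fibre 3 p) : Γ p u = -u ↔ ∃ x, u = eMinus g p x := by
  constructor
  · intro hu
    obtain ⟨x, y, a, rfl⟩ := exists_eq_eMinus_add_ePlus hg p u
    rw [map_add, h.minus, h.plus, neg_add, add_right_inj] at hu
    refine ⟨x, ?_⟩
    have h2 : (2 : ℝ) • ePlus g p y a = 0 := by rw [two_smul]; nth_rewrite 1 [hu]; abel
    rw [(smul_eq_zero.1 h2).resolve_left two_ne_zero, add_zero]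
  · rintro ⟨x, rfl⟩
    exact h.minus p x

variable [Group G] [LieGroup (𝓡 3) ∞ G]

theorem isTwist_zero : IsTwist (0 : DiffForm 3 G 3) (0 : DiffForm 3 G 2) where
  smooth_H _ _ := contMDiff_const (c := (0 : ℝ))
  smooth_F _ _ := contMDiff_const (c := (0 : ℝ))
  closed_F X Y Z _ _ _ p := by
    simp only [dTwoForm, Pi.zero_apply, AlternatingMap.zero_apply, der_const]; norm_num
  d_H X Y Z W _ _ _ _ p := by
    simp only [dThreeForm, wedgeSq, Pi.zero_apply, AlternatingMap.zero_apply, der_const]; norm_num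

theorem IsPairWithComponents.leftInv (h : IsPairWithComponents Γ 𝓕 g Jp Jm Xp) (hg : IsMetric g)
    (lg : LeftInvBilin g) : LeftInvEndE Γ := by
  intro p w
  obtain ⟨x, y, a, rfl⟩ := exists_eq_eMinus_add_ePlus hg 1 w
  rw [map_add, map_add, transport_eMinus lg, transport_ePlus lg, h.minus, h.plus, map_add,
    h.minus, h.plus, map_add, map_neg, transport_eMinus lg, transport_ePlus lg]

theorem IsPairWithComponents.isGenMetric (h : IsPairWithComponents Γ 𝓕 g Jp Jm Xp)
    (hg : IsMetric g) (lg : LeftInvBilin g) : IsGenMetric Γ where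
  smooth := (h.leftInv hg lg).smoothEnd
  invol p u := by
    obtain ⟨x, y, a, rfl⟩ := exists_eq_eMinus_add_ePlus hg p u
    simp only [map_add, map_neg, h.minus, h.plus, neg_neg]
  orth p u v := by
    obtain ⟨x, y, a, rfl⟩ := exists_eq_eMinus_add_ePlus hg p u
    obtain ⟨x', y', a', rfl⟩ := exists_eq_eMinus_add_ePlus hg p v
    rw [map_add, map_add, h.minus, h.plus, h.minus, h.plus]
    have h1 := sp_ePlus_eMinus hg p y x' a
    have h2 := sp_ePlus_eMinus hg p y' x a'
    simp only [sp, eMinus, ePlus, Prod.fst_add, Prod.snd_add, Prod.fst_neg, Prod.snd_neg, map_add,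
      map_neg, LinearMap.add_apply, LinearMap.neg_apply] at h1 h2 ⊢
    linarith
  admissible p x := by
    refine ⟨eMinus g p x, ⟨h.minus p x, rfl⟩, ?_⟩
    rintro u ⟨hu, hux⟩
    obtain ⟨y, rfl⟩ := (h.eq_neg_iff hg p u).1 hu
    rw [show y = x from hux]

theorem HasComponents.isGenAlmostComplex {A : EndE 3 G} (hA : HasComponents A g Jp Jm Xp)
    (hg : IsMetric g) (lg : LeftInvBilin g) (lp : LeftInvEnd Jp) (lm : LeftInvEnd Jm)
    (lX : LeftInvVec Xp) (lXm : LeftInvVec Xm) (hp : IsAdaptedTo g Jp Xp)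
    (hm : IsAdaptedTo g Jm Xm) (hXp : ∀ p, g p (Xp p) (Xp p) = 1)
    (hXm : ∀ p, g p (Xm p) (Xm p) = 1) : IsGenAlmostComplex A where
  smooth := (hA.leftInv hg lg lp lm lX).smoothEnd
  skew := hA.skew hg hp hm
  square := by
    refine ⟨fun p => eMinus g p (Xm p), ?_, fun p => ⟨?_, ?_, fun u => ?_⟩⟩
    · have : (fun p => eMinus g p (Xm p)) = fun p => transport p (eMinus g 1 (Xm 1)) := by
        funext p
        rw [transport_eMinus lg, leftEquiv_apply, ← lXm p]
      rw [this]
      exact smoothSec_transport _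
    · rw [sp_eMinus_eMinus hg, hXm]; norm_num
    · rw [hA.minus, (hm p).2.1]
      simp only [eMinus, map_zero, neg_zero]; rfl
    · rw [hA.sq hg hp hm hXp hXm]
      have e : (-1 : ℝ) ^ 3 * sp u (eMinus g p (Xm p)) = -(sp u (eMinus g p (Xm p))) := by ring
      rw [e, sub_eq_add_neg]
      exact congrArg (-u + ·) (neg_smul _ _).symm

/-- Since `X₊ = ±X₋`, both `J₊` and `J₋` are adapted to the line of `w₂`, so each is one of the two
rotations of `adapted_standard_form`. -/
theorem HasComponents.algIntegrable {A : EndE 3 G} (hA : HasComponents A g Jp Jm Xp)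
    (hp : IsAdaptedTo g Jp Xp) (hm : IsAdaptedTo g Jm Xm)
    {w : Module.Basis (Fin 3) ℝ (GroupLieAlgebra (𝓡 3) G)} (hw : IsStandardBasis w)
    {δ ε ε' : ℝ} (hδ : δ ≠ 0) (hε : ε = 1 ∨ ε = -1) (hε' : ε' = 1 ∨ ε' = -1)
    (hwg : IsStandardMetric g w δ ε ε') (hXw : Xm 1 = w 2) (hX : Xp = Xm ∨ Xp = -Xm) :
    AlgIntegrable (V := GroupLieAlgebra (𝓡 3) G) 0 0 (A 1) := by
  obtain ⟨g00, g11, g22, gij⟩ := hwg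
  obtain ⟨s, hs0, hs⟩ : ∃ s : ℝ, s ≠ 0 ∧ Xp 1 = s • w 2 := by
    rcases hX with rfl | rfl
    · exact ⟨1, one_ne_zero, by rw [hXw, one_smul]⟩
    · refine ⟨-1, by norm_num, ?_⟩
      rw [neg_one_smul, ← hXw]; rfl
  obtain ⟨p1, p2, p3⟩ := hp 1
  obtain ⟨m1, m2, m3⟩ := hm 1
  rw [hXw] at m2 m3
  have p2' : Jp 1 (w 2) = 0 := by
    rw [hs] at p2
    exact (smul_eq_zero.1 ((map_smul (Jp 1) s (w 2)).symm.trans p2)).resolve_left hs0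
  have p3' : ∀ x, g 1 x (w 2) = 0 → Jp 1 (Jp 1 x) = -x := fun x hx => p3 x (by
    rw [hs]
    exact (map_smul (g 1 x) s (w 2)).trans (by rw [hx, smul_zero]))
  obtain ⟨hee, σ, hσ, e1, e2⟩ := adapted_standard_form (V := GroupLieAlgebra (𝓡 3) G) hδ hε hε'
    g00 g11 g22 gij p1 p2' p3'
  obtain ⟨-, τ, hτ, f1, f2⟩ := adapted_standard_form (V := GroupLieAlgebra (𝓡 3) G) hδ hε hε'
    g00 g11 g22 gij m1 m2 m3
  have hσ2 : σ * σ = 1 := mul_self_eq_one_iff.2 hσ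
  -- `k` and `l` are the entries of `J₊`, and `k² = δ⁻²` matches the metric. With `σ, τ` the signs
  -- of `J₊, J₋`, their relative sign is `τ σ`.
  refine algIntegrable_standard (w := w) (g := g 1) (k := σ * δ⁻¹) (l := -(σ * δ)) (ε := ε)
    (Jp := Jp 1) (Jm := Jm 1) (Z := Xp 1) (σ := τ * σ) (s := s) (mul_self_eq_one_iff.2 hε) ?_ hw ?_
    (by rw [hee]; exact g11) g22 gij ?_ e1 e2 p2' ?_ ?_ m2 hs (hA.minus 1) (hA.plus 1)
  · have : σ * δ⁻¹ * -(σ * δ) = -(σ * σ) * (δ⁻¹ * δ) := by ring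
    rw [this, hσ2, inv_mul_cancel₀ hδ, mul_one]
  · refine Eq.trans g00 ?_
    rw [mul_pow, pow_two σ, hσ2, one_mul, inv_pow, div_eq_mul_inv]
  · refine mul_self_eq_one_iff.1 ?_
    have : τ * τ = 1 := mul_self_eq_one_iff.2 hτ
    linear_combination (σ * σ) * this + hσ2
  · refine Eq.trans f1 ?_
    congr 1
    linear_combination (-(τ * δ⁻¹)) * hσ2
  · refine Eq.trans f2 ?_
    congr 1
    linear_combination (τ * δ) * hσ2

theorem isMetric_of_standard (lg : LeftInvBilin g)
    {w : Module.Basis (Fin 3) ℝ (GroupLieAlgebra (𝓡 3) G)}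
    {δ ε ε' : ℝ} (hδ : δ ≠ 0) (hε : ε = 1 ∨ ε = -1) (hε' : ε' = 1 ∨ ε' = -1)
    (hwg : IsStandardMetric g w δ ε ε') : IsMetric g := by
  obtain ⟨g00, g11, g22, gij⟩ := hwg
  have hε0 : ε ≠ 0 := by rcases hε with h | h <;> rw [h] <;> norm_num
  have hε0' : ε' ≠ 0 := by rcases hε' with h | h <;> rw [h] <;> norm_num
  let B : GroupLieAlgebra (𝓡 3) G →ₗ[ℝ] GroupLieAlgebra (𝓡 3) G →ₗ[ℝ] ℝ := g 1
  have hs : ∀ x y, B x y = B y x := by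
    have : B = B.flip := by
      refine w.ext fun i => w.ext fun j => ?_
      rw [LinearMap.flip_apply]
      by_cases hij : i = j
      · rw [hij]
      · rw [show B (w i) (w j) = 0 from gij i j hij,
          show B (w j) (w i) = 0 from gij j i (Ne.symm hij)]
    intro x y
    conv_lhs => rw [this]
    rfl
  have hn : ∀ x, B x = 0 → x = 0 := by
    intro x hx
    have hd : ∀ i, B (w i) (w i) ≠ 0 := by
      intro i; fin_cases i
      · exact g00.trans_ne (div_ne_zero hε0 (pow_ne_zero 2 hδ))
      · exact g11.trans_ne hε0'
      · exact g22.trans_ne one_ne_zero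
    refine w.ext_elem fun i => ?_
    have h1 : B x (w i) = w.repr x i * B (w i) (w i) := by
      conv_lhs => rw [← w.sum_repr x]
      rw [map_sum, LinearMap.sum_apply, Finset.sum_eq_single i]
      · rw [map_smul, LinearMap.smul_apply, smul_eq_mul]
      · intro j _ hj
        rw [map_smul, LinearMap.smul_apply, show B (w j) (w i) = 0 from gij j i hj, smul_zero]
      · simp
    rw [hx, LinearMap.zero_apply] at h1
    rw [map_zero, Finsupp.zero_apply]
    exact (mul_eq_zero.1 h1.symm).resolve_right (hd i)
  refine ⟨fun p x y => ?_, fun p x hx => ?_⟩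
  · obtain ⟨x, rfl⟩ := (leftEquiv 3 p).surjective x
    obtain ⟨y, rfl⟩ := (leftEquiv 3 p).surjective y
    rw [leftInvBilin_iff.1 lg, leftInvBilin_iff.1 lg]
    exact hs x y
  · obtain ⟨x, rfl⟩ := (leftEquiv 3 p).surjective x
    have : x = 0 := hn x (LinearMap.ext fun y => by
      have := leftInvBilin_iff.1 lg p x y
      rw [hx] at this
      exact this.symm)
    rw [this, map_zero]

/-- `ad w₀` has trace `1` and the other two are traceless, so `𝔤₀` is spanned by `w₁, w₂`, where `g`
is diagonal with entries `ε', 1`. -/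
theorem kernelNondegenerate_of_standard
    {w : Module.Basis (Fin 3) ℝ (GroupLieAlgebra (𝓡 3) G)} (hw : IsStandardBasis w)
    {δ ε ε' : ℝ} (hε' : ε' = 1 ∨ ε' = -1)
    (hwg : IsStandardMetric g w δ ε ε') : KernelNondegenerate g := by
  obtain ⟨g00, g11, g22, gij⟩ := hwg
  obtain ⟨h01, h02, h12⟩ := hw
  have hε0' : ε' ≠ 0 := by rcases hε' with h | h <;> rw [h] <;> norm_num
  have h10 : ⁅w 1, w 0⁆ = -w 1 := by rw [← lie_skew, h01]
  have h20 : ⁅w 2, w 0⁆ = 0 := by rw [← lie_skew, h02, neg_zero]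
  have h21 : ⁅w 2, w 1⁆ = 0 := by rw [← lie_skew, h12, neg_zero]
  have t0 : traceAd 3 G (w 0) = 1 := by
    refine (trace_ad_eq w (w 0)).trans ?_
    rw [h01, h02]; simp
  have t1 : traceAd 3 G (w 1) = 0 := by
    refine (trace_ad_eq w (w 1)).trans ?_
    rw [h10, h12]; simp
  have t2 : traceAd 3 G (w 2) = 0 := by
    refine (trace_ad_eq w (w 2)).trans ?_
    rw [h20, h21]; simp
  intro x hx hxy
  have hrep : x = w.repr x 0 • w 0 + w.repr x 1 • w 1 + w.repr x 2 • w 2 := by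
    conv_lhs => rw [← w.sum_repr x, Fin.sum_univ_three]
  have hx' : traceAd 3 G x = 0 := hx
  have x0 : w.repr x 0 = 0 := by
    rw [hrep] at hx'
    simpa [t0, t1, t2] using hx'
  rw [x0, zero_smul, zero_add] at hrep
  let B : GroupLieAlgebra (𝓡 3) G →ₗ[ℝ] GroupLieAlgebra (𝓡 3) G →ₗ[ℝ] ℝ := g 1
  have b11 : B (w 1) (w 1) = ε' := g11
  have b22 : B (w 2) (w 2) = 1 := g22
  have bij : ∀ i j : Fin 3, i ≠ j → B (w i) (w j) = 0 := gij
  have k1 : B x (w 1) = 0 := hxy (w 1) t1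
  have k2 : B x (w 2) = 0 := hxy (w 2) t2
  rw [hrep] at k1 k2
  have x1 : w.repr x 1 = 0 := by simpa [b11, bij, hε0'] using k1
  have x2 : w.repr x 2 = 0 := by simpa [b22, bij] using k2
  rw [hrep, x1, x2]; simp

theorem exists_isLeftInvGPK (lg : LeftInvBilin g) (lp : LeftInvEnd Jp) (lm : LeftInvEnd Jm)
    (lXp : LeftInvVec Xp) (lXm : LeftInvVec Xm) (hp : IsAdaptedTo g Jp Xp)
    (hm : IsAdaptedTo g Jm Xm)
    {w : Module.Basis (Fin 3) ℝ (GroupLieAlgebra (𝓡 3) G)} (hw : IsStandardBasis w)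
    {δ ε ε' : ℝ} (hδ : δ ≠ 0) (hε : ε = 1 ∨ ε = -1) (hε' : ε' = 1 ∨ ε' = -1)
    (hwg : IsStandardMetric g w δ ε ε') (hXw : Xm 1 = w 2) (hX : Xp = Xm ∨ Xp = -Xm) :
    ∃ Γ 𝓕 : EndE 3 G, IsLeftInvGPK 0 0 Γ 𝓕 g Jp Jm Xp Xm ∧ KernelNondegenerate g := by
  have hg := isMetric_of_standard lg hδ hε hε' hwg
  have hXm : ∀ p, g p (Xm p) (Xm p) = 1 := by
    intro p
    rw [lXm p, lg p, hXw]
    exact hwg.2.2.1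
  have hXp : ∀ p, g p (Xp p) (Xp p) = 1 := by
    intro p
    rcases hX with rfl | rfl
    · exact hXm p
    · simp [hXm]
  have hpair := isPairWithComponents_structureEnd hg Jp Jm Xp
  -- Stated for a variable `J₋` so as to be applied to `J₋` and to `-J₋`.
  have hcomplex : ∀ (A : EndE 3 G) (Jm' : EndField 3 G), HasComponents A g Jp Jm' Xp →
      IsAdaptedTo g Jm' Xm → LeftInvEnd Jm' → IsGenComplex 0 0 A := fun A Jm' hA hJ lJ =>
    ⟨hA.isGenAlmostComplex hg lg lp lJ lXp lXm hp hJ hXp hXm,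
      isIntegrable_zero_of_algIntegrable (hA.leftInv hg lg lp lJ lXp) (hA.skew hg hp hJ)
        (hA.algIntegrable hp hJ hw hδ hε hε' hwg hXw hX)⟩
  refine ⟨metricInvolution hg, structureEnd hg Jp Jm Xp, ?_,
    kernelNondegenerate_of_standard hw hε' hwg⟩
  refine ⟨isTwist_zero, fun _ _ => rfl, fun _ _ => rfl, ⟨hpair.isGenMetric hg lg, ?_,
    hcomplex _ _ hpair.comps hm lm, hcomplex _ _ hpair.comp hm.neg lm.neg⟩,
    ⟨fun p u => hpair.eq_neg_iff hg p u, ?_, hpair.comps.minus, hpair.comps.plus, ?_, ?_⟩,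
    lg, lp, lm, lXp, lXm⟩
  · intro p u
    obtain ⟨x, y, a, rfl⟩ := exists_eq_eMinus_add_ePlus hg p u
    simp only [map_add, map_neg, hpair.minus, hpair.plus, hpair.comps.minus, hpair.comps.plus]
  · intro p x y
    have := sp_eMinus_eMinus hg p x y
    rw [eMinus, eMinus] at this
    rw [this, neg_neg]
  · intro p
    refine (hpair.comps.minus p (Xm p)).trans ?_
    rw [(hm p).2.1]
    simp only [eMinus, map_zero, neg_zero]; rfl
  · intro p
    refine (sp_eMinus_eMinus hg p (Xm p) (Xm p)).trans ?_
    rw [hXm]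

end Converse

/-! ### The Lie algebra `ℝ ⊕ sol₂` in a standard basis. -/

section Model

/-- The coordinates on `ℝ ⊕ sol₂` in the basis `e₁, e₂` of `sol₂` and the generator of `ℝ`. -/
def lineSolCoord : (LieLine × LieSol2) ≃ₗ[ℝ] (Fin 3 → ℝ) where
  toFun x := ![x.2.1, x.2.2, x.1]
  invFun f := (f 2, (f 0, f 1))
  map_add' x y := by ext i; fin_cases i <;> rfl
  map_smul' t x := by ext i; fin_cases i <;> rfl
  left_inv x := rfl
  right_inv f := by ext i; fin_cases i <;> rfl

theorem lineSolCoord_symm_lie (f h : Fin 3 → ℝ) :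
    ⁅lineSolCoord.symm f, lineSolCoord.symm h⁆ =
      lineSolCoord.symm ![0, f 0 * h 1 - f 1 * h 0, 0] := rfl

theorem lie_eq_of_standard {V : Type*} [LieRing V] [LieAlgebra ℝ V] (w : Module.Basis (Fin 3) ℝ V)
    (hw : ⁅w 0, w 1⁆ = w 1 ∧ ⁅w 0, w 2⁆ = 0 ∧ ⁅w 1, w 2⁆ = 0) (x y : V) :
    ⁅x, y⁆ = (w.repr x 0 * w.repr y 1 - w.repr x 1 * w.repr y 0) • w 1 := by
  obtain ⟨h01, h02, h12⟩ := hw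
  have h10 : ⁅w 1, w 0⁆ = -w 1 := by rw [← lie_skew, h01]
  have h20 : ⁅w 2, w 0⁆ = 0 := by rw [← lie_skew, h02, neg_zero]
  have h21 : ⁅w 2, w 1⁆ = 0 := by rw [← lie_skew, h12, neg_zero]
  conv_lhs => rw [← w.sum_repr x, ← w.sum_repr y, Fin.sum_univ_three, Fin.sum_univ_three]
  simp only [add_lie, lie_add, smul_lie, lie_smul, lie_self, h01, h02, h12, h10, h20, h21,
    smul_zero]
  module

theorem nonempty_equiv_iff_exists_standard {V : Type*} [LieRing V] [LieAlgebra ℝ V] :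
    Nonempty (V ≃ₗ⁅ℝ⁆ LieLine × LieSol2) ↔ ∃ w : Module.Basis (Fin 3) ℝ V,
      ⁅w 0, w 1⁆ = w 1 ∧ ⁅w 0, w 2⁆ = 0 ∧ ⁅w 1, w 2⁆ = 0 := by
  constructor
  · rintro ⟨e⟩
    let w : Module.Basis (Fin 3) ℝ V := Module.Basis.ofEquivFun (e.toLinearEquiv.trans lineSolCoord)
    have hw : ∀ i, w i = e.symm (lineSolCoord.symm (Pi.single i 1)) := fun i => by
      simp [w]; rfl
    refine ⟨w, ?_, ?_, ?_⟩
    · rw [hw, hw, ← LieEquiv.map_lie, lineSolCoord_symm_lie]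
      congr 2
      ext i; fin_cases i <;> simp
    · rw [hw, hw, ← LieEquiv.map_lie, lineSolCoord_symm_lie]
      have h0 : (![0, (Pi.single 0 1 : Fin 3 → ℝ) 0 * (Pi.single 2 1 : Fin 3 → ℝ) 1 -
          (Pi.single 0 1 : Fin 3 → ℝ) 1 * (Pi.single 2 1 : Fin 3 → ℝ) 0, 0] : Fin 3 → ℝ) = 0 := by
        ext i; fin_cases i <;> simp
      rw [h0, map_zero, map_zero]
    · rw [hw, hw, ← LieEquiv.map_lie, lineSolCoord_symm_lie]
      have h0 : (![0, (Pi.single 1 1 : Fin 3 → ℝ) 0 * (Pi.single 2 1 : Fin 3 → ℝ) 1 -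
          (Pi.single 1 1 : Fin 3 → ℝ) 1 * (Pi.single 2 1 : Fin 3 → ℝ) 0, 0] : Fin 3 → ℝ) = 0 := by
        ext i; fin_cases i <;> simp
      rw [h0, map_zero, map_zero]
  · rintro ⟨w, hw⟩
    let f : V ≃ₗ[ℝ] LieLine × LieSol2 := w.equivFun.trans lineSolCoord.symm
    refine ⟨{ f with map_lie' := ?_ }⟩
    intro x y
    show f ⁅x, y⁆ = ⁅lineSolCoord.symm (w.equivFun x), lineSolCoord.symm (w.equivFun y)⁆
    rw [lineSolCoord_symm_lie, lie_eq_of_standard w hw]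
    refine congrArg lineSolCoord.symm ?_
    ext i; fin_cases i <;> simp

end Model

/-! ### Left-invariant extension and existence of standard structures. -/

section Existence

variable {G : Type*} [TopologicalSpace G] [ChartedSpace (EuclideanSpace ℝ (Fin 3)) G]
  [Group G] [LieGroup (𝓡 3) ∞ G]

/-- The left-invariant bilinear form with value `B` at the identity. -/
def leftBilin (B : GroupLieAlgebra (𝓡 3) G →ₗ[ℝ] GroupLieAlgebra (𝓡 3) G →ₗ[ℝ] ℝ) :
    BilinField 3 G := fun p =>
  B.compl₁₂ (leftEquiv 3 p).symm.toLinearMap (leftEquiv 3 p).symm.toLinearMap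

/-- The left-invariant field of endomorphisms with value `J` at the identity. -/
def leftEnd (J : GroupLieAlgebra (𝓡 3) G →ₗ[ℝ] GroupLieAlgebra (𝓡 3) G) : EndField 3 G := fun p =>
  (leftEquiv 3 p).toLinearMap ∘ₗ J ∘ₗ (leftEquiv 3 p).symm.toLinearMap

/-- The left-invariant vector field with value `x` at the identity. -/
def leftVec (x : GroupLieAlgebra (𝓡 3) G) : VecField 3 G := fun p => leftEquiv 3 p x

theorem leftBilin_apply (B : GroupLieAlgebra (𝓡 3) G →ₗ[ℝ] GroupLieAlgebra (𝓡 3) G →ₗ[ℝ] ℝ) (p : G)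
    (x y : GroupLieAlgebra (𝓡 3) G) :
    leftBilin B p (leftEquiv 3 p x) (leftEquiv 3 p y) = B x y := by
  simp [leftBilin]

theorem leftBilin_one (B : GroupLieAlgebra (𝓡 3) G →ₗ[ℝ] GroupLieAlgebra (𝓡 3) G →ₗ[ℝ] ℝ)
    (x y : GroupLieAlgebra (𝓡 3) G) : leftBilin B 1 x y = B x y := by
  have := leftBilin_apply B 1 x y
  rwa [leftEquiv_one, leftEquiv_one] at this

theorem leftEnd_apply (J : GroupLieAlgebra (𝓡 3) G →ₗ[ℝ] GroupLieAlgebra (𝓡 3) G) (p : G)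
    (x : GroupLieAlgebra (𝓡 3) G) : leftEnd J p (leftEquiv 3 p x) = leftEquiv 3 p (J x) := by
  simp [leftEnd]

theorem leftEnd_one (J : GroupLieAlgebra (𝓡 3) G →ₗ[ℝ] GroupLieAlgebra (𝓡 3) G)
    (x : GroupLieAlgebra (𝓡 3) G) : leftEnd J 1 x = J x := by
  have := leftEnd_apply J 1 x
  rwa [leftEquiv_one, leftEquiv_one] at this

theorem leftVec_one (x : GroupLieAlgebra (𝓡 3) G) : leftVec x 1 = x := leftEquiv_one x

theorem leftInvBilin_leftBilin
    (B : GroupLieAlgebra (𝓡 3) G →ₗ[ℝ] GroupLieAlgebra (𝓡 3) G →ₗ[ℝ] ℝ) :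
    LeftInvBilin (leftBilin B) :=
  leftInvBilin_iff.2 fun p x y => by rw [leftBilin_apply, leftBilin_one]

theorem leftInvEnd_leftEnd (J : GroupLieAlgebra (𝓡 3) G →ₗ[ℝ] GroupLieAlgebra (𝓡 3) G) :
    LeftInvEnd (leftEnd J) :=
  leftInvEnd_iff.2 fun p x => by rw [leftEnd_apply, leftEnd_one]

theorem leftInvVec_leftVec (x : GroupLieAlgebra (𝓡 3) G) : LeftInvVec (leftVec x) :=
  leftInvVec_iff.2 fun p => by rw [leftVec_one]; rfl

theorem isAdaptedTo_left (B : GroupLieAlgebra (𝓡 3) G →ₗ[ℝ] GroupLieAlgebra (𝓡 3) G →ₗ[ℝ] ℝ)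
    (J : GroupLieAlgebra (𝓡 3) G →ₗ[ℝ] GroupLieAlgebra (𝓡 3) G) (x₀ : GroupLieAlgebra (𝓡 3) G)
    (h1 : ∀ x y, B (J x) y = - B x (J y)) (h2 : J x₀ = 0) (h3 : ∀ x, B x x₀ = 0 → J (J x) = -x) :
    IsAdaptedTo (leftBilin B) (leftEnd J) (leftVec x₀) := by
  intro p
  refine ⟨fun x y => ?_, ?_, fun x hx => ?_⟩
  · obtain ⟨x, rfl⟩ := (leftEquiv 3 p).surjective x
    obtain ⟨y, rfl⟩ := (leftEquiv 3 p).surjective y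
    rw [leftEnd_apply, leftEnd_apply, leftBilin_apply, leftBilin_apply, h1]
  · rw [leftVec, leftEnd_apply, h2, map_zero]
  · obtain ⟨x, rfl⟩ := (leftEquiv 3 p).surjective x
    rw [leftVec, leftBilin_apply] at hx
    rw [leftEnd_apply, leftEnd_apply, h3 x hx, map_neg]

/-- A single rotation serves as both `J₊` and `J₋`: being adapted to `w₂` does not depend on the
sign of the vector. -/
theorem exists_standard_structure {w : Module.Basis (Fin 3) ℝ (GroupLieAlgebra (𝓡 3) G)}
    (hw : IsStandardBasis w) {δ ε s : ℝ} (hδ : δ ≠ 0) (hε : ε = 1 ∨ ε = -1)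
    (hs : s = 1 ∨ s = -1) :
    ∃ (Γ 𝓕 : EndE 3 G) (g : BilinField 3 G) (Jp Jm : EndField 3 G) (Xp Xm : VecField 3 G),
      IsLeftInvGPK 0 0 Γ 𝓕 g Jp Jm Xp Xm ∧ KernelNondegenerate g ∧
      IsStandardMetric g w δ ε ε ∧ Xm 1 = w 2 ∧ Xp = s • Xm := by
  let B : GroupLieAlgebra (𝓡 3) G →ₗ[ℝ] GroupLieAlgebra (𝓡 3) G →ₗ[ℝ] ℝ :=
    w.constr ℝ ![(ε / δ ^ 2) • w.coord 0, ε • w.coord 1, w.coord 2]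
  -- The case `σ = 1` of `adapted_standard_form`; the weights `δ⁻¹` and `-δ` make it skew for `g(w₀,
  -- w₀) = ε / δ²`.
  let J : GroupLieAlgebra (𝓡 3) G →ₗ[ℝ] GroupLieAlgebra (𝓡 3) G :=
    w.constr ℝ ![δ⁻¹ • w 1, (-δ) • w 0, 0]
  have hB0 : B (w 0) = (ε / δ ^ 2) • w.coord 0 := w.constr_basis ℝ _ 0
  have hB1 : B (w 1) = ε • w.coord 1 := w.constr_basis ℝ _ 1
  have hB2 : B (w 2) = w.coord 2 := w.constr_basis ℝ _ 2
  have hJ0 : J (w 0) = δ⁻¹ • w 1 := w.constr_basis ℝ _ 0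
  have hJ1 : J (w 1) = (-δ) • w 0 := w.constr_basis ℝ _ 1
  have hJ2 : J (w 2) = 0 := w.constr_basis ℝ _ 2
  have hrep : ∀ x, x = w.repr x 0 • w 0 + w.repr x 1 • w 1 + w.repr x 2 • w 2 := fun x => by
    conv_lhs => rw [← w.sum_repr x, Fin.sum_univ_three]
  have hBx : ∀ x y, B x y = ε / δ ^ 2 * (w.repr x 0 * w.repr y 0) +
      ε * (w.repr x 1 * w.repr y 1) + w.repr x 2 * w.repr y 2 := by
    intro x y
    conv_lhs => rw [hrep x]
    simp only [map_add, map_smul, LinearMap.add_apply, LinearMap.smul_apply, hB0, hB1, hB2,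
      Module.Basis.coord_apply, smul_eq_mul]
    ring
  have hJx : ∀ x, J x = (-(δ * w.repr x 1)) • w 0 + (δ⁻¹ * w.repr x 0) • w 1 := by
    intro x
    conv_lhs => rw [hrep x]
    simp only [map_add, map_smul, hJ0, hJ1, hJ2]
    module
  have hr0 : ∀ x, w.repr (J x) 0 = -(δ * w.repr x 1) := fun x => by rw [hJx]; simp
  have hr1 : ∀ x, w.repr (J x) 1 = δ⁻¹ * w.repr x 0 := fun x => by rw [hJx]; simp
  have hr2 : ∀ x, w.repr (J x) 2 = 0 := fun x => by rw [hJx]; simp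
  have hadp := isAdaptedTo_left B J (w 2)
    (by
      intro x y
      rw [hBx, hBx, hr0, hr0, hr1, hr1, hr2, hr2]
      field_simp
      ring)
    hJ2
    (by
      intro x hx
      have hx2 : w.repr x 2 = 0 := by simpa [hBx] using hx
      rw [hJx (J x), hr0, hr1]
      conv_rhs => rw [hrep x, hx2]
      have e1 : -(δ * (δ⁻¹ * w.repr x 0)) = - w.repr x 0 := by field_simp
      have e2 : δ⁻¹ * -(δ * w.repr x 1) = - w.repr x 1 := by field_simp
      rw [e1, e2]
      module)
  have hadp' : IsAdaptedTo (leftBilin B) (leftEnd J) (s • leftVec (w 2)) := by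
    intro p
    obtain ⟨h1, h2, h3⟩ := hadp p
    have hs0 : s ≠ 0 := by rcases hs with h | h <;> rw [h] <;> norm_num
    refine ⟨h1, ?_, fun x hx => h3 x ?_⟩
    · rw [Pi.smul_apply, map_smul, h2, smul_zero]
    · rw [Pi.smul_apply, map_smul] at hx
      exact (smul_eq_zero.1 hx).resolve_left hs0
  have hstd : IsStandardMetric (leftBilin B) w δ ε ε := by
    refine ⟨?_, ?_, ?_, fun i j hij => ?_⟩
    · rw [leftBilin_one, hBx]; simp
    · rw [leftBilin_one, hBx]; simp
    · rw [leftBilin_one, hBx]; simp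
    · rw [leftBilin_one, hBx]
      fin_cases i <;> fin_cases j <;> simp at hij ⊢
  have hX : s • leftVec (w 2) = leftVec (w 2) ∨ s • leftVec (w 2) = - leftVec (w 2) := by
    rcases hs with rfl | rfl
    · left; rw [one_smul]
    · right; rw [neg_one_smul]
  obtain ⟨Γ, 𝓕, h, hk⟩ := exists_isLeftInvGPK (leftInvBilin_leftBilin B) (leftInvEnd_leftEnd J)
    (leftInvEnd_leftEnd J) ((leftInvVec_leftVec (w 2)).smul s) (leftInvVec_leftVec (w 2)) hadp' hadp
    hw hδ hε hε hstd (leftVec_one _) hX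
  exact ⟨Γ, 𝓕, _, _, _, _, _, h, hk, hstd, leftVec_one _, rfl⟩

end Existence

end BGen

end

theorem mainTheorem10 {G : Type*} [TopologicalSpace G] [ChartedSpace (EuclideanSpace ℝ (Fin 3)) G]
    [Group G] [LieGroup (𝓡 3) ∞ G] (hG : ¬ BGen.IsUnimodular 3 G) :
    -- existence of a structure
    ((∃ (H : BGen.DiffForm 3 G 3) (F : BGen.DiffForm 3 G 2) (Γ 𝓕 : BGen.EndE 3 G)
        (g : BGen.BilinField 3 G) (Jp Jm : BGen.EndField 3 G) (Xp Xm : BGen.VecField 3 G),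
        BGen.IsLeftInvGPK H F Γ 𝓕 g Jp Jm Xp Xm ∧ BGen.KernelNondegenerate g) ↔
      Nonempty (GroupLieAlgebra (𝓡 3) G ≃ₗ⁅ℝ⁆ LieLine × LieSol2)) ∧
    -- description of all structures
    (∀ (H : BGen.DiffForm 3 G 3) (F : BGen.DiffForm 3 G 2)
        (g : BGen.BilinField 3 G) (Jp Jm : BGen.EndField 3 G) (Xp Xm : BGen.VecField 3 G),
      (∃ Γ 𝓕 : BGen.EndE 3 G,
        BGen.IsLeftInvGPK H F Γ 𝓕 g Jp Jm Xp Xm ∧ BGen.KernelNondegenerate g) ↔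
      (H = 0 ∧ F = 0 ∧
        BGen.LeftInvBilin g ∧ BGen.LeftInvEnd Jp ∧ BGen.LeftInvEnd Jm ∧
        BGen.LeftInvVec Xp ∧ BGen.LeftInvVec Xm ∧
        BGen.IsAdaptedTo g Jp Xp ∧ BGen.IsAdaptedTo g Jm Xm ∧
        ∃ w : Module.Basis (Fin 3) ℝ (GroupLieAlgebra (𝓡 3) G), BGen.IsStandardBasis w ∧
          (∃ δ ε ε' : ℝ, δ ≠ 0 ∧ (ε = 1 ∨ ε = -1) ∧ (ε' = 1 ∨ ε' = -1) ∧
            BGen.IsStandardMetric g w δ ε ε') ∧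
          Xm 1 = w 2 ∧ (Xp = Xm ∨ Xp = -Xm))) ∧
    -- which parameters occur
    (∀ w : Module.Basis (Fin 3) ℝ (GroupLieAlgebra (𝓡 3) G), BGen.IsStandardBasis w →
      ∀ δ ε ε' s : ℝ, δ ≠ 0 → (ε = 1 ∨ ε = -1) → (ε' = 1 ∨ ε' = -1) → (s = 1 ∨ s = -1) →
      ((∃ (H : BGen.DiffForm 3 G 3) (F : BGen.DiffForm 3 G 2) (Γ 𝓕 : BGen.EndE 3 G)
          (g : BGen.BilinField 3 G) (Jp Jm : BGen.EndField 3 G) (Xp Xm : BGen.VecField 3 G),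
          BGen.IsLeftInvGPK H F Γ 𝓕 g Jp Jm Xp Xm ∧ BGen.KernelNondegenerate g ∧
          BGen.IsStandardMetric g w δ ε ε' ∧ Xm 1 = w 2 ∧ Xp = s • Xm) ↔ ε = ε')) := by
  refine ⟨⟨?_, ?_⟩, ?_, ?_⟩
  · rintro ⟨H, F, Γ, 𝓕, g, Jp, Jm, Xp, Xm, h, -⟩
    obtain ⟨-, -, -, -, ⟨w, hw, -, -⟩, -⟩ := h.description hG
    exact BGen.nonempty_equiv_iff_exists_standard.2 ⟨w, hw⟩
  · intro he
    obtain ⟨w, hw⟩ := BGen.nonempty_equiv_iff_exists_standard.1 he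
    obtain ⟨Γ, 𝓕, g, Jp, Jm, Xp, Xm, h, hk, -⟩ :=
      BGen.exists_standard_structure (w := w) hw (δ := 1) (ε := 1) (s := 1) one_ne_zero
        (Or.inl rfl) (Or.inl rfl)
    exact ⟨0, 0, Γ, 𝓕, g, Jp, Jm, Xp, Xm, h, hk⟩
  · intro H F g Jp Jm Xp Xm
    constructor
    · rintro ⟨Γ, 𝓕, h, -⟩
      obtain ⟨hH, hF, hp, hm, ⟨w, hw, hwg, hXw⟩, hX⟩ := h.description hG
      exact ⟨hH, hF, h.left_g, h.left_Jp, h.left_Jm, h.left_Xp, h.left_Xm, hp, hm, w, hw, hwg,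
        hXw, hX⟩
    · rintro ⟨rfl, rfl, lg, lp, lm, lXp, lXm, hp, hm, w, hw, ⟨δ, ε, ε', hδ, hε, hε', hwg⟩, hXw, hX⟩
      exact BGen.exists_isLeftInvGPK lg lp lm lXp lXm hp hm hw hδ hε hε' hwg hXw hX
  · intro w hw δ ε ε' s hδ hε hε' hs
    constructor
    · rintro ⟨H, F, Γ, 𝓕, g, Jp, Jm, Xp, Xm, h, -, ⟨g00, g11, g22, gij⟩, hXw, -⟩
      -- The existence of `J₋` alone already forces the two signs to be equal.
      obtain ⟨-, -, -, hm, -⟩ := h.description hG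
      obtain ⟨m1, m2, m3⟩ := hm 1
      rw [hXw] at m2 m3
      exact (BGen.adapted_standard_form (V := GroupLieAlgebra (𝓡 3) G) hδ hε hε' g00 g11 g22 gij
        m1 m2 m3).1
    · rintro rfl
      exact ⟨0, 0, BGen.exists_standard_structure hw hδ hε hs⟩
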